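/- All manifolds are smooth, finite dimensional, Hausdorff and paracompact; $M$ is a connected manifold, $G$ and $H$ are connected Lie groups with universal covering groups $\rho_G:\widetilde G\to G$, $\rho_H:\widetilde H\to H$, and $\iota:H\hookrightarrow G$ is the inclusion of a Lie subgroup (an injective homomorphism of Lie groups) such that $\iota_*:\pi_1(H)\to\pi_1(G)$ is an isomorphism. A spinor structure of a principal $G$-bundle $\pi_P:P\to M$ is a principal $\widetilde G$-bundle $\pi_Q:Q\to M$ with a smooth map $u:Q\to P$ (the spinor map) such that $\pi_P\circ u=\pi_Q$ and $u(q\tilde g)=u(q)\rho_G(\tilde g)$; two spinor structures $(Q,u)$, $(Q',u')$ are equivalent if there is a morphism of principal bundles $a:Q\to Q'$ with $u'\circ a=u$. Let $\pi_P:P\to M$ be a principal $G$-bundle and $\pi_R:R\to M$ a principal $H$-bundle that is a reduction of $P$ via $\kappa:R\to P$, i.e. $\kappa$ is smooth, $\pi_P\circ\kappa=\pi_R$ and $\kappa(rh)=\kappa(r)\iota(h)$. Fix $r_0\in R$, put $p_0=\kappa(r_0)$, $m_0=\pi_R(r_0)$, and let $i_R(h)=r_0h$, $i_P(g)=p_0g$.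 **(1)** The diagram $$\begin{array}{ccccccc} \pi_2(M)&\xrightarrow{h_{H*}}&\pi_1(H)&\xrightarrow{i_{R*}}&\pi_1(R)&\xrightarrow{\pi_{R*}}&\pi_1(M)\\ \|&&\downarrow{\scriptstyle\iota_*}&&\downarrow{\scriptstyle\kappa_*}&&\|\\ \pi_2(M)&\xrightarrow{h_{G*}}&\pi_1(G)&\xrightarrow{i_{P*}}&\pi_1(P)&\xrightarrow{\pi_{P*}}&\pi_1(M) \end{array}$$ commutes, and $\kappa_*:\pi_1(R,r_0)\to\pi_1(P,p_0)$ is an isomorphism. Here $h_{H*},h_{G*}$ are the connecting homomorphisms: $h_{G*}(a)=b$ if and only if some representative of $a$ lifts to a square in $P$ that is constantly $p_0$ on three sides and equal to $t\mapsto p_0\gamma(t)$ on the fourth, where $\gamma$ is a loop in $G$ representing $b$ (and similarly for $h_{H*}$); that these are well defined homomorphisms on $\pi_2(M)$ is part of the claim. **(2)** A subgroup $K\le\pi_1(R)$ satisfies (i) $\pi_{R*}|_K:K\to\pi_1(M)$ is an isomorphism, (ii) $K\cap i_{R*}(\pi_1(H))=\{e\}$, (iii) $\pi_1(R)=K\times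 i_{R*}(\pi_1(H))$ (internal direct product) if and only if $\kappa_*(K)\le\pi_1(P)$ satisfies (i) $\pi_{P*}|_{\kappa_*(K)}:\kappa_*(K)\to\pi_1(M)$ is an isomorphism, (ii) $\kappa_*(K)\cap i_{P*}(\pi_1(G))=\{e\}$, (iii) $\pi_1(P)=\kappa_*(K)\times i_{P*}(\pi_1(G))$. Moreover $R$ has a spinor structure if and only if $P$ has one. **(3)** There is a bijection between the equivalence classes of spinor structures of $R$ and those of $P$, under which the class of $(S,u_S)$ corresponds to the class of $(Q,u_Q)$ if and only if $\kappa_*\bigl(u_{S*}\pi_1(S)\bigr)=u_{Q*}\pi_1(Q)$ in $\pi_1(P,p_0)$ (for all base points of $S$ over $r_0$ and of $Q$ over $p_0$). If $S$ and $Q$ correspond, then $S$ is a reduction of $Q$: there are an injective homomorphism of Lie groups $\tilde\iota:\widetilde H\to\widetilde G$ with $\rho_G\circ\tilde\iota=\iota\circ\rho_H$, not depending on $S$ and $Q$, and a smooth map $\tilde\kappa:S\to Q$ over $M$ with $\tilde\kappa(s\tilde h)=\tilde\kappa(s)\tilde\iota(\tilde h)$ and $u_Q\circ\tilde\kappa=\kappa\circ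 u_S$. **(4)** Let $M$ be a connected oriented $4$-manifold, $F^+M$ its bundle of oriented frames (a principal $GL^+(4,\mathbb R)$-bundle), and let $R$ be a Lorentz structure on $M$ compatible with the orientation, i.e. a reduction $\kappa:R\to F^+M$ to $SO_0(1,3)$, the identity component of $SO(1,3)$. Then $R$ has a spinor structure if and only if $F^+M$ has a spinor structure (for the universal covering group $\widetilde{GL}{}^+(4,\mathbb R)$). In this case every spinor structure of $R$ is a reduction, in the sense of (3), of a spinor structure of $F^+M$. -/

import Mathlib

open scoped Manifold ContDiff Topology
open MulOpposite

universe u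

section Bundles

variable {EG EH EM ER EP : Type*}
  [NormedAddCommGroup EG] [NormedSpace ℝ EG] [NormedAddCommGroup EH] [NormedSpace ℝ EH]
  [NormedAddCommGroup EM] [NormedSpace ℝ EM] [NormedAddCommGroup EP] [NormedSpace ℝ EP]
  [NormedAddCommGroup ER] [NormedSpace ℝ ER]
  {G : Type*} [Group G] [TopologicalSpace G] [ChartedSpace EG G]
  {H : Type*} [Group H] [TopologicalSpace H] [ChartedSpace EH H]
  {M : Type*} [TopologicalSpace M] [ChartedSpace EM M]
  {P : Type*} [TopologicalSpace P] [ChartedSpace EP P] [MulAction Gᵐᵒᵖ P]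
  {R : Type*} [TopologicalSpace R] [ChartedSpace ER R] [MulAction Hᵐᵒᵖ R]

variable (EG EM EP G) in
/-- `π : P → M` is a smooth principal fibre bundle with structure group `G`. The right action
`p g` of `G` on `P` is written `op g • p`. -/
structure IsPrincipalBundle (π : P → M) : Prop where
  surjective : Function.Surjective π
  contMDiff_proj : ContMDiff 𝓘(ℝ, EP) 𝓘(ℝ, EM) ∞ π
  contMDiff_act : ContMDiff (𝓘(ℝ, EP).prod 𝓘(ℝ, EG)) 𝓘(ℝ, EP) ∞
    (fun x : P × G => op x.2 • x.1)
  proj_act : ∀ (p : P) (g : G), π (op g • p) = π p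
  transitive : ∀ p p' : P, π p = π p' → ∃ g : G, op g • p = p'
  free : ∀ (p : P) (g : G), op g • p = p → g = 1
  locally_trivial : ∀ m₀ : M, ∃ U : Set M, IsOpen U ∧ m₀ ∈ U ∧
    ∃ φ : PartialDiffeomorph (𝓘(ℝ, EM).prod 𝓘(ℝ, EG)) 𝓘(ℝ, EP) (M × G) P ∞,
      φ.source = U ×ˢ Set.univ ∧ φ.target = π ⁻¹' U ∧
      ∀ m ∈ U, ∀ g : G, π (φ (m, g)) = m ∧ φ (m, g) = op g • φ (m, 1)

theorem IsPrincipalBundle.continuous_orbit {π : P → M} (hP : IsPrincipalBundle EG EM EP G π)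
    (p : P) : Continuous (fun g : G => op g • p) :=
  hP.contMDiff_act.continuous.comp (by fun_prop : Continuous fun g : G => (p, g))

variable (ER EP) in
/-- `κ` is a smooth map over the identity of the base that is equivariant relative to the
homomorphism `ι` of structure groups: a principal bundle morphism relative to `ι`. If `ι` is the
inclusion of a Lie subgroup, this says that `κ` makes `πR` a reduction of `πP`. -/
structure IsBundleMorphism (πR : R → M) (πP : P → M) (ι : H →* G) (κ : R → P) : Prop where
  contMDiff : ContMDiff 𝓘(ℝ, ER) 𝓘(ℝ, EP) ∞ κ
  proj : ∀ r, πP (κ r) = πR r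
  act : ∀ (r : R) (h : H), κ (op h • r) = op (ι h) • κ r

end Bundles

/-- `ρ : Gt → G` is the universal covering group of the Lie group `G`: a homomorphism of Lie
groups that is a smooth covering map with simply connected total space. -/
structure IsUniversalCover (EGt EG : Type*) [NormedAddCommGroup EGt] [NormedSpace ℝ EGt]
    [NormedAddCommGroup EG] [NormedSpace ℝ EG]
    {Gt : Type*} [Group Gt] [TopologicalSpace Gt] [ChartedSpace EGt Gt]
    {G : Type*} [Group G] [TopologicalSpace G] [ChartedSpace EG G] (ρ : Gt →* G) : Prop where
  simplyConnected : SimplyConnectedSpace Gt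
  isCoveringMap : IsCoveringMap ρ
  isLocalDiffeomorph : IsLocalDiffeomorph 𝓘(ℝ, EGt) 𝓘(ℝ, EG) ∞ ρ

/-- A spinor structure for the principal bundle `π : P → M` with group `G`, relative to the
universal covering `ρ : Gt → G`: a smooth principal bundle `Q → M` with group `Gt` and a bundle
morphism `Q → P` relative to `ρ`. As `Gt` and `G` have the same dimension, so have `Q` and `P`,
and the manifold `Q` is modelled on the same vector space as `P`. -/
structure SpinorStructure (EGt EM EP : Type*) [NormedAddCommGroup EGt] [NormedSpace ℝ EGt]
    [NormedAddCommGroup EM] [NormedSpace ℝ EM] [NormedAddCommGroup EP] [NormedSpace ℝ EP]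
    {Gt : Type*} [Group Gt] [TopologicalSpace Gt] [ChartedSpace EGt Gt]
    {G : Type*} [Group G]
    {M : Type*} [TopologicalSpace M] [ChartedSpace EM M]
    {P : Type u} [TopologicalSpace P] [ChartedSpace EP P] [MulAction Gᵐᵒᵖ P]
    (π : P → M) (ρ : Gt →* G) where
  /-- the total space -/
  Q : Type u
  [topologicalSpace : TopologicalSpace Q]
  [chartedSpace : ChartedSpace EP Q]
  [isManifold : IsManifold 𝓘(ℝ, EP) ∞ Q]
  [t2Space : T2Space Q]
  [paracompactSpace : ParacompactSpace Q]
  [mulAction : MulAction Gtᵐᵒᵖ Q]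
  /-- the bundle projection -/
  proj : Q → M
  isPrincipalBundle : IsPrincipalBundle EGt EM EP Gt proj
  /-- the spinor map -/
  spinorMap : Q → P
  isBundleMorphism : IsBundleMorphism EP EP proj π ρ spinorMap

attribute [instance] SpinorStructure.topologicalSpace SpinorStructure.chartedSpace
  SpinorStructure.isManifold SpinorStructure.t2Space SpinorStructure.paracompactSpace
  SpinorStructure.mulAction

section Equivalence

variable {EG EM EP EP' : Type*}
  [NormedAddCommGroup EG] [NormedSpace ℝ EG] [NormedAddCommGroup EM] [NormedSpace ℝ EM]
  [NormedAddCommGroup EP] [NormedSpace ℝ EP] [NormedAddCommGroup EP'] [NormedSpace ℝ EP']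
  {G : Type*} [Group G] [TopologicalSpace G] [ChartedSpace EG G] [LieGroup 𝓘(ℝ, EG) ∞ G]
  {M : Type*} [TopologicalSpace M] [ChartedSpace EM M]
  {P : Type*} [TopologicalSpace P] [ChartedSpace EP P] [MulAction Gᵐᵒᵖ P]
  {P' : Type*} [TopologicalSpace P'] [ChartedSpace EP' P'] [MulAction Gᵐᵒᵖ P']

/-- Bundle morphisms over the identity of base and structure group are invertible. -/
theorem IsBundleMorphism.exists_inverse {π : P → M} {π' : P' → M} {a : P → P'}
    (hP : IsPrincipalBundle EG EM EP G π) (hP' : IsPrincipalBundle EG EM EP' G π')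
    (ha : IsBundleMorphism EP EP' π π' (MonoidHom.id G) a) :
    ∃ b : P' → P, IsBundleMorphism EP' EP π' π (MonoidHom.id G) b ∧ ∀ p', a (b p') = p' := by
  have hinj : Function.Injective a := by
    intro p q hpq
    have h1 : π p = π q := by rw [← ha.proj, ← ha.proj, hpq]
    obtain ⟨g, rfl⟩ := hP.transitive p q h1
    have h2 := ha.act p g
    rw [← hpq, MonoidHom.id_apply] at h2
    rw [hP'.free _ _ h2.symm, op_one, one_smul]
  have hsurj : Function.Surjective a := by
    intro p'
    obtain ⟨p, hp⟩ := hP.surjective (π' p')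
    obtain ⟨g, hg⟩ := hP'.transitive (a p) p' (by rw [ha.proj, hp])
    exact ⟨op g • p, by rw [ha.act]; exact hg⟩
  choose b hb using hsurj
  have hbp : ∀ p', π (b p') = π' p' := fun p' => by rw [← ha.proj, hb]
  have hbu : ∀ p p', a p = p' → b p' = p := fun p p' h => hinj (by rw [hb, h])
  refine ⟨b, ⟨?_, hbp, fun r h => hbu _ _ (by rw [ha.act, hb]; rfl)⟩, hb⟩
  intro q₀
  obtain ⟨U, hU, hmU, φ, hφs, hφt, hφ⟩ := hP.locally_trivial (π' q₀)
  obtain ⟨U', hU', hmU', φ', hφs', hφt', hφ'⟩ := hP'.locally_trivial (π' q₀)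
  have hVo : IsOpen (π' ⁻¹' (U ∩ U')) :=
    (hU.inter hU').preimage hP'.contMDiff_proj.continuous
  have h1 : ContMDiffAt 𝓘(ℝ, EP') 𝓘(ℝ, EM) ∞ π' q₀ := hP'.contMDiff_proj q₀
  have hσ : ContMDiffAt 𝓘(ℝ, EM) 𝓘(ℝ, EP) ∞ (fun m => φ (m, (1 : G))) (π' q₀) := by
    have h2 : ContMDiffAt (𝓘(ℝ, EM).prod 𝓘(ℝ, EG)) 𝓘(ℝ, EP) ∞ φ (π' q₀, (1 : G)) :=
      φ.contMDiffOn_toFun.contMDiffAt (φ.open_source.mem_nhds (by rw [hφs]; exact ⟨hmU, trivial⟩))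
    exact h2.comp (π' q₀) (contMDiffAt_id.prodMk contMDiffAt_const)
  have hπσ : π (φ (π' q₀, (1 : G))) = π' q₀ := (hφ _ hmU 1).1
  have hψ : ∀ q, π' q = π' q₀ →
      ContMDiffAt 𝓘(ℝ, EP') 𝓘(ℝ, EG) ∞ (fun q => (φ'.invFun q).2) q := by
    intro q hq
    have h2 : ContMDiffAt 𝓘(ℝ, EP') (𝓘(ℝ, EM).prod 𝓘(ℝ, EG)) ∞ φ'.invFun q :=
      φ'.contMDiffOn_invFun.contMDiffAt (φ'.open_target.mem_nhds (by
        rw [hφt']; change π' q ∈ U'; rwa [hq]))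
    exact h2.snd
  have hc : ContMDiffAt 𝓘(ℝ, EM) 𝓘(ℝ, EG) ∞
      (fun m => (φ'.invFun (a (φ (m, (1 : G))))).2) (π' q₀) :=
    ContMDiffAt.comp (π' q₀) (g := fun q => (φ'.invFun q).2) (hψ _ (by rw [ha.proj, hπσ]))
      (ContMDiffAt.comp (π' q₀) (g := a) (ha.contMDiff _) hσ)
  have hmain : ContMDiffAt 𝓘(ℝ, EP') 𝓘(ℝ, EP) ∞
      (fun q => op ((φ'.invFun (a (φ (π' q, (1 : G))))).2⁻¹ * (φ'.invFun q).2) •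
        φ (π' q, (1 : G))) q₀ := by
    have h3 : ContMDiffAt 𝓘(ℝ, EP') 𝓘(ℝ, EG) ∞
      (fun q => (φ'.invFun (a (φ (π' q, (1 : G))))).2⁻¹ * (φ'.invFun q).2) q₀ :=
      ((ContMDiffAt.comp q₀
        (g := fun m => (φ'.invFun (a (φ (m, (1 : G))))).2) hc h1).inv).mul (hψ q₀ rfl)
    have h4 : ContMDiffAt 𝓘(ℝ, EP') 𝓘(ℝ, EP) ∞ (fun q => φ (π' q, (1 : G))) q₀ :=
      ContMDiffAt.comp q₀ (g := fun m => φ (m, (1 : G))) hσ h1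
    exact ContMDiffAt.comp q₀ (g := fun x : P × G => op x.2 • x.1) (hP.contMDiff_act _) (h4.prodMk h3)
  refine hmain.congr_of_eventuallyEq ?_
  filter_upwards [hVo.mem_nhds ⟨hmU, hmU'⟩] with q hq
  have key : ∀ q, π' q ∈ U' → op (φ'.invFun q).2 • φ' (π' q, (1 : G)) = q := by
    intro q hq
    have hq' : q ∈ φ'.target := by rw [hφt']; exact hq
    have e1 : φ' (φ'.invFun q) = q := φ'.right_inv hq'
    have e2 : φ'.invFun q ∈ φ'.source := φ'.map_target hq'
    rw [hφs'] at e2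
    have e3 := hφ' _ e2.1 (φ'.invFun q).2
    have e4 : (φ'.invFun q).1 = π' q := by
      rw [← e3.1]
      change π' (φ' (φ'.invFun q)) = _
      rw [e1]
    rw [← e4, ← e3.2]
    exact e1
  have k1 := key q hq.2
  have k0 : π' (a (φ (π' q, (1 : G)))) = π' q := by rw [ha.proj, (hφ _ hq.1 1).1]
  have k2 := key (a (φ (π' q, (1 : G)))) (by rw [k0]; exact hq.2)
  rw [k0] at k2
  apply hbu
  rw [ha.act, MonoidHom.id_apply, op_mul, mul_smul, op_inv]
  rw [← eq_inv_smul_iff.mpr k2]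
  exact k1

end Equivalence

namespace SpinorStructure

variable {EGt EM EP : Type*} [NormedAddCommGroup EGt] [NormedSpace ℝ EGt]
    [NormedAddCommGroup EM] [NormedSpace ℝ EM] [NormedAddCommGroup EP] [NormedSpace ℝ EP]
    {Gt : Type*} [Group Gt] [TopologicalSpace Gt] [ChartedSpace EGt Gt]
    {G : Type*} [Group G]
    {M : Type*} [TopologicalSpace M] [ChartedSpace EM M]
    {P : Type u} [TopologicalSpace P] [ChartedSpace EP P] [MulAction Gᵐᵒᵖ P]
    {π : P → M} {ρ : Gt →* G}

/-- Spinor structures are equivalent if there is a principal bundle morphism between them that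
is compatible with the spinor maps. -/
def Equivalent (S T : SpinorStructure EGt EM EP π ρ) : Prop :=
  ∃ a : S.Q → T.Q, IsBundleMorphism EP EP S.proj T.proj (MonoidHom.id Gt) a ∧
    ∀ q, T.spinorMap (a q) = S.spinorMap q

instance setoid [LieGroup 𝓘(ℝ, EGt) ∞ Gt] : Setoid (SpinorStructure EGt EM EP π ρ) where
  r := Equivalent
  iseqv :=
    { refl := fun _ => ⟨id, ⟨contMDiff_id, fun _ => rfl, fun _ _ => rfl⟩, fun _ => rfl⟩
      symm := fun {S T} ⟨_, ha, hu⟩ => by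
        obtain ⟨b, hb, hab⟩ := ha.exists_inverse S.isPrincipalBundle T.isPrincipalBundle
        exact ⟨b, hb, fun q => by rw [← hu, hab]⟩
      trans := fun ⟨a, ha, hu⟩ ⟨b, hb, hv⟩ =>
        ⟨b ∘ a, ⟨hb.contMDiff.comp ha.contMDiff,
          fun q => by rw [Function.comp_apply, hb.proj, ha.proj],
          fun q g => by rw [Function.comp_apply, ha.act, hb.act]; rfl⟩,
          fun q => by rw [Function.comp_apply, hv, hu]⟩ }

/-- The set of equivalence classes of spinor structures. -/
abbrev Classes (EGt EM EP : Type*) [NormedAddCommGroup EGt] [NormedSpace ℝ EGt]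
    [NormedAddCommGroup EM] [NormedSpace ℝ EM] [NormedAddCommGroup EP] [NormedSpace ℝ EP]
    {Gt : Type*} [Group Gt] [TopologicalSpace Gt] [ChartedSpace EGt Gt]
    [LieGroup 𝓘(ℝ, EGt) ∞ Gt] {G : Type*} [Group G]
    {M : Type*} [TopologicalSpace M] [ChartedSpace EM M]
    {P : Type u} [TopologicalSpace P] [ChartedSpace EP P] [MulAction Gᵐᵒᵖ P]
    (π : P → M) (ρ : Gt →* G) :=
  Quotient (setoid (EGt := EGt) (EM := EM) (EP := EP) (π := π) (ρ := ρ))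

end SpinorStructure

section FundamentalGroups

/-- The homomorphism `f_*` of fundamental groups induced by a continuous map with `f x = y`. -/
noncomputable def pi1Map {X Y : Type*} [TopologicalSpace X] [TopologicalSpace Y] (f : X → Y)
    (hf : Continuous f) {x : X} {y : Y} (h : f x = y) :
    FundamentalGroup X x →* FundamentalGroup Y y :=
  FundamentalGroup.mapOfEq ⟨f, hf⟩ h

/-- `b ∈ π₁(G)` is an image of `a ∈ π₂(M)` under the connecting map of the bundle `π : P → M`:
some representative `A` of `a` lifts to a square `F` in `P` which is constantly `p₀` on three
sides of the square, and whose fourth side is `t ↦ p₀ γ(t)` with `γ` a loop representing `b`. -/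
def ConnectingRel {G M P : Type*} [Group G] [TopologicalSpace G] [TopologicalSpace M]
    [TopologicalSpace P] [MulAction Gᵐᵒᵖ P] (π : P → M) (p₀ : P) {m₀ : M}
    (a : π_ 2 M m₀) (b : FundamentalGroup G 1) : Prop :=
  ∃ (A : GenLoop (Fin 2) M m₀) (F : C(unitInterval × unitInterval, P)) (γ : Path (1 : G) 1),
    (Quotient.mk _ A : HomotopyGroup (Fin 2) M m₀) = a ∧
    FundamentalGroup.fromPath (Path.Homotopic.Quotient.mk γ) = b ∧
    (∀ s t, π (F (s, t)) = A ![s, t]) ∧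
    (∀ t, F (0, t) = p₀) ∧ (∀ s, F (s, 0) = p₀) ∧ (∀ s, F (s, 1) = p₀) ∧
    ∀ t, F (1, t) = op (γ t) • p₀

/-- `K` is a subgroup of `Γ` mapped isomorphically by `p`, and `Γ` is the internal direct
product of `K` and the image of `i`. -/
structure IsSplitting {A Γ B : Type*} [Group A] [Group Γ] [Group B] (i : A →* Γ) (p : Γ →* B)
    (K : Subgroup Γ) : Prop where
  bijective : Function.Bijective (p.comp K.subtype)
  inf_eq_bot : K ⊓ i.range = ⊥
  commute : ∀ x ∈ K, ∀ y ∈ i.range, Commute x y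
  sup_eq_top : K ⊔ i.range = ⊤

variable {EG EH EM ER EP : Type*}
  [NormedAddCommGroup EG] [NormedSpace ℝ EG] [NormedAddCommGroup EM] [NormedSpace ℝ EM]
  [NormedAddCommGroup ER] [NormedSpace ℝ ER] [NormedAddCommGroup EP] [NormedSpace ℝ EP]
  {G : Type*} [Group G] [TopologicalSpace G] [ChartedSpace EG G]
  {H : Type*} [Group H]
  {M : Type*} [TopologicalSpace M] [ChartedSpace EM M]
  {P : Type*} [TopologicalSpace P] [ChartedSpace EP P] [MulAction Gᵐᵒᵖ P]
  {R : Type*} [TopologicalSpace R] [ChartedSpace ER R] [MulAction Hᵐᵒᵖ R]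

/-- The homomorphism `i_* : π₁(G) → π₁(P, p)` induced by `g ↦ p g`. -/
noncomputable def IsPrincipalBundle.orbitPi1 {π : P → M} (hP : IsPrincipalBundle EG EM EP G π)
    (p : P) : FundamentalGroup G 1 →* FundamentalGroup P p :=
  pi1Map (fun g : G => op g • p) (hP.continuous_orbit p) (by rw [op_one, one_smul])

/-- The homomorphism `π_* : π₁(P, p) → π₁(M, m)` induced by the projection. -/
noncomputable def IsPrincipalBundle.projPi1 {π : P → M} (hP : IsPrincipalBundle EG EM EP G π)
    {p : P} {m : M} (h : π p = m) : FundamentalGroup P p →* FundamentalGroup M m :=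
  pi1Map π hP.contMDiff_proj.continuous h

/-- The homomorphism `κ_* : π₁(R, r) → π₁(P, p)` induced by a bundle morphism. -/
noncomputable def IsBundleMorphism.pi1 {πR : R → M} {πP : P → M} {ι : H →* G} {κ : R → P}
    (hκ : IsBundleMorphism ER EP πR πP ι κ) {r : R} {p : P} (h : κ r = p) :
    FundamentalGroup R r →* FundamentalGroup P p :=
  pi1Map κ hκ.contMDiff.continuous h

end FundamentalGroups

section OpenSubgroups

variable {E G : Type*} [NormedAddCommGroup E] [NormedSpace ℝ E] [Group G] [TopologicalSpace G]
  [ChartedSpace E G]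

/-- The smooth structure of an open subgroup of a Lie group. -/
@[reducible] noncomputable def openSubgroupChartedSpace (S : Subgroup G) (hS : IsOpen (S : Set G)) :
    ChartedSpace E S :=
  inferInstanceAs (ChartedSpace E (⟨S, hS⟩ : TopologicalSpace.Opens G))

theorem openSubgroup_contMDiff_coe (S : Subgroup G) (hS : IsOpen (S : Set G)) :
    letI := openSubgroupChartedSpace (E := E) S hS
    ContMDiff 𝓘(ℝ, E) 𝓘(ℝ, E) ∞ (fun x : S => (x : G)) :=
  contMDiff_subtype_val (U := (⟨S, hS⟩ : TopologicalSpace.Opens G))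

theorem openSubgroup_lieGroup [LieGroup 𝓘(ℝ, E) ∞ G] (S : Subgroup G)
    (hS : IsOpen (S : Set G)) :
    letI := openSubgroupChartedSpace (E := E) S hS
    LieGroup 𝓘(ℝ, E) ∞ S := by
  let _ := openSubgroupChartedSpace (E := E) S hS
  have hv := openSubgroup_contMDiff_coe (E := E) S hS
  have : IsManifold 𝓘(ℝ, E) ∞ S :=
    inferInstanceAs (IsManifold 𝓘(ℝ, E) ∞ (⟨S, hS⟩ : TopologicalSpace.Opens G))
  have : ContMDiffMul 𝓘(ℝ, E) ∞ S :=
    { contMDiff_mul := (ContMDiff.subtypeVal_comp_iff (⟨S, hS⟩ : TopologicalSpace.Opens G) _).1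
        ((hv.comp contMDiff_fst).mul (hv.comp contMDiff_snd)) }
  exact { contMDiff_inv := (ContMDiff.subtypeVal_comp_iff (⟨S, hS⟩ : TopologicalSpace.Opens G) _).1
            hv.inv }

end OpenSubgroups

section LinearGroups

/-- The vector space `ℝ⁴`. -/
abbrev E4 : Type := EuclideanSpace ℝ (Fin 4)

/-- The algebra of endomorphisms of `ℝ⁴`. -/
abbrev End4 : Type := E4 →L[ℝ] E4

/-- The group `GL⁺(4, ℝ)`. -/
def GLplus : Subgroup End4ˣ where
  carrier := {g | 0 < (g : End4).det}
  one_mem' := by simp [ContinuousLinearMap.det]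
  mul_mem' {a b} ha hb := by
    have : ((a * b : End4ˣ) : End4).det = (a : End4).det * (b : End4).det :=
      LinearMap.det_comp _ _
    rw [Set.mem_ofPred_eq, this]
    exact mul_pos ha hb
  inv_mem' {a} ha := by
    have h : (a : End4).det * ((a⁻¹ : End4ˣ) : End4).det = 1 := by
      rw [ContinuousLinearMap.det, ContinuousLinearMap.det, ← LinearMap.det_comp]
      have : ((a : End4) : E4 →ₗ[ℝ] E4) ∘ₗ ((a⁻¹ : End4ˣ) : End4) = LinearMap.id := by
        have := congrArg (fun f : End4 => (f : E4 →ₗ[ℝ] E4)) a.mul_inv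
        exact this
      rw [this, LinearMap.det_id]
    exact (pos_iff_pos_of_mul_pos (h ▸ one_pos)).1 ha

theorem isOpen_GLplus : IsOpen (GLplus : Set End4ˣ) :=
  isOpen_lt continuous_const (ContinuousLinearMap.continuous_det.comp Units.continuous_val)

noncomputable instance : ChartedSpace End4 GLplus := openSubgroupChartedSpace GLplus isOpen_GLplus

instance : LieGroup 𝓘(ℝ, End4) ∞ GLplus := openSubgroup_lieGroup GLplus isOpen_GLplus

/-- The inner product of signature `(1, 3)` on `ℝ⁴`. -/
def lorentzForm (x y : E4) : ℝ := x 0 * y 0 - x 1 * y 1 - x 2 * y 2 - x 3 * y 3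

/-- The group `O(1, 3)`. -/
def O13 : Subgroup End4ˣ where
  carrier := {g | ∀ x y, lorentzForm ((g : End4) x) ((g : End4) y) = lorentzForm x y}
  one_mem' := fun _ _ => rfl
  mul_mem' {a b} ha hb := fun x y => (ha _ _).trans (hb x y)
  inv_mem' {a} ha := fun x y => by
    rw [← ha]
    have h : ∀ z, (a : End4) (((a⁻¹ : End4ˣ) : End4) z) = z := fun z =>
      congrArg (fun f : End4 => f z) a.mul_inv
    rw [h, h]

/-- The Lie algebra `so(1, 3)`. -/
def so13 : Submodule ℝ End4 where
  carrier := {X | ∀ x y, lorentzForm (X x) y + lorentzForm x (X y) = 0}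
  zero_mem' := fun x y => by simp [lorentzForm]
  add_mem' {X Y} hX hY := fun x y => by
    have h1 := hX x y
    have h2 := hY x y
    simp only [lorentzForm, add_apply, PiLp.add_apply] at *
    linarith
  smul_mem' c X hX := fun x y => by
    have h1 := hX x y
    simp only [lorentzForm, smul_apply, PiLp.smul_apply, smul_eq_mul] at *
    linear_combination c * h1

/-- The Cayley transform. -/
noncomputable def cayley (A : End4) : End4 := (1 - A) * Ring.inverse (1 + A)

theorem contDiffAt_cayley {A : End4} (hA : IsUnit (1 + A)) : ContDiffAt ℝ ∞ cayley A := by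
  obtain ⟨u, hu⟩ := hA
  have h1 : ContDiffAt ℝ ∞ (Ring.inverse : End4 → End4) (1 + A) := hu ▸ contDiffAt_ringInverse ℝ u
  have h2 : ContDiffAt ℝ ∞ (fun A : End4 => Ring.inverse (1 + A)) A :=
    h1.comp A (contDiffAt_const.add contDiffAt_id)
  exact (contDiffAt_const.sub contDiffAt_id).mul h2

theorem cayley_mul {A : End4} (hA : IsUnit (1 + A)) : cayley A * (1 + A) = 1 - A := by
  rw [cayley, mul_assoc, Ring.inverse_mul_cancel _ hA, mul_one]

theorem one_add_cayley {A : End4} (hA : IsUnit (1 + A)) : (1 + cayley A) * (1 + A) = 2 := by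
  rw [add_mul, one_mul, cayley_mul hA, add_add_sub_cancel, one_add_one_eq_two]

theorem one_sub_cayley {A : End4} (hA : IsUnit (1 + A)) : (1 - cayley A) * (1 + A) = 2 * A := by
  rw [sub_mul, one_mul, cayley_mul hA, two_mul, add_sub_sub_cancel]

theorem isUnit_two_End4 : IsUnit (2 : End4) := by
  have h : (algebraMap ℝ End4) 2 = 2 := map_ofNat _ 2
  exact h ▸ (IsUnit.mk0 (2 : ℝ) two_ne_zero).map (algebraMap ℝ End4)

theorem isUnit_one_add_cayley {A : End4} (hA : IsUnit (1 + A)) : IsUnit (1 + cayley A) := by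
  obtain ⟨u, hu⟩ := hA
  have h := one_add_cayley ⟨u, hu⟩
  rw [← hu] at h
  rw [← Units.isUnit_mul_units _ u, h]
  exact isUnit_two_End4

theorem isUnit_one_sub_cayley {A : End4} (hA : IsUnit (1 + A)) (hA' : IsUnit A) :
    IsUnit (1 - cayley A) := by
  obtain ⟨u, hu⟩ := hA
  have h := one_sub_cayley ⟨u, hu⟩
  rw [← hu] at h
  rw [← Units.isUnit_mul_units _ u, h]
  exact isUnit_two_End4.mul hA'

theorem isUnit_cayley {A : End4} (hA : IsUnit (1 + A)) (hA' : IsUnit (1 - A)) :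
    IsUnit (cayley A) :=
  hA'.mul hA.ringInverse

theorem cayley_cayley {A : End4} (hA : IsUnit (1 + A)) : cayley (cayley A) = A := by
  have h1 := isUnit_one_add_cayley hA
  rw [← h1.mul_left_inj, cayley_mul h1, ← hA.mul_left_inj, one_sub_cayley hA, mul_assoc,
    one_add_cayley hA, two_mul, mul_two]

theorem cayley_preserves {X : End4} (hX : X ∈ so13) (hu : IsUnit (1 + X)) (x y : E4) :
    lorentzForm (cayley X x) (cayley X y) = lorentzForm x y := by
  obtain ⟨x, rfl⟩ : ∃ v, x = (1 + X) v :=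
    ⟨Ring.inverse (1 + X) x, (congrArg (fun f : End4 => f x) (Ring.mul_inverse_cancel _ hu)).symm⟩
  obtain ⟨y, rfl⟩ : ∃ v, y = (1 + X) v :=
    ⟨Ring.inverse (1 + X) y, (congrArg (fun f : End4 => f y) (Ring.mul_inverse_cancel _ hu)).symm⟩
  have h : ∀ v, cayley X ((1 + X) v) = (1 - X) v := fun v =>
    congrArg (fun f : End4 => f v) (cayley_mul hu)
  rw [h, h]
  have := hX x y
  simp only [lorentzForm, add_apply, sub_apply,
    PiLp.add_apply, PiLp.sub_apply, one_apply_eq_self] at *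
  linarith

theorem cayley_mem {A : End4} (hA : ∀ x y, lorentzForm (A x) (A y) = lorentzForm x y)
    (hu : IsUnit (1 + A)) : cayley A ∈ so13 := by
  intro x y
  obtain ⟨x, rfl⟩ : ∃ v, x = (1 + A) v :=
    ⟨Ring.inverse (1 + A) x, (congrArg (fun f : End4 => f x) (Ring.mul_inverse_cancel _ hu)).symm⟩
  obtain ⟨y, rfl⟩ : ∃ v, y = (1 + A) v :=
    ⟨Ring.inverse (1 + A) y, (congrArg (fun f : End4 => f y) (Ring.mul_inverse_cancel _ hu)).symm⟩
  have h : ∀ v, cayley A ((1 + A) v) = (1 - A) v := fun v =>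
    congrArg (fun f : End4 => f v) (cayley_mul hu)
  rw [h, h]
  have := hA x y
  simp only [lorentzForm, add_apply, sub_apply,
    PiLp.add_apply, PiLp.sub_apply, one_apply_eq_self] at *
  linarith

/-- The Lie algebra `so(1, 3)` as a normed space, the model space of the manifold `O(1, 3)`. -/
def LieO13 : Type := so13

noncomputable instance : NormedAddCommGroup LieO13 := inferInstanceAs (NormedAddCommGroup so13)

noncomputable instance : NormedSpace ℝ LieO13 := inferInstanceAs (NormedSpace ℝ so13)

instance : FiniteDimensional ℝ LieO13 := inferInstanceAs (FiniteDimensional ℝ so13)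

/-- The inclusion of `so(1, 3)` in the endomorphisms, as a linear map. -/
noncomputable def LieO13.valₗ : LieO13 →ₗ[ℝ] End4 := so13.subtype

theorem LieO13.valₗ_injective : Function.Injective LieO13.valₗ :=
  (Subtype.val_injective : Function.Injective (Subtype.val : so13 → End4))

/-- The inclusion of `so(1, 3)` in the endomorphisms, as a continuous linear map. -/
noncomputable def LieO13.val : LieO13 →L[ℝ] End4 := LinearMap.toContinuousLinearMap LieO13.valₗ

theorem LieO13.val_mem (X : LieO13) : X.val ∈ so13 := Subtype.property (p := (· ∈ so13)) X

theorem exists_so13Proj : ∃ p : End4 →L[ℝ] LieO13, ∀ X : LieO13, p X.val = X := by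
  obtain ⟨p, hp⟩ := LinearMap.exists_leftInverse_of_injective LieO13.valₗ
    (LinearMap.ker_eq_bot.2 LieO13.valₗ_injective)
  exact ⟨LinearMap.toContinuousLinearMap p, fun X => congrArg (fun f => f X) hp⟩

/-- A continuous linear projection of the endomorphisms onto `so(1, 3)`. -/
noncomputable def so13Proj : End4 →L[ℝ] LieO13 := exists_so13Proj.choose

theorem so13Proj_val (X : LieO13) : so13Proj X.val = X := exists_so13Proj.choose_spec X

theorem val_so13Proj {A : End4} (hA : A ∈ so13) : (so13Proj A).val = A :=
  congrArg (fun X : LieO13 => X.val) (so13Proj_val (⟨A, hA⟩ : so13))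

open Classical in
/-- The inverse of the Cayley chart of `O(1, 3)` around `g`: `X ↦ g (1 - X) (1 + X)⁻¹`. -/
noncomputable def cayleyInv (g : O13) (X : LieO13) : O13 :=
  if h : IsUnit (1 + X.val) ∧ IsUnit (1 - X.val) then
    g * ⟨(isUnit_cayley h.1 h.2).unit, fun x y => cayley_preserves X.val_mem h.1 x y⟩
  else 1

theorem coe_cayleyInv (g : O13) {X : LieO13} (h : IsUnit (1 + X.val) ∧ IsUnit (1 - X.val)) :
    ((cayleyInv g X : End4ˣ) : End4) = ((g : End4ˣ) : End4) * cayley X.val := by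
  rw [cayleyInv, dif_pos h]; rfl

theorem isEmbedding_O13 : Topology.IsEmbedding (fun A : O13 => ((A : End4ˣ) : End4)) :=
  Units.isOpenEmbedding_val.isEmbedding.comp Topology.IsEmbedding.subtypeVal

theorem isOpen_isUnit_End4 : IsOpen {A : End4 | IsUnit A} := Units.isOpen

/-- The left translate `g⁻¹ A`, as an endomorphism. -/
def leftDiv (g A : O13) : End4 := ((g⁻¹ * A : O13) : End4ˣ)

theorem continuous_leftDiv (g : O13) : Continuous (leftDiv g) :=
  isEmbedding_O13.continuous.comp (continuous_const.mul continuous_id)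

theorem val_so13Proj_cayley {g A : O13} (hA : IsUnit (1 + leftDiv g A)) :
    (so13Proj (cayley (leftDiv g A))).val = cayley (leftDiv g A) :=
  val_so13Proj (cayley_mem (g⁻¹ * A : O13).2 hA)

theorem so13Proj_cayley_mem {g A : O13} (hA : IsUnit (1 + leftDiv g A)) :
    IsUnit (1 + (so13Proj (cayley (leftDiv g A))).val) ∧
      IsUnit (1 - (so13Proj (cayley (leftDiv g A))).val) := by
  rw [val_so13Proj_cayley hA]
  exact ⟨isUnit_one_add_cayley hA, isUnit_one_sub_cayley hA (Units.isUnit _)⟩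

theorem leftDiv_cayleyInv (g : O13) {X : LieO13}
    (h : IsUnit (1 + X.val) ∧ IsUnit (1 - X.val)) :
    leftDiv g (cayleyInv g X) = cayley X.val := by
  rw [leftDiv, cayleyInv, dif_pos h, inv_mul_cancel_left]; rfl

theorem cayleyInv_cayley {g A : O13} (hA : IsUnit (1 + leftDiv g A)) :
    cayleyInv g (so13Proj (cayley (leftDiv g A))) = A := by
  apply isEmbedding_O13.injective
  change ((cayleyInv g _ : End4ˣ) : End4) = ((A : End4ˣ) : End4)
  rw [coe_cayleyInv g (so13Proj_cayley_mem hA), val_so13Proj_cayley hA, cayley_cayley hA, leftDiv,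
    ← Units.val_mul, ← Subgroup.coe_mul, mul_inv_cancel_left]

/-- The chart of `O(1, 3)` around `g`, given by `A ↦ (1 - g⁻¹ A) (1 + g⁻¹ A)⁻¹`. -/
noncomputable def cayleyChart (g : O13) : OpenPartialHomeomorph O13 LieO13 where
  toFun A := so13Proj (cayley (leftDiv g A))
  invFun := cayleyInv g
  source := {A | IsUnit (1 + leftDiv g A)}
  target := {X | IsUnit (1 + X.val) ∧ IsUnit (1 - X.val)}
  map_source' _ hA := so13Proj_cayley_mem hA
  map_target' X hX := by
    rw [Set.mem_ofPred_eq, leftDiv_cayleyInv g hX]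
    exact isUnit_one_add_cayley hX.1
  left_inv' _ hA := cayleyInv_cayley hA
  right_inv' X hX := by
    rw [leftDiv_cayleyInv g hX, cayley_cayley hX.1, so13Proj_val]
  open_source := isOpen_isUnit_End4.preimage (continuous_const.add (continuous_leftDiv g))
  open_target :=
    (isOpen_isUnit_End4.preimage (continuous_const.add LieO13.val.continuous)).inter
      (isOpen_isUnit_End4.preimage (continuous_const.sub LieO13.val.continuous))
  continuousOn_toFun A hA := by
    refine ContinuousAt.continuousWithinAt (so13Proj.continuous.continuousAt.comp ?_)
    exact ContinuousAt.comp (g := cayley) (contDiffAt_cayley hA).continuousAt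
      (continuous_leftDiv g).continuousAt
  continuousOn_invFun X hX := by
    rw [isEmbedding_O13.continuousWithinAt_iff]
    have h1 : ContinuousAt (fun X : LieO13 => ((g : End4ˣ) : End4) * cayley X.val) X :=
      continuousAt_const.mul (ContinuousAt.comp (g := cayley) (contDiffAt_cayley hX.1).continuousAt
        LieO13.val.continuous.continuousAt)
    exact h1.continuousWithinAt.congr (fun Y hY => coe_cayleyInv g hY) (coe_cayleyInv g hX)

noncomputable instance : ChartedSpace LieO13 O13 where
  atlas := Set.range cayleyChart
  chartAt := cayleyChart
  mem_chart_source A := by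
    change IsUnit (1 + leftDiv A A)
    rw [leftDiv, inv_mul_cancel]
    change IsUnit ((1 : End4) + 1)
    rw [one_add_one_eq_two]
    exact isUnit_two_End4
  chart_mem_atlas A := ⟨A, rfl⟩

instance : IsManifold 𝓘(ℝ, LieO13) ∞ O13 := by
  apply isManifold_of_contDiffOn
  rintro _ _ ⟨g, rfl⟩ ⟨g', rfl⟩ X ⟨hX, -⟩
  have hX1 : X ∈ (cayleyChart g).target := hX.1
  have hX2 : IsUnit (1 + leftDiv g' (cayleyInv g X)) := hX.2
  have hk : ∀ Y : LieO13, Y ∈ (cayleyChart g).target →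
      leftDiv g' (cayleyInv g Y) = leftDiv g' g * cayley Y.val := by
    intro Y hY
    rw [leftDiv, Subgroup.coe_mul, Units.val_mul, coe_cayleyInv g hY, ← mul_assoc]
    rfl
  rw [hk X hX1] at hX2
  have h1 : ContDiffAt ℝ ∞ (fun Y : LieO13 => leftDiv g' g * cayley Y.val) X :=
    contDiffAt_const.mul (ContDiffAt.comp X (contDiffAt_cayley hX1.1)
      LieO13.val.contDiff.contDiffAt)
  have h2 : ContDiffAt ℝ ∞ (fun Y : LieO13 => so13Proj (cayley (leftDiv g' g * cayley Y.val))) X :=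
    so13Proj.contDiff.contDiffAt.comp X (ContDiffAt.comp X (contDiffAt_cayley hX2) h1)
  refine (h2.congr_of_eventuallyEq ?_).contDiffWithinAt
  filter_upwards [(cayleyChart g).open_target.mem_nhds hX1] with Y hY
  rw [← hk Y hY]
  rfl

theorem O13_contMDiff_coe :
    ContMDiff 𝓘(ℝ, LieO13) 𝓘(ℝ, End4) ∞ (fun A : O13 => ((A : End4ˣ) : End4)) := by
  intro A
  have hA : IsUnit (1 + leftDiv A A) := mem_chart_source LieO13 A
  have h1 : ContMDiffAt 𝓘(ℝ, LieO13) 𝓘(ℝ, LieO13) ∞ (cayleyChart A) A :=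
    contMDiffAt_extChartAt (x := A)
  have h2 : ContDiffAt ℝ ∞ (fun Y : LieO13 => ((A : End4ˣ) : End4) * cayley Y.val) (cayleyChart A A) :=
    contDiffAt_const.mul (ContDiffAt.comp _ (contDiffAt_cayley (so13Proj_cayley_mem hA).1)
      LieO13.val.contDiff.contDiffAt)
  refine (ContMDiffAt.comp A h2.contMDiffAt h1).congr_of_eventuallyEq ?_
  filter_upwards [(cayleyChart A).open_source.mem_nhds hA] with B hB
  rw [Function.comp_apply]
  change _ = _ * cayley (so13Proj (cayley (leftDiv A B))).val
  rw [← coe_cayleyInv A (so13Proj_cayley_mem hB), cayleyInv_cayley hB]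

theorem O13_contMDiff_iff {E N : Type*} [NormedAddCommGroup E] [NormedSpace ℝ E]
    {H : Type*} [TopologicalSpace H] {I : ModelWithCorners ℝ E H}
    [TopologicalSpace N] [ChartedSpace H N] {f : N → O13}
    (hf : ContMDiff I 𝓘(ℝ, End4) ∞ (fun x => ((f x : End4ˣ) : End4))) :
    ContMDiff I 𝓘(ℝ, LieO13) ∞ f := by
  intro x
  rw [contMDiffAt_iff_target]
  refine ⟨(isEmbedding_O13.continuous_iff.2 hf.continuous).continuousAt, ?_⟩
  have hA : IsUnit (1 + leftDiv (f x) (f x)) := mem_chart_source LieO13 (f x)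
  have h1 : ∀ y, leftDiv (f x) (f y) = (((f x)⁻¹ : O13) : End4ˣ) * ((f y : End4ˣ) : End4) :=
    fun y => rfl
  have h2 : ContDiffAt ℝ ∞ (fun B : End4 => so13Proj (cayley ((((f x)⁻¹ : O13) : End4ˣ) * B)))
      ((f x : End4ˣ) : End4) :=
    so13Proj.contDiff.contDiffAt.comp _ (ContDiffAt.comp (g := cayley) _ (contDiffAt_cayley hA)
      (contDiffAt_const.mul contDiffAt_id))
  exact ContMDiffAt.comp x (f := fun y => ((f y : End4ˣ) : End4)) h2.contMDiffAt (hf x)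

instance : LieGroup 𝓘(ℝ, LieO13) ∞ O13 where
  contMDiff_mul := O13_contMDiff_iff
    (((contDiff_mul (𝕜 := ℝ) (𝔸 := End4)).contMDiff).comp
      ((O13_contMDiff_coe.comp contMDiff_fst).prodMk_space (O13_contMDiff_coe.comp contMDiff_snd)))
  contMDiff_inv := O13_contMDiff_iff fun A => by
    have h : ContDiffAt ℝ ∞ (Ring.inverse : End4 → End4) ((A : End4ˣ) : End4) :=
      contDiffAt_ringInverse ℝ _
    refine (ContMDiffAt.comp A h.contMDiffAt (O13_contMDiff_coe A)).congr_of_eventuallyEq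
      (Filter.Eventually.of_forall fun B => ?_)
    exact (Ring.inverse_unit (B : End4ˣ)).symm

/-- The group `SO₀(1, 3)`: the connected component of the identity in `O(1, 3)` (which is also
the connected component of the identity in `SO(1, 3)`, the determinant being continuous with
values `±1` on `O(1, 3)`). -/
noncomputable def SO13₀ : Subgroup O13 := Subgroup.connectedComponentOfOne O13

theorem isOpen_SO13₀ : IsOpen (SO13₀ : Set O13) := by
  have : LocallyConnectedSpace O13 := ChartedSpace.locallyConnectedSpace LieO13 O13
  exact isOpen_connectedComponent

noncomputable instance : ChartedSpace LieO13 SO13₀ := openSubgroupChartedSpace (E := LieO13) SO13₀ isOpen_SO13₀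

instance : LieGroup 𝓘(ℝ, LieO13) ∞ SO13₀ := openSubgroup_lieGroup (E := LieO13) SO13₀ isOpen_SO13₀

theorem det_pos_of_mem_SO13₀ (g : SO13₀) : (((g : O13) : End4ˣ) : End4).det > 0 := by
  have hc : Continuous fun A : O13 => ((A : End4ˣ) : End4).det :=
    ContinuousLinearMap.continuous_det.comp isEmbedding_O13.continuous
  have hne : ∀ A : O13, ((A : End4ˣ) : End4).det ≠ 0 := by
    intro A h
    have h1 : ((A : End4ˣ) : End4).det * (((A⁻¹ : O13) : End4ˣ) : End4).det = 1 := by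
      rw [ContinuousLinearMap.det, ContinuousLinearMap.det, ← LinearMap.det_comp]
      have h2 : (((A : End4ˣ) : End4) : E4 →ₗ[ℝ] E4) ∘ₗ (((A⁻¹ : O13) : End4ˣ) : End4) =
          LinearMap.id := congrArg (fun f : End4 => (f : E4 →ₗ[ℝ] E4)) (A : End4ˣ).mul_inv
      rw [h2, LinearMap.det_id]
    rw [h, zero_mul] at h1
    exact zero_ne_one h1
  have hpre := (isPreconnected_connectedComponent (x := (1 : O13))).image _ hc.continuousOn
  by_contra hle
  have h0 : (0 : ℝ) ∈ (fun A : O13 => ((A : End4ˣ) : End4).det) '' connectedComponent (1 : O13) := by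
    refine hpre.ordConnected.out ⟨g, g.2, rfl⟩ ⟨1, mem_connectedComponent, rfl⟩ ⟨not_lt.1 hle, ?_⟩
    change (0 : ℝ) ≤ (1 : End4).det
    simp [ContinuousLinearMap.det]
  obtain ⟨A, -, hA⟩ := h0
  exact hne A hA

/-- The inclusion of `SO₀(1, 3)` in `GL⁺(4, ℝ)`. -/
noncomputable def SO13₀.incl : SO13₀ →* GLplus :=
  (O13.subtype.comp SO13₀.subtype).codRestrict GLplus det_pos_of_mem_SO13₀

end LinearGroups

section FrameBundle

variable (M : Type*) [TopologicalSpace M] [ChartedSpace E4 M] [IsManifold 𝓘(ℝ, E4) ∞ M]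

/-- The smooth vector bundle over `M` whose fibre at `x` consists of the linear maps
`ℝ⁴ → T_x M`, that is, of the quadruples of tangent vectors at `x` (the images of the standard
basis vectors of `ℝ⁴`). -/
abbrev TangentQuadruples : Type _ :=
  Bundle.TotalSpace End4 (fun x : M => Bundle.Trivial M E4 x →L[ℝ] TangentSpace 𝓘(ℝ, E4) x)

variable {M}

/-- The vectors of a quadruple. -/
noncomputable def TangentQuadruples.vec (b : TangentQuadruples M) (i : Fin 4) :
    TangentSpace 𝓘(ℝ, E4) b.proj :=
  b.snd (EuclideanSpace.single i (1 : ℝ))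

variable (M) in
/-- A smooth nowhere zero `4`-form on the `4`-manifold `M`. An orientation of `M` is a class of
such forms up to multiplication by positive functions. -/
structure OrientationForm where
  form : ∀ x : M, (TangentSpace 𝓘(ℝ, E4) x) [⋀^Fin 4]→ₗ[ℝ] ℝ
  ne_zero : ∀ x, form x ≠ 0
  contMDiff : ContMDiff (𝓘(ℝ, E4).prod 𝓘(ℝ, End4)) 𝓘(ℝ, ℝ) ∞
    (fun b : TangentQuadruples M => form b.proj b.vec)

namespace OrientationForm

variable (o : OrientationForm M)

/-- The total space of the bundle `F⁺M` of oriented frames, as an open submanifold of the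
manifold of quadruples of tangent vectors. -/
def positiveFrames : TopologicalSpace.Opens (TangentQuadruples M) :=
  ⟨{b | 0 < o.form b.proj b.vec}, isOpen_lt continuous_const o.contMDiff.continuous⟩

/-- The total space of the bundle `F⁺M` of oriented frames. -/
abbrev FPlus : Type _ := o.positiveFrames

/-- The elements of `F⁺M` are frames. -/
theorem linearIndependent_vec (b : o.FPlus) : LinearIndependent ℝ b.1.vec := by
  by_contra h
  have h1 : 0 < o.form b.1.proj b.1.vec := b.2
  rw [AlternatingMap.map_linearDependent _ _ h] at h1
  exact lt_irrefl _ h1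

noncomputable instance : ChartedSpace (E4 × End4) o.FPlus :=
  inferInstanceAs (ChartedSpace (ModelProd E4 End4) o.positiveFrames)

instance : IsManifold 𝓘(ℝ, E4 × End4) ∞ o.FPlus := by
  rw [modelWithCornersSelf_prod]
  exact inferInstanceAs (IsManifold (𝓘(ℝ, E4).prod 𝓘(ℝ, End4)) ∞ o.positiveFrames)

/-- The projection of `F⁺M` to `M`. -/
def proj (b : o.FPlus) : M := b.1.proj

/-- The right action of matrices on quadruples: `(b g)_j = ∑ i, b_i g_{ij}`. -/
noncomputable def rightMul (b : TangentQuadruples M) (g : End4) : TangentQuadruples M :=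
  ⟨b.proj, ContinuousLinearMap.comp (M₁ := E4) (M₂ := E4) b.snd g⟩

theorem form_rightMul (b : TangentQuadruples M) (g : End4) :
    o.form b.proj (rightMul b g).vec = g.det * o.form b.proj b.vec := by
  have h := AlternatingMap.eq_smul_basis_det (EuclideanSpace.basisFun (Fin 4) ℝ).toBasis
    ((o.form b.proj).compLinearMap (b.snd : E4 →ₗ[ℝ] TangentSpace 𝓘(ℝ, E4) b.proj))
  have key : ∀ v : Fin 4 → E4, o.form b.proj (fun i => b.snd (v i)) =
      o.form b.proj b.vec * (EuclideanSpace.basisFun (Fin 4) ℝ).toBasis.det v := by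
    intro v
    have h2 := congrArg (fun f => f v) h
    simp only [AlternatingMap.compLinearMap_apply, AlternatingMap.smul_apply, smul_eq_mul,
      OrthonormalBasis.coe_toBasis, EuclideanSpace.basisFun_apply] at h2
    exact h2
  have h3 := key fun i => g (EuclideanSpace.single i (1 : ℝ))
  have h4 := (EuclideanSpace.basisFun (Fin 4) ℝ).toBasis.det_comp (g : E4 →ₗ[ℝ] E4)
    (EuclideanSpace.basisFun (Fin 4) ℝ).toBasis
  rw [Module.Basis.det_self, mul_one] at h4
  have h5 : (fun i => g (EuclideanSpace.single i (1 : ℝ))) =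
      (g : E4 →ₗ[ℝ] E4) ∘ (EuclideanSpace.basisFun (Fin 4) ℝ).toBasis := by
    ext i; simp
  rw [h5, h4, mul_comm] at h3
  exact h3

noncomputable instance : MulAction GLplusᵐᵒᵖ o.FPlus where
  smul g b := ⟨rightMul b.1 ((g.unop : End4ˣ) : End4), by
    change 0 < o.form b.1.proj _
    rw [form_rightMul]
    exact mul_pos g.unop.2 b.2⟩
  one_smul b := rfl
  mul_smul g h b := rfl

end OrientationForm

end FrameBundle

/-! A principal bundle has local sections and a continuous division map, so maps of cubes into `M`
lift, and a lift can be corrected face by face by multiplying it with functions into the structure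
group. These explicit lifts replace the exact homotopy sequence and the five lemma. They yield the
connecting homomorphisms, and also the comparison of `R` with `P`: a loop or a null homotopy in `P`
is projected to `M` and lifted to `R`, the image of the lift differs from the original by a map into
`G`, and the bijectivity of `ι_*` brings this difference back to `H`
(`IsTopPrincipal.pi1Map_surjective`, `IsTopPrincipal.pi1Map_injective`). Once `κ_*` is an
isomorphism, splittings are transported by pure algebra.

A spinor map is a covering whose fibres are the orbits of `ker ρ`
(`IsBundleMorphism.isCoveringMap`). By the lifting criterion a spinor structure is determined up to
equivalence by the subgroup `u_* π₁(Q)` of `π₁(P)` (`SpinorStructure.equivalent_iff_range_eq`). In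
the same way a map `S → Q` above `κ` exists if and only if `κ_*` takes the subgroup of `S` to that
of `Q` (`SpinorStructure.range_map_eq_iff`). The lifting criterion asks only for an inclusion;
equality follows because `π₁(S) → π₁(Q)` is surjective, the group of `Q` being simply connected. As
`κ_*` is injective, the bijection of classes only requires that each spinor structure of one bundle
has a partner for the other. For `S` this is the associated bundle `S ×_Ht Gt`
(`SpinorStructure.exists_extension`), for `Q` the fibre product `R ×_P Q`
(`SpinorStructure.exists_pullback`). The latter is principal for `Ht` because the lift `ιt` of `ι`
is injective and maps `ker ρH` onto `ker ρG`, which again expresses the bijectivity of `ι_*`. Both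
spaces are built topologically and receive the smooth structure for which the spinor map is a local
diffeomorphism.

For Lorentz structures it remains to see that `GL⁺(4)` is connected, that the frame bundle is a
principal bundle, and that `SO₀(1,3) → GL⁺(4)` is bijective on `π₁` (`SO13₀.bijective_pi1Map_incl`).
A matrix in `GL⁺(4)` is the product of the left multiplication by a quaternion and a matrix fixing
the first basis vector. Loops in `ℝ⁴ ∖ 0` contract, and Gram–Schmidt deforms the second factor to a
rotation. A pair of Lorentz reflections deforms `SO₀(1,3)` to the same rotations. -/

set_option linter.unusedSectionVars false

/-! ### Lifting families of maps to a topological principal bundle. -/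

section TopologicalBundles

open Set unitInterval

variable {G M P : Type*} [Group G] [TopologicalSpace G] [TopologicalSpace M] [TopologicalSpace P]
  [MulAction Gᵐᵒᵖ P]

variable (G) in
/-- The topological content of a principal bundle: local sections and a continuous division
function. -/
structure IsTopPrincipal (π : P → M) : Prop where
  surjective : Function.Surjective π
  continuous_proj : Continuous π
  continuous_act : Continuous (fun x : P × G => op x.2 • x.1)
  proj_act : ∀ (p : P) (g : G), π (op g • p) = π p
  free : ∀ (p : P) (g : G), op g • p = p → g = 1
  local_section : ∀ m₀ : M, ∃ U : Set M, IsOpen U ∧ m₀ ∈ U ∧ ∃ τ : M → P, ContinuousOn τ U ∧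
    ∀ m ∈ U, π (τ m) = m
  exists_div : ∃ d : P × P → G, (∀ p p', π p = π p' → op (d (p, p')) • p = p') ∧
    ContinuousOn d {x | π x.1 = π x.2}

variable {π : P → M}

/-- Every family of maps `K → M` lifts to `P` locally in the parameter. -/
def HasLocalLifts (π : P → M) (K : Type) [TopologicalSpace K] : Prop :=
  ∀ (X : Type) [TopologicalSpace X] (f : C(K × X, M)) (x₀ : X), ∃ V : Set X, IsOpen V ∧ x₀ ∈ V ∧
    ∃ F : C(K × V, P), ∀ k x, π (F (k, x)) = f (k, x)

namespace IsTopPrincipal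

theorem act_injective (h : IsTopPrincipal G π) (p : P) {g g' : G} (e : op g • p = op g' • p) :
    g = g' := by
  rw [← mul_inv_eq_one]
  refine h.free p _ ?_
  rw [op_mul, mul_smul, e, op_inv, inv_smul_smul]

theorem transitive (h : IsTopPrincipal G π) (p p' : P) (e : π p = π p') :
    ∃ g : G, op g • p = p' := by
  obtain ⟨d, hd, -⟩ := h.exists_div
  exact ⟨_, hd p p' e⟩

theorem exists_div_continuous (h : IsTopPrincipal G π) {K : Type*} [TopologicalSpace K]
    {F F' : K → P} (hF : Continuous F) (hF' : Continuous F') (e : ∀ k, π (F k) = π (F' k)) :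
    ∃ g : K → G, Continuous g ∧ ∀ k, op (g k) • F k = F' k := by
  obtain ⟨d, hd, hc⟩ := h.exists_div
  exact ⟨fun k => d (F k, F' k), hc.comp_continuous (hF.prodMk hF') e, fun k => hd _ _ (e k)⟩

theorem act_continuous (h : IsTopPrincipal G π) {K : Type*} [TopologicalSpace K]
    {F : K → P} {g : K → G} (hF : Continuous F) (hg : Continuous g) :
    Continuous fun k => op (g k) • F k :=
  h.continuous_act.comp (hF.prodMk hg)

theorem hasLocalLifts_unit (h : IsTopPrincipal G π) : HasLocalLifts π Unit := by
  intro X _ f x₀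
  obtain ⟨U, hU, hm, τ, hτ, hτ'⟩ := h.local_section (f ((), x₀))
  refine ⟨{x | f ((), x) ∈ U}, hU.preimage (by fun_prop), hm,
    ⟨fun y => τ (f ((), y.2)), hτ.comp_continuous (by fun_prop) fun y => y.2.2⟩, fun k x => ?_⟩
  exact hτ' _ x.2

/-- Lifts over adjacent intervals can be glued. -/
theorem glue (h : IsTopPrincipal G π) {Y : Type*} [TopologicalSpace Y] (f : I × Y → M) (a b c : I)
    (h₁ : ∃ F : I × Y → P, Continuous F ∧ ∀ s ∈ Icc a b, ∀ y, π (F (s, y)) = f (s, y))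
    (h₂ : ∃ F : I × Y → P, Continuous F ∧ ∀ s ∈ Icc b c, ∀ y, π (F (s, y)) = f (s, y))
    (hab : a ≤ b) (hbc : b ≤ c) :
    ∃ F : I × Y → P, Continuous F ∧ ∀ s ∈ Icc a c, ∀ y, π (F (s, y)) = f (s, y) := by
  obtain ⟨F₁, hF₁, e₁⟩ := h₁
  obtain ⟨F₂, hF₂, e₂⟩ := h₂
  -- Along the seam the lifts differ by a map `Y → G`; extended constantly in the interval direction
  -- it moves the second lift onto the first.
  obtain ⟨g, hg, hge⟩ := h.exists_div_continuous (K := Y) (F := fun y => F₂ (b, y))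
    (F' := fun y => F₁ (b, y)) (by fun_prop) (by fun_prop) fun y => by
      rw [e₁ b ⟨hab, le_rfl⟩, e₂ b ⟨le_rfl, hbc⟩]
  refine ⟨fun x => if x.1 ≤ b then F₁ x else op (g x.2) • F₂ x, ?_, ?_⟩
  · refine Continuous.if_le hF₁ (h.act_continuous hF₂ (hg.comp continuous_snd)) continuous_fst
      continuous_const ?_
    rintro ⟨s, y⟩ rfl
    exact (hge y).symm
  · intro s hs y
    by_cases hsb : s ≤ b
    · simp only [if_pos hsb]
      exact e₁ s ⟨hs.1, hsb⟩ y
    · simp only [if_neg hsb]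
      rw [h.proj_act]
      exact e₂ s ⟨(not_le.1 hsb).le, hs.2⟩ y

/-- Compactness of the interval reduces the claim to finitely many subintervals, over which the
lifts are glued one after the other. The arbitrary parameter space in `HasLocalLifts` is what makes
an induction on the dimension of the cube possible. -/
theorem hasLocalLifts_prod (h : IsTopPrincipal G π) {K : Type} [TopologicalSpace K]
    (hK : HasLocalLifts π K) : HasLocalLifts π (I × K) := by
  intro X _ f x₀
  have h1 : ∀ t : I, ∃ (N : Set I) (V : Set X), IsOpen N ∧ t ∈ N ∧ IsOpen V ∧ x₀ ∈ V ∧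
      ∃ F : C(K × (N ×ˢ V : Set (I × X)), P), ∀ (k : K) (x : (N ×ˢ V : Set (I × X))),
        π (F (k, x)) = f ((x.1.1, k), x.1.2) := by
    intro t
    -- The new interval coordinate is treated as a parameter.
    obtain ⟨V, hV, hm, F, hF⟩ := hK (I × X) ⟨fun x => f ((x.2.1, x.1), x.2.2), by fun_prop⟩ (t, x₀)
    obtain ⟨N, V', hN, hV', ht, hx, hs⟩ := isOpen_prod_iff.1 hV t x₀ hm
    refine ⟨N, V', hN, ht, hV', hx, ⟨fun y => F (y.1, ⟨y.2.1, hs y.2.2⟩), by fun_prop⟩, ?_⟩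
    intro k x
    exact hF k ⟨x.1, hs x.2⟩
  choose N V hN ht hV hx F hF using h1
  obtain ⟨t, t0, tm, ⟨n, tn⟩, hc⟩ := exists_monotone_Icc_subset_open_cover_unitInterval hN
    (fun t _ => mem_iUnion.2 ⟨t, ht t⟩)
  choose i hi using hc
  let W : Set X := ⋂ m ∈ Finset.range n, V (i m)
  have hWV : ∀ m < n, W ⊆ V (i m) := fun m hm => biInter_subset_of_mem (Finset.mem_range.2 hm)
  have key : ∀ m ≤ n, ∃ Φ : I × (K × W) → P, Continuous Φ ∧ ∀ s ∈ Icc (t 0) (t m), ∀ y : K × W,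
      π (Φ (s, y)) = f ((s, y.1), (y.2 : X)) := by
    have loc : ∀ m < n, ∃ Φ : I × (K × W) → P, Continuous Φ ∧ ∀ s ∈ Icc (t m) (t (m + 1)), ∀ y : K × W,
      π (Φ (s, y)) = f ((s, y.1), (y.2 : X)) := by
      intro m hm
      have hle : t m ≤ t (m + 1) := tm (Nat.le_succ m)
      -- Clamping the time to the subinterval extends the local lift to a continuous map on all of
      -- `I`, as gluing requires.
      have hmem : ∀ s : I, max (t m) (min (t (m + 1)) s) ∈ N (i m) := fun s =>
        hi m ⟨le_max_left _ _, max_le hle (min_le_left _ _)⟩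
      refine ⟨fun x : I × (K × W) => F (i m) (x.2.1, ⟨(max (t m) (min (t (m + 1)) x.1), x.2.2),
        hmem _, hWV m hm x.2.2.2⟩), by fun_prop, ?_⟩
      intro s hs y
      rw [hF]
      simp only [min_eq_right hs.2, max_eq_right hs.1]
    intro m
    induction m with
    | zero =>
      intro _
      rcases Nat.eq_zero_or_pos n with h0 | h0
      · subst h0
        exact absurd (t0.symm.trans (tn 0 le_rfl)) zero_ne_one
      · obtain ⟨Φ, hΦ, e⟩ := loc 0 h0
        exact ⟨Φ, hΦ, fun s hs => e s ⟨hs.1, hs.2.trans (tm (Nat.zero_le _))⟩⟩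
    | succ m ih =>
      intro hm
      exact h.glue (fun x : I × (K × W) => f ((x.1, x.2.1), x.2.2)) _ _ _ (ih (by omega)) (loc m (by omega))
        (tm (Nat.zero_le _)) (tm (Nat.le_succ _))
  obtain ⟨Φ, hΦ, e⟩ := key n le_rfl
  refine ⟨W, isOpen_biInter_finset fun m _ => hV _, mem_iInter₂.2 fun m _ => hx _,
    ⟨fun y : (I × K) × W => Φ (y.1.1, (y.1.2, y.2)), by fun_prop⟩, ?_⟩
  rintro ⟨s, k⟩ x
  exact e s ⟨by rw [t0]; exact s.2.1, by rw [tn n le_rfl]; exact s.2.2⟩ (k, x)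

theorem exists_lift_of_hasLocalLifts {K : Type} [TopologicalSpace K] (hK : HasLocalLifts π K)
    {f : K → M} (hf : Continuous f) : ∃ F : K → P, Continuous F ∧ ∀ k, π (F k) = f k := by
  obtain ⟨V, -, hm, F, hF⟩ := hK Unit ⟨fun x => f x.1, by fun_prop⟩ ()
  exact ⟨fun k => F (k, ⟨(), hm⟩), by fun_prop, fun k => hF k _⟩

end IsTopPrincipal

end TopologicalBundles

/-! ### Lifts of squares and cubes with prescribed faces. -/

section SquareLifts

open Set unitInterval

variable {G M P : Type*} [Group G] [TopologicalSpace G]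
  [TopologicalSpace M] [TopologicalSpace P] [MulAction Gᵐᵒᵖ P] {π : P → M}

namespace IsTopPrincipal

theorem eq_one_of_act_eq (h : IsTopPrincipal G π) {p q : P} {g : G} (e : op g • p = q)
    (e' : p = q) : g = 1 :=
  h.free p g (e.trans e'.symm)

theorem exists_path_lift (h : IsTopPrincipal G π) {f : I → M} (hf : Continuous f) (p : P)
    (hp : π p = f 0) : ∃ F : I → P, Continuous F ∧ (∀ t, π (F t) = f t) ∧ F 0 = p := by
  obtain ⟨L, hL, e⟩ := exists_lift_of_hasLocalLifts (h.hasLocalLifts_prod h.hasLocalLifts_unit)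
    (f := fun x => f x.1) (by fun_prop)
  obtain ⟨g, hg⟩ := h.transitive (L (0, ())) p (by rw [e, hp])
  refine ⟨fun t => op g • L (t, ()), h.act_continuous (by fun_prop) continuous_const,
    fun t => by rw [h.proj_act, e], hg⟩

/-- A square in the base lifts with prescribed values on three sides. -/
theorem exists_square_lift (h : IsTopPrincipal G π) {f : I × I → M} (hf : Continuous f)
    {β β₀ β₁ : I → P} (hβ : Continuous β) (hβ₀ : Continuous β₀) (hβ₁ : Continuous β₁)
    (e : ∀ t, π (β t) = f (0, t)) (e₀ : ∀ s, π (β₀ s) = f (s, 0)) (e₁ : ∀ s, π (β₁ s) = f (s, 1))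
    (c₀ : β 0 = β₀ 0) (c₁ : β 1 = β₁ 0) :
    ∃ F : I × I → P, Continuous F ∧ (∀ x, π (F x) = f x) ∧ (∀ t, F (0, t) = β t) ∧
      (∀ s, F (s, 0) = β₀ s) ∧ ∀ s, F (s, 1) = β₁ s := by
  obtain ⟨L, hL, eL⟩ := exists_lift_of_hasLocalLifts
    (h.hasLocalLifts_prod (h.hasLocalLifts_prod h.hasLocalLifts_unit))
    (f := fun x => f (x.1, x.2.1)) (by fun_prop)
  obtain ⟨k, hk, ek⟩ := h.exists_div_continuous (F := fun t => L (0, t, ())) (F' := β)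
    (by fun_prop) hβ fun t => by rw [eL, e]
  let L₁ : I × I → P := fun x => op (k x.2) • L (x.1, x.2, ())
  have hL₁ : Continuous L₁ := h.act_continuous (by fun_prop) (by fun_prop)
  have eL₁ : ∀ x, π (L₁ x) = f x := fun x => by rw [h.proj_act, eL]
  obtain ⟨a, ha, ea⟩ := h.exists_div_continuous (F := fun s => L₁ (s, 0)) (F' := β₀)
    (by fun_prop) hβ₀ fun t => by rw [eL₁, e₀]
  -- The prescribed sides agree at the corner, so this correction is trivial there and leaves the
  -- side already adjusted unchanged.
  have a0 : a 0 = 1 := h.eq_one_of_act_eq (ea 0) ((ek 0).trans c₀)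
  let L₂ : I × I → P := fun x => op (a x.1) • L₁ x
  have hL₂ : Continuous L₂ := h.act_continuous (by fun_prop) (by fun_prop)
  have eL₂ : ∀ x, π (L₂ x) = f x := fun x => by rw [h.proj_act, eL₁]
  have zL₂ : ∀ t, L₂ (0, t) = β t := fun t => by
    simp only [L₂, a0, op_one, one_smul]; exact ek t
  obtain ⟨b, hb, eb⟩ := h.exists_div_continuous (F := fun s => L₂ (s, 1)) (F' := β₁)
    (by fun_prop) hβ₁ fun t => by rw [eL₂, e₁]
  have b0 : b 0 = 1 := h.eq_one_of_act_eq (eb 0) ((zL₂ 1).trans c₁)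
  -- The product interpolates the last correction: it is `b s` for `t = 1`, and `b 0 = 1` for `t =
  -- 0` as well as for `s = 0`.
  refine ⟨fun x => op (b (x.1 * x.2)) • L₂ x, h.act_continuous (by fun_prop) (by fun_prop),
    fun x => by rw [h.proj_act, eL₂], fun t => ?_, fun s => ?_, fun s => ?_⟩
  · simp only [zero_mul, b0, op_one, one_smul]; exact zL₂ t
  · simp only [mul_zero, b0, op_one, one_smul]; exact ea s
  · simp only [mul_one]; exact eb s

/-- A homotopy of squares in the base lifts with prescribed values at both ends and constant on
three faces. -/
theorem exists_cube_lift (h : IsTopPrincipal G π) {f : I × I × I → M} (hf : Continuous f)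
    {F₀ F₁ : I × I → P} (hF₀ : Continuous F₀) (hF₁ : Continuous F₁) (p : P)
    (e₀ : ∀ x, π (F₀ x) = f (0, x)) (e₁ : ∀ x, π (F₁ x) = f (1, x))
    (c₀ : ∀ t, F₀ (0, t) = p) (c₀' : ∀ s, F₀ (s, 0) = p) (c₀'' : ∀ s, F₀ (s, 1) = p)
    (c₁ : ∀ t, F₁ (0, t) = p) (c₁' : ∀ s, F₁ (s, 0) = p) (c₁'' : ∀ s, F₁ (s, 1) = p)
    (ef : ∀ w t, f (w, 0, t) = π p) (ef' : ∀ w s, f (w, s, 0) = π p)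
    (ef'' : ∀ w s, f (w, s, 1) = π p) :
    ∃ F : I × I × I → P, Continuous F ∧ (∀ x, π (F x) = f x) ∧ (∀ x, F (0, x) = F₀ x) ∧
      (∀ x, F (1, x) = F₁ x) ∧ (∀ w s, F (w, s, 0) = p) ∧ (∀ w s, F (w, s, 1) = p) := by
  -- In the coordinates `(w, s, t)` the faces `s = 0`, `t = 0`, `t = 1`, `w = 0`, `w = 1` are
  -- corrected in this order; the face `s = 1` stays free.
  obtain ⟨L, hL, eL⟩ := exists_lift_of_hasLocalLifts
    (h.hasLocalLifts_prod (h.hasLocalLifts_prod (h.hasLocalLifts_prod h.hasLocalLifts_unit)))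
    (f := fun x => f (x.1, x.2.1, x.2.2.1)) (by fun_prop)
  obtain ⟨k, hk, ek⟩ := h.exists_div_continuous (F := fun x : I × I => L (x.1, 0, x.2, ()))
    (F' := fun _ => p) (by fun_prop) continuous_const fun t => by rw [eL, ef]
  let L₁ : I × I × I → P := fun x => op (k (x.1, x.2.2)) • L (x.1, x.2.1, x.2.2, ())
  have hL₁ : Continuous L₁ := h.act_continuous (by fun_prop) (by fun_prop)
  have eL₁ : ∀ x, π (L₁ x) = f x := fun x => by rw [h.proj_act, eL]
  obtain ⟨a, ha, ea⟩ := h.exists_div_continuous (F := fun x : I × I => L₁ (x.1, x.2, 0))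
    (F' := fun _ => p) (by fun_prop) continuous_const fun t => by rw [eL₁, ef']
  have a0 : ∀ w, a (w, 0) = 1 := fun w => h.eq_one_of_act_eq (ea (w, 0)) (ek (w, 0))
  let L₂ : I × I × I → P := fun x => op (a (x.1, x.2.1)) • L₁ x
  have hL₂ : Continuous L₂ := h.act_continuous (by fun_prop) (by fun_prop)
  have eL₂ : ∀ x, π (L₂ x) = f x := fun x => by rw [h.proj_act, eL₁]
  have zL₂ : ∀ w t, L₂ (w, 0, t) = p := fun w t => by
    simp only [L₂, a0, op_one, one_smul]; exact ek (w, t)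
  obtain ⟨b, hb, eb⟩ := h.exists_div_continuous (F := fun x : I × I => L₂ (x.1, x.2, 1))
    (F' := fun _ => p) (by fun_prop) continuous_const fun t => by rw [eL₂, ef'']
  have b0 : ∀ w, b (w, 0) = 1 := fun w => h.eq_one_of_act_eq (eb (w, 0)) (zL₂ w 1)
  let L₃ : I × I × I → P := fun x => op (b (x.1, x.2.1 * x.2.2)) • L₂ x
  have hL₃ : Continuous L₃ := h.act_continuous (by fun_prop) (by fun_prop)
  have eL₃ : ∀ x, π (L₃ x) = f x := fun x => by rw [h.proj_act, eL₂]
  have s₃ : ∀ w t, L₃ (w, 0, t) = p := fun w t => by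
    simp only [L₃, zero_mul, b0, op_one, one_smul]; exact zL₂ w t
  have t₃ : ∀ w s, L₃ (w, s, 0) = p := fun w s => by
    simp only [L₃, mul_zero, b0, op_one, one_smul]; exact ea (w, s)
  have u₃ : ∀ w s, L₃ (w, s, 1) = p := fun w s => by
    simp only [L₃, mul_one]; exact eb (w, s)
  obtain ⟨c, hc, ec⟩ := h.exists_div_continuous (F := fun x : I × I => L₃ (0, x))
    (F' := F₀) (by fun_prop) hF₀ fun t => by rw [eL₃, e₀]
  have cs : ∀ t, c (0, t) = 1 := fun t => h.eq_one_of_act_eq (ec (0, t)) ((s₃ _ _).trans (c₀ _).symm)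
  have ct : ∀ s, c (s, 0) = 1 := fun s => h.eq_one_of_act_eq (ec (s, 0)) ((t₃ _ _).trans (c₀' _).symm)
  have cu : ∀ s, c (s, 1) = 1 := fun s =>
    h.eq_one_of_act_eq (ec (s, 1)) ((u₃ _ _).trans (c₀'' _).symm)
  let L₄ : I × I × I → P := fun x => op (c x.2) • L₃ x
  have hL₄ : Continuous L₄ := h.act_continuous (by fun_prop) (by fun_prop)
  have eL₄ : ∀ x, π (L₄ x) = f x := fun x => by rw [h.proj_act, eL₃]
  have s₄ : ∀ w t, L₄ (w, 0, t) = p := fun w t => by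
    simp only [L₄, cs, op_one, one_smul]; exact s₃ w t
  have t₄ : ∀ w s, L₄ (w, s, 0) = p := fun w s => by
    simp only [L₄, ct, op_one, one_smul]; exact t₃ w s
  have u₄ : ∀ w s, L₄ (w, s, 1) = p := fun w s => by
    simp only [L₄, cu, op_one, one_smul]; exact u₃ w s
  obtain ⟨d, hd, ed⟩ := h.exists_div_continuous (F := fun x : I × I => L₄ (1, x))
    (F' := F₁) (by fun_prop) hF₁ fun t => by rw [eL₄, e₁]
  have ds : ∀ t, d (0, t) = 1 := fun t => h.eq_one_of_act_eq (ed (0, t)) ((s₄ _ _).trans (c₁ _).symm)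
  have dt : ∀ s, d (s, 0) = 1 := fun s => h.eq_one_of_act_eq (ed (s, 0)) ((t₄ _ _).trans (c₁' _).symm)
  have du : ∀ s, d (s, 1) = 1 := fun s =>
    h.eq_one_of_act_eq (ed (s, 1)) ((u₄ _ _).trans (c₁'' _).symm)
  -- For `w = 0` the argument is `(0, t)`, where `d` is trivial, so the end `F₀` is kept; `d` is
  -- trivial for `t = 0` and `t = 1` in any case.
  refine ⟨fun x => op (d (x.2.1 * x.1, x.2.2)) • L₄ x, h.act_continuous (by fun_prop) (by fun_prop),
    fun x => by rw [h.proj_act, eL₄], fun x => ?_, fun x => ?_, fun w s => ?_, fun w s => ?_⟩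
  · simp only [mul_zero, ds, op_one, one_smul]; exact ec x
  · simp only [mul_one]; exact ed x
  · simp only [dt, op_one, one_smul]; exact t₄ w s
  · simp only [du, op_one, one_smul]; exact u₄ w s

end IsTopPrincipal

end SquareLifts

/-! ### Loop classes and explicit homotopies. -/

section LoopClasses

open unitInterval

variable {X Y : Type*} [TopologicalSpace X] [TopologicalSpace Y] {x y : X}

theorem Path.homotopic_iff_exists {p q : Path x y} : p.Homotopic q ↔ ∃ H : I × I → X,
    Continuous H ∧ (∀ t, H (0, t) = p t) ∧ (∀ t, H (1, t) = q t) ∧ (∀ s, H (s, 0) = x) ∧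
      ∀ s, H (s, 1) = y := by
  constructor
  · rintro ⟨H⟩
    exact ⟨H, H.continuous, fun t => by simp, fun t => by simp, fun s => by simp, fun s => by simp⟩
  · rintro ⟨H, hH, h0, h1, hx, hy⟩
    refine ⟨⟨⟨⟨H, hH⟩, h0, h1⟩, ?_⟩⟩
    rintro s t (rfl | rfl)
    · exact (hx s).trans p.source.symm
    · exact (hy s).trans p.target.symm

/-- The class of a loop in the fundamental group. -/
abbrev loopClass (γ : Path x x) : FundamentalGroup X x :=
  FundamentalGroup.fromPath (Path.Homotopic.Quotient.mk γ)

theorem loopClass_surjective (a : FundamentalGroup X x) : ∃ γ : Path x x, loopClass γ = a :=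
  Quotient.exists_rep a

theorem loopClass_eq_iff {γ δ : Path x x} : loopClass γ = loopClass δ ↔ γ.Homotopic δ :=
  Path.Homotopic.Quotient.eq

theorem loopClass_eq_one_iff {γ : Path x x} : loopClass γ = 1 ↔ γ.Homotopic (Path.refl x) :=
  Path.Homotopic.Quotient.eq

theorem pi1Map_loopClass {f : X → Y} (hf : Continuous f) {y : Y} (h : f x = y) (γ : Path x x) :
    pi1Map f hf h (loopClass γ) = loopClass ((γ.map hf).cast h.symm h.symm) :=
  FundamentalGroup.mapOfEq_apply _ _ _

end LoopClasses

/-! ### The fundamental group of a reduction. -/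

section Reduction

open Set unitInterval

variable {G H M P R : Type*} [Group G] [TopologicalSpace G] [Group H] [TopologicalSpace H]
  [TopologicalSpace M] [TopologicalSpace P] [MulAction Gᵐᵒᵖ P] [TopologicalSpace R]
  [MulAction Hᵐᵒᵖ R] {πP : P → M} {πR : R → M} {ι : H →* G} {κ : R → P}

/-- The projection of a loop in `P` lifts to a path in `R`, which can be closed up along a path in
`H`. Its image in `P` then differs from the given loop by a loop in `G`. Up to homotopy this comes
from a loop in `H`, which is absorbed into the loop in `R`. -/
theorem IsTopPrincipal.pi1Map_surjective [PathConnectedSpace H] (hP : IsTopPrincipal G πP)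
    (hR : IsTopPrincipal H πR) (hι : Continuous ι) (hκ : Continuous κ)
    (hπ : ∀ r, πP (κ r) = πR r) (hact : ∀ (r : R) (h : H), κ (op h • r) = op (ι h) • κ r)
    (hs : Function.Surjective (pi1Map ι hι (map_one ι))) {r₀ : R} {p₀ : P} (h₀ : κ r₀ = p₀) :
    Function.Surjective (pi1Map κ hκ h₀) := by
  subst h₀
  intro a
  obtain ⟨α, rfl⟩ := loopClass_surjective a
  obtain ⟨L, hL, eL, L0⟩ := hR.exists_path_lift (f := fun t => πP (α t))
    (hP.continuous_proj.comp α.continuous) r₀ (by simp [hπ])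
  obtain ⟨k, hk⟩ := hR.transitive (L 1) r₀ (by rw [eL, α.target, hπ])
  let η : Path (1 : H) k := PathConnectedSpace.somePath 1 k
  let β : Path r₀ r₀ := ⟨⟨fun t => op (η t) • L t, hR.act_continuous hL η.continuous⟩,
    by simp [L0], by simp [hk]⟩
  have eβ : ∀ t, πR (β t) = πP (α t) := fun t => (hR.proj_act _ _).trans (eL t)
  obtain ⟨g, hg, eg⟩ := hP.exists_div_continuous (F := fun t => κ (β t)) (F' := α)
    (by fun_prop) α.continuous fun t => by rw [hπ, eβ]
  let γ : Path (1 : G) 1 := ⟨⟨g, hg⟩, hP.eq_one_of_act_eq (eg 0) (by simp),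
    hP.eq_one_of_act_eq (eg 1) (by simp)⟩
  obtain ⟨b, hb⟩ := hs (loopClass γ)
  obtain ⟨δ, rfl⟩ := loopClass_surjective b
  rw [pi1Map_loopClass, loopClass_eq_iff, Path.homotopic_iff_exists] at hb
  obtain ⟨K, hK, K0, K1, Kx, Ky⟩ := hb
  let β' : Path r₀ r₀ := ⟨⟨fun t => op (δ t) • β t, hR.act_continuous β.continuous δ.continuous⟩,
    by simp, by simp⟩
  refine ⟨loopClass β', ?_⟩
  rw [pi1Map_loopClass, loopClass_eq_iff, Path.homotopic_iff_exists]
  refine ⟨fun x => op (K x) • κ (β x.2), hP.act_continuous (by fun_prop) hK, fun t => ?_,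
    fun t => ?_, fun s => ?_, fun s => ?_⟩
  · simp only [K0]
    exact (hact _ _).symm
  · simp only [K1]
    exact eg t
  · simp [Kx]
  · simp [Ky]

/-- The pointwise action of a path in the group on a point. -/
theorem IsTopPrincipal.exists_homotopy_of_projPi1 (hR : IsTopPrincipal H πR) {r₀ : R}
    {f : I × I → M} (hf : Continuous f) (β : Path r₀ r₀) (f0 : ∀ t, f (0, t) = πR (β t))
    (f1 : ∀ t, f (1, t) = πR r₀) (fl : ∀ s, f (s, 0) = πR r₀) (fr : ∀ s, f (s, 1) = πR r₀) :
    ∃ (F : I × I → R) (c : Path (1 : H) 1), Continuous F ∧ (∀ x, πR (F x) = f x) ∧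
      (∀ t, F (0, t) = β t) ∧ (∀ s, F (s, 0) = r₀) ∧ (∀ s, F (s, 1) = r₀) ∧
      ∀ t, F (1, t) = op (c t) • r₀ := by
  obtain ⟨F, hF, eF, F0, Fl, Fr⟩ := hR.exists_square_lift hf (β := β) (β₀ := fun _ => r₀)
    (β₁ := fun _ => r₀) β.continuous continuous_const continuous_const (fun t => (f0 t).symm)
    (fun t => (fl t).symm) (fun t => (fr t).symm) (by simp) (by simp)
  obtain ⟨c, hc, ec⟩ := hR.exists_div_continuous (F := fun _ => r₀) (F' := fun t => F (1, t))
    continuous_const (by fun_prop) fun t => by rw [eF, f1]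
  refine ⟨F, ⟨⟨c, hc⟩, hR.eq_one_of_act_eq (ec 0) (Fl 1).symm,
    hR.eq_one_of_act_eq (ec 1) (Fr 1).symm⟩, hF, eF, F0, Fl, Fr, fun t => (ec t).symm⟩

/-- Lifting the projection of a null homotopy to `R` deforms the given loop into an orbit loop `t ↦
r₀ c(t)`. Comparing the image of this lift with the null homotopy itself shows that `ι ∘ c` is null
homotopic, hence so is `c`. -/
theorem IsTopPrincipal.pi1Map_injective (hP : IsTopPrincipal G πP)
    (hR : IsTopPrincipal H πR) (hι : Continuous ι) (hκ : Continuous κ)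
    (hπ : ∀ r, πP (κ r) = πR r) (hact : ∀ (r : R) (h : H), κ (op h • r) = op (ι h) • κ r)
    (hs : Function.Injective (pi1Map ι hι (map_one ι))) {r₀ : R} {p₀ : P} (h₀ : κ r₀ = p₀) :
    Function.Injective (pi1Map κ hκ h₀) := by
  subst h₀
  rw [injective_iff_map_eq_one]
  intro a ha
  obtain ⟨β, rfl⟩ := loopClass_surjective a
  rw [pi1Map_loopClass, loopClass_eq_one_iff, Path.homotopic_iff_exists] at ha
  obtain ⟨Γ, hΓ, Γ0, Γ1, Γl, Γr⟩ := ha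
  obtain ⟨F, c, hF, eF, F0, Fl, Fr, F1⟩ := hR.exists_homotopy_of_projPi1
    (f := fun x => πP (Γ x)) (hP.continuous_proj.comp hΓ) β (fun t => by rw [Γ0]; exact hπ _)
    (fun t => by rw [Γ1]; exact hπ _) (fun t => by rw [Γl]; exact hπ _)
    (fun t => by rw [Γr]; exact hπ _)
  obtain ⟨g, hg, eg⟩ := hP.exists_div_continuous (F := Γ) (F' := fun x => κ (F x))
    hΓ (by fun_prop) fun t => by rw [hπ, eF]
  -- The difference `g` of the two squares is trivial on three sides and equal to `ι ∘ c` on the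
  -- fourth.
  have hc : (c.map hι).cast (map_one ι).symm (map_one ι).symm |>.Homotopic (Path.refl 1) := by
    refine Path.Homotopic.symm (Path.homotopic_iff_exists.2 ⟨g, hg, fun t => ?_, fun t => ?_,
      fun s => ?_, fun s => ?_⟩)
    · exact hP.eq_one_of_act_eq (eg _) (by rw [Γ0, F0]; rfl)
    · refine hP.act_injective (κ r₀) ?_
      have := eg (1, t)
      rw [Γ1, F1, hact] at this
      exact this
    · exact hP.eq_one_of_act_eq (eg _) (by rw [Γl, Fl])
    · exact hP.eq_one_of_act_eq (eg _) (by rw [Γr, Fr])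
  have hc' : loopClass c = 1 := by
    apply hs
    rw [map_one, pi1Map_loopClass, loopClass_eq_one_iff.2 hc]
  rw [loopClass_eq_one_iff] at hc' ⊢
  have h1 : β.Homotopic (((c.map (f := fun h : H => op h • r₀)
      (hR.act_continuous continuous_const continuous_id)).cast (by simp) (by simp))) :=
    Path.homotopic_iff_exists.2 ⟨F, hF, F0, F1, Fl, Fr⟩
  refine h1.trans ?_
  obtain ⟨K, hK, K0, K1, Kl, Kr⟩ := Path.homotopic_iff_exists.1 hc'
  refine Path.homotopic_iff_exists.2 ⟨fun x => op (K x) • r₀,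
    hR.act_continuous continuous_const hK, fun t => ?_, fun t => ?_, fun s => ?_, fun s => ?_⟩
  · simp [K0]
  · simp [K1]
  · simp [Kl]
  · simp [Kr]

end Reduction

/-! ### The connecting homomorphism. -/

section Connecting

open unitInterval

variable {G M P : Type*} [Group G] [TopologicalSpace G] [TopologicalSpace M]
    [TopologicalSpace P] [MulAction Gᵐᵒᵖ P] {π : P → M}

theorem mem_boundary_fin_two {y : Fin 2 → I} :
    y ∈ Cube.boundary (Fin 2) ↔ y 0 = 0 ∨ y 0 = 1 ∨ y 1 = 0 ∨ y 1 = 1 := by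
  simp [Cube.boundary, Fin.exists_fin_two, or_assoc]

theorem genLoop_square_boundary {m : M} (A : GenLoop (Fin 2) M m) {s t : I}
    (h : s = 0 ∨ s = 1 ∨ t = 0 ∨ t = 1) : A ![s, t] = m :=
  A.2 _ (mem_boundary_fin_two.2 h)

theorem continuous_vec_two : Continuous fun x : I × I => (![x.1, x.2] : Fin 2 → I) :=
  continuous_pi fun i => by fin_cases i <;> simp <;> fun_prop

theorem IsTopPrincipal.exists_connectingRel (hP : IsTopPrincipal G π) (p₀ : P)
    (a : π_ 2 M (π p₀)) : ∃ b : FundamentalGroup G 1, ConnectingRel π p₀ a b := by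
  obtain ⟨A, rfl⟩ := Quotient.exists_rep a
  obtain ⟨F, c, hF, eF, F0, Fl, Fr, F1⟩ := hP.exists_homotopy_of_projPi1
    (f := fun x => A ![x.1, x.2]) (A.1.continuous.comp continuous_vec_two) (Path.refl p₀)
    (fun t => genLoop_square_boundary A (by simp)) (fun t => genLoop_square_boundary A (by simp))
    (fun t => genLoop_square_boundary A (by simp)) (fun t => genLoop_square_boundary A (by simp))
  exact ⟨_, A, ⟨F, hF⟩, c, rfl, rfl, fun s t => eF (s, t), F0, Fl, Fr, F1⟩

/-- A homotopy of representatives in `M` lifts to a cube whose ends are the two given lifts. Its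
remaining face lies in the orbit of `p₀`, and is therefore a homotopy of loops in `G`. -/
theorem IsTopPrincipal.connectingRel_unique (hP : IsTopPrincipal G π) (p₀ : P)
    {a : π_ 2 M (π p₀)} {b b' : FundamentalGroup G 1} (h : ConnectingRel π p₀ a b)
    (h' : ConnectingRel π p₀ a b') : b = b' := by
  obtain ⟨A, F, γ, rfl, rfl, eF, F0, Fl, Fr, F1⟩ := h
  obtain ⟨A', F', γ', hA, rfl, eF', F0', Fl', Fr', F1'⟩ := h'
  obtain ⟨H⟩ := Quotient.exact hA.symm
  have Hb : ∀ (w s t : I), (s = 0 ∨ s = 1 ∨ t = 0 ∨ t = 1) → H (w, ![s, t]) = π p₀ := by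
    intro w s t hst
    rw [H.eq_fst w (mem_boundary_fin_two.2 hst)]
    exact genLoop_square_boundary A hst
  obtain ⟨K, hK, eK, K0, K1, Kl, Kr⟩ := hP.exists_cube_lift (f := fun x => H (x.1, ![x.2.1, x.2.2]))
    (by
      have := continuous_vec_two.comp (continuous_snd (X := I) (Y := I × I))
      exact H.continuous.comp (continuous_fst.prodMk this))
    F.continuous F'.continuous p₀ (fun x => by simp [eF]) (fun x => by simp [eF'])
    F0 Fl Fr F0' Fl' Fr' (fun w t => Hb _ _ _ (by simp)) (fun w t => Hb _ _ _ (by simp))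
    (fun w t => Hb _ _ _ (by simp))
  obtain ⟨c, hc, ec⟩ := hP.exists_div_continuous (K := I × I) (F := fun _ => p₀)
    (F' := fun x => K (x.1, 1, x.2)) continuous_const (by fun_prop)
    fun x => by rw [eK, Hb _ _ _ (by simp)]
  refine loopClass_eq_iff.2 (Path.homotopic_iff_exists.2 ⟨c, hc, fun t => ?_, fun t => ?_,
    fun s => ?_, fun s => ?_⟩)
  · exact hP.act_injective p₀ (by rw [ec, K0, F1])
  · exact hP.act_injective p₀ (by rw [ec, K1, F1'])
  · exact hP.eq_one_of_act_eq (ec _) (Kl _ _).symm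
  · exact hP.eq_one_of_act_eq (ec _) (Kr _ _).symm

/-- The two lifts can be concatenated in the direction of `t`, being constantly `p₀` for `t = 0` and
`t = 1`. -/
theorem ConnectingRel.mul {p₀ : P}
    {a a' : π_ 2 M (π p₀)} {b b' : FundamentalGroup G 1} (h : ConnectingRel π p₀ a b)
    (h' : ConnectingRel π p₀ a' b') : ConnectingRel π p₀ (a * a') (b * b') := by
  obtain ⟨A, F, γ, rfl, rfl, eF, F0, Fl, Fr, F1⟩ := h
  obtain ⟨A', F', γ', rfl, rfl, eF', F0', Fl', Fr', F1'⟩ := h'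
  let c : I → I := fun t => Set.projIcc 0 1 zero_le_one (2 * (t : ℝ))
  let c' : I → I := fun t => Set.projIcc 0 1 zero_le_one (2 * (t : ℝ) - 1)
  have hc : Continuous c := continuous_projIcc.comp (by fun_prop)
  have hc' : Continuous c' := continuous_projIcc.comp (by fun_prop)
  have hpt : ∀ t : I, (γ'.trans γ) t = if (t : ℝ) ≤ 1 / 2 then γ' (c t) else γ (c' t) := by
    intro t
    rw [Path.trans_apply]
    split_ifs with ht
    · congr 1
      exact (Set.projIcc_of_mem _ _).symm
    · congr 1
      exact (Set.projIcc_of_mem _ _).symm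
  -- In `π_ 2` as in `FundamentalGroup` the product `x * y` is represented by running through `y`
  -- first, whence the order.
  refine ⟨GenLoop.transAt 1 A' A, ⟨fun x => if (x.2 : ℝ) ≤ 1 / 2 then F' (x.1, c x.2) else
    F (x.1, c' x.2), ?_⟩, γ'.trans γ, HomotopyGroup.mul_spec.symm, rfl, ?_, ?_, ?_, ?_, ?_⟩
  · refine Continuous.if_le (by fun_prop) (by fun_prop) (by fun_prop) continuous_const ?_
    rintro ⟨s, t⟩ ht
    have h1 : c t = 1 := by
      apply Set.projIcc_of_right_le
      have : (t : ℝ) = 1 / 2 := ht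
      linarith
    have h2 : c' t = 0 := by
      apply Set.projIcc_of_le_left
      have : (t : ℝ) = 1 / 2 := ht
      linarith
    simp only [h1, h2, Fr', Fl]
  · intro s t
    have h0 : GenLoop.transAt 1 A' A ![s, t] =
      if (t : ℝ) ≤ 1 / 2 then A' (Function.update ![s, t] 1 (c t)) else
        A (Function.update ![s, t] 1 (c' t)) := rfl
    have hu : ∀ t', Function.update ![s, t] 1 t' = ![s, t'] := fun t' => by
      ext i; fin_cases i <;> simp
    rw [h0, hu, hu]
    change π (if _ then _ else _) = _
    split_ifs
    · exact eF' _ _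
    · exact eF _ _
  · intro t
    change (if _ then _ else _) = _
    split_ifs
    · exact F0' _
    · exact F0 _
  · intro s
    have h1 : c 0 = 0 := Set.projIcc_of_le_left _ (by simp)
    change (if _ then _ else _) = _
    rw [if_pos (by simp), h1]
    exact Fl' _
  · intro s
    have h1 : c' 1 = 1 := Set.projIcc_of_right_le _ (by norm_num)
    change (if _ then _ else _) = _
    rw [if_neg (by norm_num), h1]
    exact Fr _
  · intro t
    rw [hpt]
    change (if _ then _ else _) = _
    split_ifs
    · exact F1' _
    · exact F1 _

theorem IsTopPrincipal.exists_connectingHom (hP : IsTopPrincipal G π) (p₀ : P) :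
    ∃ h : π_ 2 M (π p₀) →* FundamentalGroup G 1, ∀ a b, ConnectingRel π p₀ a b ↔ h a = b := by
  choose h hh using hP.exists_connectingRel p₀
  refine ⟨MonoidHom.mk' h fun a a' => hP.connectingRel_unique p₀ (hh _)
    ((hh a).mul (hh a')), fun a b => ⟨fun hab => ?_, fun hab => ?_⟩⟩
  · exact hP.connectingRel_unique p₀ (hh a) hab
  · exact hab ▸ hh a

theorem ConnectingRel.map {H R : Type*} [Group H] [TopologicalSpace H] [TopologicalSpace R]
    [MulAction Hᵐᵒᵖ R] {πR : R → M} {ι : H →* G} {κ : R → P} (hι : Continuous ι)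
    (hκ : Continuous κ) (hπ : ∀ r, π (κ r) = πR r)
    (hact : ∀ (r : R) (h : H), κ (op h • r) = op (ι h) • κ r) {r₀ : R} {m₀ : M} {a : π_ 2 M m₀}
    {b : FundamentalGroup H 1} (h : ConnectingRel πR r₀ a b) :
    ConnectingRel π (κ r₀) a (pi1Map ι hι (map_one ι) b) := by
  obtain ⟨A, F, γ, rfl, rfl, eF, F0, Fl, Fr, F1⟩ := h
  refine ⟨A, ⟨fun x => κ (F x), by fun_prop⟩, _, rfl, (pi1Map_loopClass hι _ γ).symm,
    fun s t => (hπ _).trans (eF s t), fun t => congrArg κ (F0 t), fun t => congrArg κ (Fl t),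
    fun t => congrArg κ (Fr t), fun t => ?_⟩
  exact (congrArg κ (F1 t)).trans (hact _ _)

end Connecting

/-! ### Second countability of connected manifolds. -/

section SigmaCompact

open Set

/-- In a locally finite cover by open sets contained in compact ones, only finitely many members are
reached from a given one by chains of length `n`, and the union of all members reached is clopen.
The resulting second countability is used to show that the total spaces constructed later are
paracompact. -/
theorem sigmaCompactSpace_of_connected_paracompact (X : Type*) [TopologicalSpace X]
    [WeaklyLocallyCompactSpace X] [ParacompactSpace X] [ConnectedSpace X] : SigmaCompactSpace X := by
  have hK : ∀ x : X, ∃ K : Set X, IsCompact K ∧ K ∈ 𝓝 x := exists_compact_mem_nhds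
  choose K hKc hK using hK
  obtain ⟨v, hvo, hvu, hvf, hvK⟩ := precise_refinement (fun x => interior (K x))
    (fun x => isOpen_interior)
    (iUnion_eq_univ_iff.2 fun x => ⟨x, mem_interior_iff_mem_nhds.2 (hK x)⟩)
  replace hvK : ∀ i, v i ⊆ K i := fun i => (hvK i).trans interior_subset
  obtain ⟨x₀⟩ : Nonempty X := inferInstance
  obtain ⟨i₀, hi₀⟩ := iUnion_eq_univ_iff.1 hvu x₀
  -- `S n` indexes the members reached after `n` steps; contact is measured with the compact sets `K
  -- j`, so that finiteness is preserved.
  let S : ℕ → Set X := fun n => Nat.rec {i₀} (fun _ T => {i | (v i ∩ ⋃ j ∈ T, K j).Nonempty}) n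
  have hSf : ∀ n, (S n).Finite := by
    intro n
    induction n with
    | zero => exact finite_singleton i₀
    | succ n ih =>
      exact hvf.finite_nonempty_inter_compact (ih.isCompact_biUnion fun j _ => hKc j)
  let A : Set X := ⋃ n, ⋃ j ∈ S n, v j
  have hA : IsClopen A := by
    refine ⟨⟨isOpen_iff_forall_mem_open.2 fun x hx => ?_⟩,
      isOpen_iUnion fun n => isOpen_biUnion fun j _ => hvo j⟩
    obtain ⟨i, hi⟩ := iUnion_eq_univ_iff.1 hvu x
    -- If `v i` met the union, it would itself be reached one step later.
    refine ⟨v i, fun y hy hyA => hx ?_, hvo i, hi⟩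
    obtain ⟨n, hn⟩ := mem_iUnion.1 hyA
    obtain ⟨j, hj, hyj⟩ := mem_iUnion₂.1 hn
    refine mem_iUnion.2 ⟨n + 1, mem_iUnion₂.2 ⟨i, ?_, hi⟩⟩
    exact ⟨y, hy, mem_iUnion₂.2 ⟨j, hj, hvK j hyj⟩⟩
  have hAu : A = univ := hA.eq_univ ⟨x₀, mem_iUnion.2 ⟨0, mem_iUnion₂.2 ⟨i₀, rfl, hi₀⟩⟩⟩
  refine ⟨⟨fun n => ⋃ j ∈ S n, K j, fun n => (hSf n).isCompact_biUnion fun j _ => hKc j,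
    eq_univ_of_subset ?_ hAu⟩⟩
  exact iUnion_mono fun n => iUnion₂_mono fun j _ => hvK j

theorem secondCountable_of_connected_manifold (E X : Type*) [NormedAddCommGroup E]
    [NormedSpace ℝ E] [FiniteDimensional ℝ E] [TopologicalSpace X] [ChartedSpace E X]
    [ParacompactSpace X] [ConnectedSpace X] : SecondCountableTopology X := by
  have : ProperSpace E := FiniteDimensional.proper ℝ E
  have : LocallyCompactSpace X := ChartedSpace.locallyCompactSpace E X
  have := sigmaCompactSpace_of_connected_paracompact X
  exact ChartedSpace.secondCountable_of_sigmaCompact E X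

end SigmaCompact

/-! ### Local trivializations and the topology of smooth principal bundles. -/

section SmoothBundles

variable {EG EM EP : Type*}
  [NormedAddCommGroup EG] [NormedSpace ℝ EG] [NormedAddCommGroup EM] [NormedSpace ℝ EM]
  [NormedAddCommGroup EP] [NormedSpace ℝ EP]
  {G : Type*} [Group G] [TopologicalSpace G] [ChartedSpace EG G]
  {M : Type*} [TopologicalSpace M] [ChartedSpace EM M]
  {P : Type*} [TopologicalSpace P] [ChartedSpace EP P] [MulAction Gᵐᵒᵖ P]
  {π : P → M}

variable (EG EM EP G) in
/-- A smooth local trivialization of a principal bundle over an open set `U`, given by a section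
`τ` and the fibre coordinate `ψ`. -/
structure IsLocalTriv (π : P → M) (U : Set M) (τ : M → P) (ψ : P → G) : Prop where
  isOpen : IsOpen U
  section_smooth : ContMDiffOn 𝓘(ℝ, EM) 𝓘(ℝ, EP) ∞ τ U
  coord_smooth : ContMDiffOn 𝓘(ℝ, EP) 𝓘(ℝ, EG) ∞ ψ (π ⁻¹' U)
  proj_section : ∀ m ∈ U, π (τ m) = m
  coord_act : ∀ p, π p ∈ U → op (ψ p) • τ (π p) = p

theorem IsPrincipalBundle.exists_isLocalTriv (hP : IsPrincipalBundle EG EM EP G π) (m₀ : M) :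
    ∃ (U : Set M) (τ : M → P) (ψ : P → G), m₀ ∈ U ∧ IsLocalTriv EG EM EP G π U τ ψ := by
  obtain ⟨U, hU, hm, φ, hs, ht, hφ⟩ := hP.locally_trivial m₀
  refine ⟨U, fun m => φ (m, 1), fun p => (φ.invFun p).2, hm, hU, ?_, ?_, fun m hm => (hφ m hm 1).1,
    fun p hp => ?_⟩
  · refine ContMDiffOn.comp (t := φ.source) φ.contMDiffOn_toFun
      (contMDiffOn_id.prodMk contMDiffOn_const) fun m hm => ?_
    rw [hs]; exact ⟨hm, trivial⟩
  · rw [← ht]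
    exact contMDiff_snd.comp_contMDiffOn φ.contMDiffOn_invFun
  · have hp' : p ∈ φ.target := by rw [ht]; exact hp
    have e1 : φ (φ.invFun p) = p := φ.right_inv hp'
    have e2 : φ.invFun p ∈ φ.source := φ.map_target hp'
    rw [hs] at e2
    have e3 := hφ _ e2.1 (φ.invFun p).2
    have e4 : (φ.invFun p).1 = π p := by
      rw [← e3.1]
      change π (φ (φ.invFun p)) = _
      rw [e1]
    rw [← e4, ← e3.2]
    exact e1

theorem IsPrincipalBundle.act_injective (hP : IsPrincipalBundle EG EM EP G π) (p : P) {g g' : G}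
    (e : op g • p = op g' • p) : g = g' := by
  rw [← mul_inv_eq_one]
  refine hP.free p _ ?_
  rw [op_mul, mul_smul, e, op_inv, inv_smul_smul]

theorem IsLocalTriv.coord_mul {U : Set M} {τ : M → P} {ψ : P → G}
    (hP : IsPrincipalBundle EG EM EP G π) (hU : IsLocalTriv EG EM EP G π U τ ψ)
    {p : P} (hp : π p ∈ U) (g : G) : ψ (op g • p) = ψ p * g := by
  refine hP.act_injective (τ (π p)) ?_
  have h1 := hU.coord_act (op g • p) (by rwa [hP.proj_act])
  rw [hP.proj_act] at h1
  rw [h1, op_mul, mul_smul, hU.coord_act p hp]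

theorem IsLocalTriv.coord_section {U : Set M} {τ : M → P} {ψ : P → G}
    (hP : IsPrincipalBundle EG EM EP G π) (hU : IsLocalTriv EG EM EP G π U τ ψ)
    {m : M} (hm : m ∈ U) : ψ (τ m) = 1 := by
  refine hP.free (τ m) _ ?_
  have := hU.coord_act (τ m) (by rwa [hU.proj_section m hm])
  rwa [hU.proj_section m hm] at this

variable [LieGroup 𝓘(ℝ, EG) ∞ G]

/-- In a local fibre coordinate `ψ` the division map is `(ψ p)⁻¹ * ψ p'`, hence continuous. -/
theorem IsPrincipalBundle.isTopPrincipal (hP : IsPrincipalBundle EG EM EP G π) :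
    IsTopPrincipal G π := by
  have := topologicalGroup_of_lieGroup 𝓘(ℝ, EG) ∞ (G := G)
  refine ⟨hP.surjective, hP.contMDiff_proj.continuous, hP.contMDiff_act.continuous, hP.proj_act,
    hP.free, fun m₀ => ?_, ?_⟩
  · obtain ⟨U, τ, ψ, hm, hU⟩ := hP.exists_isLocalTriv m₀
    exact ⟨U, hU.isOpen, hm, τ, hU.section_smooth.continuousOn, hU.proj_section⟩
  · have hd : ∀ x : P × P, ∃ g : G, π x.1 = π x.2 → op g • x.1 = x.2 := by
      intro x
      by_cases hx : π x.1 = π x.2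
      · obtain ⟨g, hg⟩ := hP.transitive _ _ hx
        exact ⟨g, fun _ => hg⟩
      · exact ⟨1, fun h => absurd h hx⟩
    choose d hd using hd
    refine ⟨d, fun p p' h => hd (p, p') h, ?_⟩
    rintro ⟨p, p'⟩ hpp
    obtain ⟨U, τ, ψ, hm, hU⟩ := hP.exists_isLocalTriv (π p)
    have hV : IsOpen (π ⁻¹' U) := hU.isOpen.preimage hP.contMDiff_proj.continuous
    have hψ : ∀ q, π q ∈ U → ContinuousAt ψ q := fun q hq =>
      hU.coord_smooth.continuousOn.continuousAt (hV.mem_nhds hq)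
    have hpp' : π p = π p' := hpp
    have hc : ContinuousAt (fun x : P × P => (ψ x.1)⁻¹ * ψ x.2) (p, p') :=
      ((hψ p hm).comp continuousAt_fst).inv.mul
        (ContinuousAt.comp (x := (p, p')) (hψ p' (hpp' ▸ hm)) continuousAt_snd)
    have key : ∀ q q' : P, π q = π q' → π q ∈ U → d (q, q') = (ψ q)⁻¹ * ψ q' := by
      intro q q' h hq
      rw [eq_inv_mul_iff_mul_eq, ← hU.coord_mul hP hq, hd (q, q') h]
    refine hc.continuousWithinAt.congr_of_eventuallyEq ?_ (key p p' hpp hm)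
    filter_upwards [self_mem_nhdsWithin, nhdsWithin_le_nhds ((hV.preimage continuous_fst).mem_nhds hm)]
      with x hx hx'
    exact key _ _ hx hx'

omit [LieGroup 𝓘(ℝ, EG) ∞ G] in
/-- A principal bundle may be given by local trivializations in terms of sections. -/
theorem isPrincipalBundle_of_isLocalTriv (hs : Function.Surjective π)
    (hπ : ContMDiff 𝓘(ℝ, EP) 𝓘(ℝ, EM) ∞ π)
    (hact : ContMDiff (𝓘(ℝ, EP).prod 𝓘(ℝ, EG)) 𝓘(ℝ, EP) ∞ (fun x : P × G => op x.2 • x.1))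
    (hπa : ∀ (p : P) (g : G), π (op g • p) = π p)
    (ht : ∀ p p' : P, π p = π p' → ∃ g : G, op g • p = p')
    (hf : ∀ (p : P) (g : G), op g • p = p → g = 1)
    (hU : ∀ m₀ : M, ∃ (U : Set M) (τ : M → P) (ψ : P → G), m₀ ∈ U ∧
      IsLocalTriv EG EM EP G π U τ ψ) : IsPrincipalBundle EG EM EP G π := by
  refine ⟨hs, hπ, hact, hπa, ht, hf, fun m₀ => ?_⟩
  obtain ⟨U, τ, ψ, hm, hU⟩ := hU m₀
  have hinj : ∀ (p : P) {g g' : G}, op g • p = op g' • p → g = g' := fun p g g' e => by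
    rw [← mul_inv_eq_one]
    refine hf p _ ?_
    rw [op_mul, mul_smul, e, op_inv, inv_smul_smul]
  refine ⟨U, hU.isOpen, hm,
    { toFun := fun x => op x.2 • τ x.1
      invFun := fun p => (π p, ψ p)
      source := U ×ˢ Set.univ
      target := π ⁻¹' U
      map_source' := fun x hx => ?_
      map_target' := fun p hp => ⟨hp, trivial⟩
      left_inv' := fun x hx => ?_
      right_inv' := fun p hp => hU.coord_act p hp
      open_source := hU.isOpen.prod isOpen_univ
      open_target := hU.isOpen.preimage hπ.continuous
      contMDiffOn_toFun := ?_
      contMDiffOn_invFun := ?_ }, rfl, rfl, fun m hm g => ⟨?_, ?_⟩⟩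
  · change π _ ∈ U
    rw [hπa, hU.proj_section _ hx.1]; exact hx.1
  · have e : π (op x.2 • τ x.1) = x.1 := by rw [hπa, hU.proj_section _ hx.1]
    refine Prod.ext e (hinj (τ x.1) ?_)
    have := hU.coord_act (op x.2 • τ x.1) (by rw [e]; exact hx.1)
    rwa [e] at this
  · exact hact.comp_contMDiffOn ((hU.section_smooth.comp contMDiffOn_fst fun x hx => hx.1).prodMk
      contMDiffOn_snd)
  · exact hπ.contMDiffOn.prodMk hU.coord_smooth
  · exact (hπa _ _).trans (hU.proj_section _ hm)
  · change op g • τ m = op g • (op 1 • τ m)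
    rw [op_one, one_smul]

-- Points of different fibres are separated in the base, points of one fibre by the fibre
-- coordinate.
omit [LieGroup 𝓘(ℝ, EG) ∞ G] in
theorem IsPrincipalBundle.t2Space [T2Space M] [T2Space G] (hP : IsPrincipalBundle EG EM EP G π) :
    T2Space P := by
  refine ⟨fun p q hpq => ?_⟩
  have hc := hP.contMDiff_proj.continuous
  by_cases h : π p = π q
  · obtain ⟨U, τ, ψ, hm, hU⟩ := hP.exists_isLocalTriv (π p)
    have hV : IsOpen (π ⁻¹' U) := hU.isOpen.preimage hc
    have hψ : ψ p ≠ ψ q := by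
      intro e
      apply hpq
      rw [← hU.coord_act p hm, ← hU.coord_act q (h ▸ hm), e, h]
    obtain ⟨A, B, hA, hB, hpA, hqB, hAB⟩ := t2_separation hψ
    refine ⟨_, _, hU.coord_smooth.continuousOn.isOpen_inter_preimage hV hA,
      hU.coord_smooth.continuousOn.isOpen_inter_preimage hV hB, ⟨hm, hpA⟩,
      ⟨(h ▸ hm : π q ∈ U), hqB⟩, ?_⟩
    exact (hAB.preimage ψ).mono Set.inter_subset_right Set.inter_subset_right
  · obtain ⟨A, B, hA, hB, hpA, hqB, hAB⟩ := t2_separation h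
    exact ⟨_, _, hA.preimage hc, hB.preimage hc, hpA, hqB, hAB.preimage π⟩

omit [LieGroup 𝓘(ℝ, EG) ∞ G] in
theorem IsPrincipalBundle.secondCountableTopology [SecondCountableTopology M]
    [SecondCountableTopology G] (hP : IsPrincipalBundle EG EM EP G π) :
    SecondCountableTopology P := by
  have hc := hP.contMDiff_proj.continuous
  choose U τ ψ hm hU using hP.exists_isLocalTriv
  obtain ⟨S, hS, hSU⟩ := TopologicalSpace.countable_cover_nhds fun m =>
    (hU m).isOpen.mem_nhds (hm m)
  have : Countable S := hS
  have : ∀ m : S, SecondCountableTopology (π ⁻¹' U m) := by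
    intro m
    have hψ : Continuous fun p : π ⁻¹' U m => ψ m p :=
      continuousOn_iff_continuous_domRestrict.1 (hU m).coord_smooth.continuousOn
    have hτ : ContinuousOn (fun x : M × G => op x.2 • τ m x.1) (U m ×ˢ Set.univ) :=
      hP.contMDiff_act.continuous.comp_continuousOn
        (((hU m).section_smooth.continuousOn.comp continuousOn_fst fun x hx => hx.1).prodMk
          continuousOn_snd)
    -- Composed with `(m, g) ↦ τ(m) g` the coordinate map becomes the inclusion, which is inducing.
    have hi : Topology.IsInducing fun p : π ⁻¹' U m => ((⟨π p, p.2⟩ : U m), ψ m p) := by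
      have h1 : Continuous fun p : π ⁻¹' U m => ((⟨π p, p.2⟩ : U m), ψ m p) :=
        (Continuous.subtype_mk (hc.comp continuous_subtype_val) _).prodMk hψ
      have h2 : Continuous fun x : U m × G => op x.2 • τ m x.1 :=
        hτ.comp_continuous (f := fun x : U m × G => ((x.1 : M), x.2)) (by fun_prop)
          fun x => ⟨x.1.2, trivial⟩
      refine Topology.IsInducing.of_comp h1 h2 ?_
      have h3 : (fun x : U m × G => op x.2 • τ m x.1) ∘
          (fun p : π ⁻¹' U m => ((⟨π p, p.2⟩ : U m), ψ m p)) = Subtype.val :=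
        funext fun p => (hU m).coord_act p p.2
      rw [h3]
      exact Topology.IsInducing.subtypeVal
    exact hi.secondCountableTopology
  refine TopologicalSpace.secondCountableTopology_of_countable_cover (ι := S)
    (U := fun m => π ⁻¹' U m) (fun m => (hU m).isOpen.preimage hc) ?_
  refine Set.iUnion_eq_univ_iff.2 fun p => ?_
  obtain ⟨m, hm, hp⟩ := Set.mem_iUnion₂.1 (hSU.symm ▸ Set.mem_univ (π p))
  exact ⟨⟨m, hm⟩, hp⟩

omit [LieGroup 𝓘(ℝ, EG) ∞ G] in
theorem IsPrincipalBundle.paracompactSpace [T2Space M] [T2Space G] [SecondCountableTopology M]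
    [SecondCountableTopology G] [FiniteDimensional ℝ EP] (hP : IsPrincipalBundle EG EM EP G π) :
    ParacompactSpace P := by
  have := hP.t2Space
  have := hP.secondCountableTopology
  have : ProperSpace EP := FiniteDimensional.proper ℝ EP
  have : LocallyCompactSpace P := ChartedSpace.locallyCompactSpace EP P
  infer_instance

end SmoothBundles

/-! ### Transport of splittings along an isomorphism. -/

section Splitting

theorem isSplitting_iff_map {A A' Γ Γ' B : Type*} [Group A] [Group A'] [Group Γ] [Group Γ']
    [Group B] {i : A →* Γ} {p : Γ →* B} {i' : A' →* Γ'} {p' : Γ' →* B} {ι : A →* A'} {κ : Γ →* Γ'}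
    (hι : Function.Surjective ι) (hκ : Function.Bijective κ) (h₁ : κ.comp i = i'.comp ι)
    (h₂ : p'.comp κ = p) (K : Subgroup Γ) : IsSplitting i p K ↔ IsSplitting i' p' (K.map κ) := by
  have hr : i'.range = i.range.map κ := by
    rw [MonoidHom.map_range, h₁, MonoidHom.range_comp, MonoidHom.range_eq_top.2 hι,
      ← MonoidHom.range_eq_map]
  have hb : Function.Bijective (p.comp K.subtype) ↔
      Function.Bijective (p'.comp (K.map κ).subtype) := by
    have e : p.comp K.subtype = (p'.comp (K.map κ).subtype).comp
        (K.equivMapOfInjective κ hκ.1).toMonoidHom := by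
      ext x
      exact (DFunLike.congr_fun h₂ (x : Γ)).symm
    rw [e]
    exact Function.Bijective.of_comp_iff (p'.comp (K.map κ).subtype)
      (K.equivMapOfInjective κ hκ.1).bijective
  have hinf : K ⊓ i.range = ⊥ ↔ K.map κ ⊓ i'.range = ⊥ := by
    rw [hr, ← Subgroup.map_inf _ _ _ hκ.1, Subgroup.map_eq_bot_iff_of_injective _ hκ.1]
  have hsup : K ⊔ i.range = ⊤ ↔ K.map κ ⊔ i'.range = ⊤ := by
    rw [hr, ← Subgroup.map_sup, ← (Subgroup.map_injective hκ.1).eq_iff,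
      Subgroup.map_top_of_surjective κ hκ.2]
  have hcomm : (∀ x ∈ K, ∀ y ∈ i.range, Commute x y) ↔
      ∀ x ∈ K.map κ, ∀ y ∈ i'.range, Commute x y := by
    rw [hr]
    constructor
    · rintro h _ ⟨x, hx, rfl⟩ _ ⟨y, hy, rfl⟩
      exact (h x hx y hy).map κ
    · intro h x hx y hy
      exact (h _ ⟨x, hx, rfl⟩ _ ⟨y, hy, rfl⟩).of_map hκ.1
  exact ⟨fun h => ⟨hb.1 h.1, hinf.1 h.2, hcomm.1 h.3, hsup.1 h.4⟩,
    fun h => ⟨hb.2 h.1, hinf.2 h.2, hcomm.2 h.3, hsup.2 h.4⟩⟩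

end Splitting

/-! ### Smoothness of lifts through local diffeomorphisms. -/

section LocalDiffeomorphisms

/-- A continuous lift of a smooth map through a local diffeomorphism is smooth. -/
theorem IsLocalDiffeomorph.contMDiffAt_of_comp {E E' F : Type*} [NormedAddCommGroup E]
    [NormedSpace ℝ E] [NormedAddCommGroup E'] [NormedSpace ℝ E'] [NormedAddCommGroup F]
    [NormedSpace ℝ F] {HF : Type*} [TopologicalSpace HF] {I : ModelWithCorners ℝ F HF}
    {X Y N : Type*} [TopologicalSpace X] [ChartedSpace E X] [TopologicalSpace Y]
    [ChartedSpace E' Y] [TopologicalSpace N] [ChartedSpace HF N] {u : X → Y}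
    (hu : IsLocalDiffeomorph 𝓘(ℝ, E) 𝓘(ℝ, E') ∞ u) {f : N → X} {x : N} (hf : ContinuousAt f x)
    (huf : ContMDiffAt I 𝓘(ℝ, E') ∞ (fun y => u (f y)) x) : ContMDiffAt I 𝓘(ℝ, E) ∞ f x := by
  obtain ⟨Φ, hx, hΦ⟩ := hu (f x)
  have ht : u (f x) ∈ Φ.target := by rw [hΦ hx]; exact Φ.map_source hx
  have h1 : ContMDiffAt 𝓘(ℝ, E') 𝓘(ℝ, E) ∞ Φ.invFun (u (f x)) :=
    Φ.contMDiffOn_invFun.contMDiffAt (Φ.open_target.mem_nhds ht)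
  refine (ContMDiffAt.comp x (f := fun y => u (f y)) h1 huf).congr_of_eventuallyEq ?_
  filter_upwards [hf.preimage_mem_nhds (Φ.open_source.mem_nhds hx)] with y hy
  change f y = Φ.invFun (u (f y))
  rw [hΦ hy]
  exact (Φ.left_inv hy).symm

theorem IsLocalDiffeomorph.contMDiff_of_comp {E E' F : Type*} [NormedAddCommGroup E]
    [NormedSpace ℝ E] [NormedAddCommGroup E'] [NormedSpace ℝ E'] [NormedAddCommGroup F]
    [NormedSpace ℝ F] {HF : Type*} [TopologicalSpace HF] {I : ModelWithCorners ℝ F HF}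
    {X Y N : Type*} [TopologicalSpace X] [ChartedSpace E X] [TopologicalSpace Y]
    [ChartedSpace E' Y] [TopologicalSpace N] [ChartedSpace HF N] {u : X → Y}
    (hu : IsLocalDiffeomorph 𝓘(ℝ, E) 𝓘(ℝ, E') ∞ u) {f : N → X} (hf : Continuous f)
    (huf : ContMDiff I 𝓘(ℝ, E') ∞ (fun y => u (f y))) : ContMDiff I 𝓘(ℝ, E) ∞ f :=
  fun x => hu.contMDiffAt_of_comp hf.continuousAt (huf x)

end LocalDiffeomorphisms

/-! ### End points of lifted paths. -/

section Coverings

open unitInterval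

/-- Lifts of homotopic paths with a common starting point have a common end point. -/
theorem IsCoveringMap.target_eq_of_homotopic {E X : Type*} [TopologicalSpace E]
    [TopologicalSpace X] {p : E → X} (hp : IsCoveringMap p) {e a b : E} (δ : Path e a)
    (δ' : Path e b) {γ γ' : Path (p e) (p e)} (hγ : ∀ t, p (δ t) = γ t)
    (hγ' : ∀ t, p (δ' t) = γ' t) (h : γ.Homotopic γ') : a = b := by
  have h1 : δ.toContinuousMap = hp.liftPath γ.toContinuousMap e γ.source :=
    (hp.eq_liftPath_iff' _).2 ⟨funext hγ, δ.source⟩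
  have h2 : δ'.toContinuousMap = hp.liftPath γ'.toContinuousMap e γ'.source :=
    (hp.eq_liftPath_iff' _).2 ⟨funext hγ', δ'.source⟩
  have h3 := hp.liftPath_apply_one_eq_of_homotopicRel h e γ.source γ'.source
  rw [← h1, ← h2] at h3
  simpa using h3

end Coverings

/-! ### Lifting the inclusion to the universal covering groups. -/

section UniversalCovers

variable {EGt EG EHt EH : Type*} [NormedAddCommGroup EGt] [NormedSpace ℝ EGt]
  [NormedAddCommGroup EG] [NormedSpace ℝ EG] [NormedAddCommGroup EHt] [NormedSpace ℝ EHt]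
  [NormedAddCommGroup EH] [NormedSpace ℝ EH]
  {Gt : Type*} [Group Gt] [TopologicalSpace Gt] [ChartedSpace EGt Gt] [LieGroup 𝓘(ℝ, EGt) ∞ Gt]
  {G : Type*} [Group G] [TopologicalSpace G] [ChartedSpace EG G] [LieGroup 𝓘(ℝ, EG) ∞ G]
  {Ht : Type*} [Group Ht] [TopologicalSpace Ht] [ChartedSpace EHt Ht] [LieGroup 𝓘(ℝ, EHt) ∞ Ht]
  {H : Type*} [Group H] [TopologicalSpace H] [ChartedSpace EH H] [LieGroup 𝓘(ℝ, EH) ∞ H]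
  {ρG : Gt →* G} {ρH : Ht →* H} {ι : H →* G}

-- The image is an open subgroup of a connected group, and open subgroups are closed.
omit [LieGroup 𝓘(ℝ, EGt) ∞ Gt] in
theorem IsUniversalCover.surjective [ConnectedSpace G] (hρ : IsUniversalCover EGt EG ρG) :
    Function.Surjective ρG := by
  have := topologicalGroup_of_lieGroup 𝓘(ℝ, EG) ∞ (G := G)
  have ho : IsOpen (ρG.range : Set G) := by
    rw [MonoidHom.coe_range]; exact hρ.isCoveringMap.isOpenMap.isOpen_range
  have := IsClopen.eq_univ ⟨Subgroup.isClosed_of_isOpen _ ho, ho⟩ ⟨1, one_mem _⟩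
  rw [MonoidHom.coe_range] at this
  exact Set.range_eq_univ.1 this

omit [LieGroup 𝓘(ℝ, EG) ∞ G] [LieGroup 𝓘(ℝ, EH) ∞ H] in
/-- A homomorphism of Lie groups lifts to the universal covering groups. -/
theorem exists_lift_universalCover (hG : IsUniversalCover EGt EG ρG)
    (hH : IsUniversalCover EHt EH ρH) (hι : ContMDiff 𝓘(ℝ, EH) 𝓘(ℝ, EG) ∞ ι) :
    ∃ ιt : Ht →* Gt, ContMDiff 𝓘(ℝ, EHt) 𝓘(ℝ, EGt) ∞ ιt ∧ ∀ h, ρG (ιt h) = ι (ρH h) := by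
  have := topologicalGroup_of_lieGroup 𝓘(ℝ, EGt) ∞ (G := Gt)
  have := topologicalGroup_of_lieGroup 𝓘(ℝ, EHt) ∞ (G := Ht)
  have := hH.simplyConnected
  have : LocallyPathConnectedSpace Ht := ChartedSpace.locallyPathConnectedSpace EHt Ht
  obtain ⟨F, ⟨F1, hF⟩, -⟩ := hG.isCoveringMap.existsUnique_continuousMap_lifts
    (⟨fun h => ι (ρH h), hι.continuous.comp hH.isCoveringMap.continuous⟩ : C(Ht, G)) 1 1 (by simp)
  replace hF : ∀ h, ρG (F h) = ι (ρH h) := fun h => congrFun hF h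
  -- Both sides lift `(x, y) ↦ ι (ρH (x * y))` and agree at `(1, 1)`, and `Ht × Ht` is connected.
  have hmul : (fun x : Ht × Ht => F (x.1 * x.2)) = fun x => F x.1 * F x.2 :=
    hG.isCoveringMap.eq_of_comp_eq (by fun_prop) (by fun_prop)
      (funext fun x => by simp [hF]) (1, 1) (by simp [F1])
  refine ⟨⟨⟨F, F1⟩, fun x y => congrFun hmul (x, y)⟩, ?_, hF⟩
  refine hG.isLocalDiffeomorph.contMDiff_of_comp (f := F) F.continuous ?_
  simp only [hF]
  exact hι.comp hH.isLocalDiffeomorph.contMDiff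

-- A path from `1` to an element `h` of the kernel lies over a loop in `H`, and its image in the
-- simply connected `Gt` is a loop. So the loop in `H` becomes null homotopic in `G`, hence is so in
-- `H`, and its lift to `Ht` closes up: `h = 1`.
omit [LieGroup 𝓘(ℝ, EG) ∞ G] [LieGroup 𝓘(ℝ, EH) ∞ H] [LieGroup 𝓘(ℝ, EGt) ∞ Gt]
  [LieGroup 𝓘(ℝ, EHt) ∞ Ht] in
theorem lift_universalCover_injective (hG : IsUniversalCover EGt EG ρG)
    (hH : IsUniversalCover EHt EH ρH) (hι : Continuous ι) (hinj : Function.Injective ι)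
    (hπ : Function.Injective (pi1Map ι hι (map_one ι))) {ιt : Ht →* Gt} (hιt : Continuous ιt)
    (hρ : ∀ h, ρG (ιt h) = ι (ρH h)) : Function.Injective ιt := by
  have := hH.simplyConnected
  have := hG.simplyConnected
  have cH := hH.isCoveringMap.continuous
  have cG := hG.isCoveringMap.continuous
  rw [injective_iff_map_eq_one]
  intro h hh
  have h1 : ρH h = 1 := hinj (by rw [← hρ, hh, map_one, map_one])
  let δ : Path 1 h := PathConnectedSpace.somePath 1 h
  let γ : Path (1 : H) 1 := (δ.map cH).cast (map_one ρH).symm h1.symm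
  let ε : Path (1 : Gt) 1 := (δ.map hιt).cast (map_one ιt).symm hh.symm
  have h2 : pi1Map ι hι (map_one ι) (loopClass γ) = pi1Map ρG cG (map_one ρG) (loopClass ε) := by
    rw [pi1Map_loopClass, pi1Map_loopClass]
    exact congrArg loopClass (Path.ext (funext fun t => (hρ _).symm))
  have h3 : loopClass γ = 1 := hπ (by rw [h2, Subsingleton.elim (loopClass ε) 1, map_one, map_one])
  rw [loopClass_eq_one_iff] at h3
  have h4 : (γ.cast (map_one ρH) (map_one ρH)).Homotopic ((Path.refl 1).cast (map_one ρH) (map_one ρH)) := h3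
  exact (hH.isCoveringMap.target_eq_of_homotopic δ (Path.refl 1) (fun _ => rfl)
    (fun _ => by exact map_one ρH) h4)

-- A path from `1` to `k` in `Gt` lies over a loop in `G`, which is homotopic to the image of a loop
-- in `H`; the end point of the lift of this loop to `Ht` is the required element. This is what
-- makes `Ht` act transitively on the fibres of the fibre product `R ×_P Q`.
omit [LieGroup 𝓘(ℝ, EG) ∞ G] [LieGroup 𝓘(ℝ, EH) ∞ H] [LieGroup 𝓘(ℝ, EGt) ∞ Gt]
  [LieGroup 𝓘(ℝ, EHt) ∞ Ht] in
theorem lift_universalCover_ker (hG : IsUniversalCover EGt EG ρG)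
    (hH : IsUniversalCover EHt EH ρH) (hι : Continuous ι)
    (hπ : Function.Surjective (pi1Map ι hι (map_one ι))) {ιt : Ht →* Gt} (hιt : Continuous ιt)
    (hρ : ∀ h, ρG (ιt h) = ι (ρH h)) {k : Gt} (hk : ρG k = 1) : ∃ h, ρH h = 1 ∧ ιt h = k := by
  have := hG.simplyConnected
  have cG := hG.isCoveringMap.continuous
  let ε : Path 1 k := PathConnectedSpace.somePath 1 k
  obtain ⟨b, hb⟩ := hπ (loopClass ((ε.map cG).cast (map_one ρG).symm hk.symm))
  obtain ⟨γ, rfl⟩ := loopClass_surjective b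
  rw [pi1Map_loopClass, loopClass_eq_iff] at hb
  let Γ := hH.isCoveringMap.liftPath γ 1 (by simp)
  have hΓ : ∀ t, ρH (Γ t) = γ t := congrFun (hH.isCoveringMap.liftPath_lifts γ 1 (by simp))
  have hΓ0 : Γ 0 = 1 := hH.isCoveringMap.liftPath_zero γ 1 (by simp)
  refine ⟨Γ 1, by rw [hΓ, γ.target], ?_⟩
  let δ : Path (1 : Gt) (ιt (Γ 1)) := ⟨⟨fun t => ιt (Γ t), by fun_prop⟩, by simp [hΓ0], rfl⟩
  have h4 : ((((γ.map hι).cast (map_one ι).symm (map_one ι).symm).cast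
    (map_one ρG) (map_one ρG))).Homotopic
    (((ε.map cG).cast (map_one ρG).symm hk.symm).cast (map_one ρG) (map_one ρG)) := hb
  refine hG.isCoveringMap.target_eq_of_homotopic δ ε (fun t => ?_) (fun t => rfl) h4
  exact (hρ _).trans (congrArg ι (hΓ t))

end UniversalCovers

/-! ### Spinor maps are coverings. -/

section SpinorMaps

variable {EGt EG EM EP EQ : Type*} [NormedAddCommGroup EGt] [NormedSpace ℝ EGt]
  [NormedAddCommGroup EG] [NormedSpace ℝ EG] [NormedAddCommGroup EM] [NormedSpace ℝ EM]
  [NormedAddCommGroup EP] [NormedSpace ℝ EP] [NormedAddCommGroup EQ] [NormedSpace ℝ EQ]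
  {Gt : Type*} [Group Gt] [TopologicalSpace Gt] [ChartedSpace EGt Gt]
  {G : Type*} [Group G] [TopologicalSpace G] [ChartedSpace EG G] [LieGroup 𝓘(ℝ, EG) ∞ G]
  {M : Type*} [TopologicalSpace M] [ChartedSpace EM M]
  {P : Type*} [TopologicalSpace P] [ChartedSpace EP P] [MulAction Gᵐᵒᵖ P]
  {Q : Type*} [TopologicalSpace Q] [ChartedSpace EQ Q] [MulAction Gtᵐᵒᵖ Q]
  {πP : P → M} {πQ : Q → M} {ρ : Gt →* G} {u : Q → P}

/-- In local trivializations `u` has the form `(m, g) ↦ (m, c(m) ρ(g))`, which a local inverse of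
`ρ` inverts. -/
theorem IsBundleMorphism.isLocalDiffeomorph (hP : IsPrincipalBundle EG EM EP G πP)
    (hQ : IsPrincipalBundle EGt EM EQ Gt πQ) (hρ : IsLocalDiffeomorph 𝓘(ℝ, EGt) 𝓘(ℝ, EG) ∞ ρ)
    (hu : IsBundleMorphism EQ EP πQ πP ρ u) : IsLocalDiffeomorph 𝓘(ℝ, EQ) 𝓘(ℝ, EP) ∞ u := by
  intro q₀
  obtain ⟨U, τ, ψ, hm, hU⟩ := hQ.exists_isLocalTriv (πQ q₀)
  obtain ⟨U', τ', ψ', hm', hU'⟩ := hP.exists_isLocalTriv (πQ q₀)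
  obtain ⟨Ψ, hΨ, hρΨ⟩ := hρ (ψ q₀)
  have hcP := hP.contMDiff_proj.continuous
  have hcQ := hQ.contMDiff_proj.continuous
  let W : Set M := U ∩ U'
  have hW : IsOpen W := hU.isOpen.inter hU'.isOpen
  let c : M → G := fun m => ψ' (u (τ m))
  have hc : ContMDiffOn 𝓘(ℝ, EM) 𝓘(ℝ, EG) ∞ c W := by
    refine hU'.coord_smooth.comp (t := πP ⁻¹' U')
      (hu.contMDiff.comp_contMDiffOn (hU.section_smooth.mono Set.inter_subset_left)) fun m hm => ?_
    change πP (u (τ m)) ∈ U'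
    rw [hu.proj, hU.proj_section _ hm.1]; exact hm.2
  have key : ∀ q, πQ q ∈ W → ψ' (u q) = c (πQ q) * ρ (ψ q) := by
    intro q hq
    have h1 : πP (u (τ (πQ q))) ∈ U' := by rw [hu.proj, hU.proj_section _ hq.1]; exact hq.2
    rw [← hU'.coord_mul hP h1, ← hu.act, hU.coord_act q hq.1]
  let d : P → G := fun p => (c (πP p))⁻¹ * ψ' p
  have hd : ContMDiffOn 𝓘(ℝ, EP) 𝓘(ℝ, EG) ∞ d (πP ⁻¹' W) :=
    (hc.comp (t := W) hP.contMDiff_proj.contMDiffOn fun p hp => hp).inv.mul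
      (hU'.coord_smooth.mono fun p hp => hp.2)
  have hdu : ∀ q, πQ q ∈ W → d (u q) = ρ (ψ q) := fun q hq => by
    simp only [d]; rw [key q hq, hu.proj, inv_mul_cancel_left]
  have hψ : ContMDiffOn 𝓘(ℝ, EQ) 𝓘(ℝ, EGt) ∞ ψ (πQ ⁻¹' W) := hU.coord_smooth.mono fun p hp => hp.1
  have hmt : ∀ p, πP p ∈ W → πQ (op (Ψ.invFun (d p)) • τ (πP p)) = πP p := fun p hp => by
    rw [hQ.proj_act, hU.proj_section _ hp.1]
  have hri : ∀ p, πP p ∈ W → d p ∈ Ψ.target → u (op (Ψ.invFun (d p)) • τ (πP p)) = p := by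
    intro p hp hdp
    have h1 : πP (u (τ (πP p))) = πP p := by rw [hu.proj, hU.proj_section _ hp.1]
    have h2 : op (c (πP p)) • τ' (πP p) = u (τ (πP p)) := by
      have := hU'.coord_act (u (τ (πP p))) (by rw [h1]; exact hp.2)
      rwa [h1] at this
    have h3 : ρ (Ψ.invFun (d p)) = d p := by
      exact (hρΨ (Ψ.map_target hdp)).trans (Ψ.right_inv hdp)
    rw [hu.act, h3, ← h2, smul_smul, ← op_mul]
    simp only [d, mul_inv_cancel_left]
    exact hU'.coord_act p hp.2
  refine ⟨
    { toFun := u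
      invFun := fun p => op (Ψ.invFun (d p)) • τ (πP p)
      source := πQ ⁻¹' W ∩ ψ ⁻¹' Ψ.source
      target := πP ⁻¹' W ∩ d ⁻¹' Ψ.target
      map_source' := fun q hq => ⟨by change πP (u q) ∈ W; rw [hu.proj]; exact hq.1, ?_⟩
      map_target' := fun p hp => ⟨by change πQ _ ∈ W; rw [hmt p hp.1]; exact hp.1, ?_⟩
      left_inv' := fun q hq => ?_
      right_inv' := fun p hp => hri p hp.1 hp.2
      open_source := hψ.continuousOn.isOpen_inter_preimage (hW.preimage hcQ) Ψ.open_source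
      open_target := hd.continuousOn.isOpen_inter_preimage (hW.preimage hcP) Ψ.open_target
      contMDiffOn_toFun := hu.contMDiff.contMDiffOn
      contMDiffOn_invFun := ?_ }, ⟨⟨hm, hm'⟩, hΨ⟩, fun q _ => rfl⟩
  · change d (u q) ∈ Ψ.target
    rw [hdu q hq.1, hρΨ hq.2]
    exact Ψ.map_source hq.2
  · have h1 : ψ (op (Ψ.invFun (d p)) • τ (πP p)) = Ψ.invFun (d p) := by
      have h2 : πQ (τ (πP p)) = πP p := hU.proj_section _ hp.1.1
      rw [hU.coord_mul hQ (by rw [h2]; exact hp.1.1), hU.coord_section hQ hp.1.1, one_mul]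
    change ψ _ ∈ Ψ.source
    rw [h1]
    exact Ψ.map_target hp.2
  · have h1 : Ψ.invFun (ρ (ψ q)) = ψ q := by rw [hρΨ hq.2]; exact Ψ.left_inv hq.2
    rw [hdu q hq.1, h1, hu.proj]
    exact hU.coord_act q hq.1.1
  · refine hQ.contMDiff_act.comp_contMDiffOn (ContMDiffOn.prodMk ?_ ?_)
    · exact (hU.section_smooth.comp (t := U) hP.contMDiff_proj.contMDiffOn fun p hp => hp.1.1)
    · exact Ψ.contMDiffOn_invFun.comp (hd.mono Set.inter_subset_left) fun p hp => hp.2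

omit [LieGroup 𝓘(ℝ, EG) ∞ G] in
theorem IsBundleMorphism.surjective (hP : IsPrincipalBundle EG EM EP G πP)
    (hQ : IsPrincipalBundle EGt EM EQ Gt πQ) (hρ : Function.Surjective ρ)
    (hu : IsBundleMorphism EQ EP πQ πP ρ u) : Function.Surjective u := by
  intro p
  obtain ⟨q, hq⟩ := hQ.surjective (πP p)
  obtain ⟨g, hg⟩ := hP.transitive (u q) p (by rw [hu.proj, hq])
  obtain ⟨gt, rfl⟩ := hρ g
  exact ⟨op gt • q, by rw [hu.act, hg]⟩

omit [LieGroup 𝓘(ℝ, EG) ∞ G] in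
theorem IsBundleMorphism.exists_ker (hP : IsPrincipalBundle EG EM EP G πP)
    (hQ : IsPrincipalBundle EGt EM EQ Gt πQ)
    (hu : IsBundleMorphism EQ EP πQ πP ρ u) {q q' : Q} (h : u q = u q') :
    ∃ k : Gt, ρ k = 1 ∧ op k • q = q' := by
  obtain ⟨k, hk⟩ := hQ.transitive q q' (by rw [← hu.proj, ← hu.proj, h])
  refine ⟨k, hP.free (u q) _ ?_, hk⟩
  rw [← hu.act, hk, h]

/-- The fibres are the orbits of the free action of `ker ρ`, and a neighbourhood on which `u` is
injective is disjoint from its nontrivial translates. -/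
theorem IsBundleMorphism.isCoveringMap (hP : IsPrincipalBundle EG EM EP G πP)
    (hQ : IsPrincipalBundle EGt EM EQ Gt πQ) (hρ : IsLocalDiffeomorph 𝓘(ℝ, EGt) 𝓘(ℝ, EG) ∞ ρ)
    (hs : Function.Surjective ρ) (hu : IsBundleMorphism EQ EP πQ πP ρ u) : IsCoveringMap u := by
  have hl := (hu.isLocalDiffeomorph hP hQ hρ).isLocalHomeomorph
  have hq : IsQuotientCoveringMap u ρ.ker.op :=
    { toIsQuotientMap := hl.isOpenMap.isQuotientMap hl.continuous (hu.surjective hP hQ hs)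
      continuous_const_smul := fun k => by
        exact hQ.contMDiff_act.continuous.comp (g := fun x : Q × Gt => op x.2 • x.1)
          (f := fun q => (q, unop k.1)) (by fun_prop)
      apply_eq_iff_mem_orbit := by
        intro q q'
        constructor
        · intro h
          obtain ⟨k, hk, rfl⟩ := hu.exists_ker hP hQ h.symm
          exact ⟨⟨op k, hk⟩, rfl⟩
        · rintro ⟨⟨k, hk⟩, rfl⟩
          change u (k • q') = u q'
          have h1 : ρ k.unop = 1 := hk
          have := hu.act q' k.unop
          rwa [h1, op_one, one_smul, op_unop] at this
      disjoint := by
        intro q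
        obtain ⟨e, hqe, he⟩ := hl q
        refine ⟨e.source, e.open_source.mem_nhds hqe, ?_⟩
        rintro ⟨k, hk⟩ ⟨_, ⟨x, hx, rfl⟩, hx'⟩
        have h1 : ρ k.unop = 1 := hk
        have h2 : u (k • x) = u x := by
          have := hu.act x k.unop
          rwa [h1, op_one, one_smul, op_unop] at this
        have h3 : k • x = x := e.injOn hx' hx (by rw [← he]; exact h2)
        have h4 := hQ.free x k.unop h3
        exact Subtype.ext (unop_injective h4) }
  exact hq.isCoveringMap

end SpinorMaps

/-! ### Functoriality of the fundamental group. -/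

section InducedMaps

open unitInterval

variable {X Y Z : Type*} [TopologicalSpace X] [TopologicalSpace Y] [TopologicalSpace Z]

theorem pi1Map_comp {f : X → Y} {g : Y → Z} (hf : Continuous f) (hg : Continuous g) {x : X} {y : Y}
    {z : Z} (h : f x = y) (h' : g y = z) {k : X → Z} (hk : Continuous k) (e : ∀ x, g (f x) = k x)
    (h'' : k x = z) : (pi1Map g hg h').comp (pi1Map f hf h) = pi1Map k hk h'' := by
  ext a
  obtain ⟨γ, rfl⟩ := loopClass_surjective a
  rw [MonoidHom.comp_apply, pi1Map_loopClass, pi1Map_loopClass, pi1Map_loopClass]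
  exact congrArg loopClass (Path.ext (funext fun t => e _))

theorem pi1Map_rfl (f : C(X, Y)) (x : X) :
    pi1Map f f.continuous (rfl : f x = f x) = FundamentalGroup.map f x := by
  ext a
  obtain ⟨γ, rfl⟩ := loopClass_surjective a
  rw [pi1Map_loopClass]
  rfl

end InducedMaps

/-! ### Path connectedness of total spaces. -/

section Connectedness

open unitInterval

theorem IsTopPrincipal.pathConnectedSpace {G M P : Type*} [Group G] [TopologicalSpace G]
    [TopologicalSpace M] [TopologicalSpace P] [MulAction Gᵐᵒᵖ P] {π : P → M}
    [PathConnectedSpace M] [PathConnectedSpace G] (h : IsTopPrincipal G π) :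
    PathConnectedSpace P := by
  obtain ⟨m⟩ : Nonempty M := inferInstance
  obtain ⟨p₀, -⟩ := h.surjective m
  refine ⟨⟨p₀⟩, fun p p' => ?_⟩
  let γ : Path (π p) (π p') := PathConnectedSpace.somePath _ _
  obtain ⟨F, hF, eF, F0⟩ := h.exists_path_lift γ.continuous p (by simp)
  obtain ⟨g, hg⟩ := h.transitive (F 1) p' (by rw [eF, γ.target])
  let δ : Path (1 : G) g := PathConnectedSpace.somePath _ _
  exact ⟨⟨⟨fun t => op (δ t) • F t, h.act_continuous hF δ.continuous⟩, by simp [F0], by simp [hg]⟩⟩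

theorem pathConnectedSpace_of_connected_manifold (E X : Type*) [NormedAddCommGroup E]
    [NormedSpace ℝ E] [TopologicalSpace X] [ChartedSpace E X] [ConnectedSpace X] :
    PathConnectedSpace X := by
  have : LocallyPathConnectedSpace X := ChartedSpace.locallyPathConnectedSpace E X
  exact pathConnectedSpace_iff_connectedSpace.2 inferInstance

end Connectedness

/-! ### Lifting bundle morphisms through spinor maps. -/

section LiftsOfMorphisms

variable {EGt EG EHt EM EP EQ ES : Type*} [NormedAddCommGroup EGt] [NormedSpace ℝ EGt]
  [NormedAddCommGroup EG] [NormedSpace ℝ EG] [NormedAddCommGroup EM] [NormedSpace ℝ EM]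
  [NormedAddCommGroup EP] [NormedSpace ℝ EP] [NormedAddCommGroup EQ] [NormedSpace ℝ EQ]
  [NormedAddCommGroup EHt] [NormedSpace ℝ EHt] [NormedAddCommGroup ES] [NormedSpace ℝ ES]
  {Gt : Type*} [Group Gt] [TopologicalSpace Gt] [ChartedSpace EGt Gt] [LieGroup 𝓘(ℝ, EGt) ∞ Gt]
  {G : Type*} [Group G] [TopologicalSpace G] [ChartedSpace EG G] [LieGroup 𝓘(ℝ, EG) ∞ G]
  {Ht : Type*} [Group Ht] [TopologicalSpace Ht] [ChartedSpace EHt Ht] [LieGroup 𝓘(ℝ, EHt) ∞ Ht]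
  {M : Type*} [TopologicalSpace M] [ChartedSpace EM M]
  {P : Type*} [TopologicalSpace P] [ChartedSpace EP P] [MulAction Gᵐᵒᵖ P]
  {Q : Type*} [TopologicalSpace Q] [ChartedSpace EQ Q] [MulAction Gtᵐᵒᵖ Q]
  {S : Type*} [TopologicalSpace S] [ChartedSpace ES S] [MulAction Htᵐᵒᵖ S]
  {πP : P → M} {πQ : Q → M} {πS : S → M} {ρ : Gt →* G} {u : Q → P} {ιt : Ht →* Gt} {f : S → P}

/-- This is the lifting criterion for the covering `u`. The lift is smooth because `u` is a local
diffeomorphism, and equivariant because two lifts of the same orbit map on the connected group `Ht`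
that agree at `1` are equal. -/
theorem IsBundleMorphism.exists_lift [ConnectedSpace G] [PathConnectedSpace Ht] [ConnectedSpace M]
    (hP : IsPrincipalBundle EG EM EP G πP)
    (hQ : IsPrincipalBundle EGt EM EQ Gt πQ) (hS : IsPrincipalBundle EHt EM ES Ht πS)
    (hρ : IsUniversalCover EGt EG ρ) (hu : IsBundleMorphism EQ EP πQ πP ρ u) (hιt : Continuous ιt)
    (hf : IsBundleMorphism ES EP πS πP (ρ.comp ιt) f) {s₀ : S} {q₀ : Q} {p₀ : P} (hq : u q₀ = p₀)
    (hs : f s₀ = p₀) (hle : (hf.pi1 hs).range ≤ (hu.pi1 hq).range) :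
    ∃ κt : S → Q, IsBundleMorphism ES EQ πS πQ ιt κt ∧ ∀ s, u (κt s) = f s := by
  subst hs
  have := pathConnectedSpace_of_connected_manifold EM M
  have := hS.isTopPrincipal.pathConnectedSpace
  have : LocallyPathConnectedSpace S := ChartedSpace.locallyPathConnectedSpace ES S
  have cov := hu.isCoveringMap hP hQ hρ.isLocalDiffeomorph hρ.surjective
  obtain ⟨F, ⟨F0, hF⟩, -⟩ := cov.existsUnique_continuousMap_lifts_of_range_le
    (f := ⟨f, hf.contMDiff.continuous⟩) (a₀ := s₀) hq (by rw [← pi1Map_rfl]; exact hle)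
  replace hF : ∀ s, u (F s) = f s := congrFun hF
  refine ⟨F, ⟨?_, fun s => ?_, fun s h => ?_⟩, hF⟩
  · refine (hu.isLocalDiffeomorph hP hQ hρ.isLocalDiffeomorph).contMDiff_of_comp F.continuous ?_
    simpa only [hF] using hf.contMDiff
  · rw [← hu.proj, hF, hf.proj]
  · have h1 : Continuous fun h : Ht => F (op h • s) := F.continuous.comp (hS.continuous_orbit s)
    have h2 : Continuous fun h : Ht => op (ιt h) • F s := (hQ.continuous_orbit (F s)).comp hιt
    refine congrFun (cov.eq_of_comp_eq h1 h2 (funext fun h => ?_) 1 (by simp)) h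
    simp only [Function.comp_apply, hF, hf.act, hu.act, MonoidHom.comp_apply]

-- Translation by `k` is a continuous map of `Q` to itself that is compatible with `u` and moves one
-- base point to the other.
omit [LieGroup 𝓘(ℝ, EG) ∞ G] [LieGroup 𝓘(ℝ, EGt) ∞ Gt] in
theorem IsBundleMorphism.range_pi1_le (hQ : IsPrincipalBundle EGt EM EQ Gt πQ)
    (hu : IsBundleMorphism EQ EP πQ πP ρ u) {q q' : Q} {p₀ : P} (hq : u q = p₀) (hq' : u q' = p₀)
    {k : Gt} (hk : ρ k = 1) (hkq : op k • q = q') : (hu.pi1 hq).range ≤ (hu.pi1 hq').range := by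
  have hc : Continuous fun q : Q => op k • q :=
    hQ.contMDiff_act.continuous.comp (g := fun x : Q × Gt => op x.2 • x.1)
      (f := fun q => (q, k)) (by fun_prop)
  have h := pi1Map_comp hc hu.contMDiff.continuous hkq hq' hu.contMDiff.continuous
    (fun x => by rw [hu.act, hk, op_one, one_smul]) hq
  rintro _ ⟨a, rfl⟩
  exact ⟨_, DFunLike.congr_fun h a⟩

omit [LieGroup 𝓘(ℝ, EG) ∞ G] [LieGroup 𝓘(ℝ, EGt) ∞ Gt] in
/-- The image of the fundamental group of a spinor structure does not depend on the base point. -/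
theorem IsBundleMorphism.range_pi1_eq (hP : IsPrincipalBundle EG EM EP G πP)
    (hQ : IsPrincipalBundle EGt EM EQ Gt πQ)
    (hu : IsBundleMorphism EQ EP πQ πP ρ u) {q q' : Q} {p₀ : P} (hq : u q = p₀) (hq' : u q' = p₀) :
    (hu.pi1 hq).range = (hu.pi1 hq').range := by
  obtain ⟨k, hk, e⟩ := hu.exists_ker hP hQ (hq.trans hq'.symm)
  obtain ⟨k', hk', e'⟩ := hu.exists_ker hP hQ (hq'.trans hq.symm)
  exact le_antisymm (hu.range_pi1_le hQ hq hq' hk e) (hu.range_pi1_le hQ hq' hq hk' e')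

-- As `π₁(Gt)` is trivial, `pi1Map_surjective` applies to `κt`; so the inclusion of images that
-- comes with the factorization through `u` is an equality.
omit [LieGroup 𝓘(ℝ, EG) ∞ G] in
theorem IsBundleMorphism.range_pi1_of_lift [PathConnectedSpace Ht] [SimplyConnectedSpace Gt]
    (hP : IsPrincipalBundle EG EM EP G πP)
    (hQ : IsPrincipalBundle EGt EM EQ Gt πQ) (hS : IsPrincipalBundle EHt EM ES Ht πS)
    (hu : IsBundleMorphism EQ EP πQ πP ρ u) (hιt : Continuous ιt)
    (hf : IsBundleMorphism ES EP πS πP (ρ.comp ιt) f) {κt : S → Q}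
    (hκt : IsBundleMorphism ES EQ πS πQ ιt κt) (e : ∀ s, u (κt s) = f s)
    {s₀ : S} {q₀ : Q} {p₀ : P} (hq : u q₀ = p₀) (hs : f s₀ = p₀) :
    (hf.pi1 hs).range = (hu.pi1 hq).range := by
  have h1 : u (κt s₀) = p₀ := (e s₀).trans hs
  rw [hu.range_pi1_eq hP hQ hq h1]
  have h2 : (hu.pi1 h1).comp (hκt.pi1 rfl) = hf.pi1 hs := pi1Map_comp _ _ _ _ _ e _
  have h3 : Function.Surjective (hκt.pi1 (rfl : κt s₀ = κt s₀)) :=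
    hQ.isTopPrincipal.pi1Map_surjective hS.isTopPrincipal hιt hκt.contMDiff.continuous hκt.proj
      hκt.act (fun b => ⟨1, Subsingleton.elim _ _⟩) rfl
  rw [← h2, MonoidHom.range_comp, MonoidHom.range_eq_top.2 h3, ← MonoidHom.range_eq_map]

end LiftsOfMorphisms

/-! ### Classification of spinor structures by subgroups of the fundamental group. -/

section Correspondence

/-- `A` and `B` embed the two sets of classes in `Z`, with the same image. -/
theorem exists_quotient_equiv {X Y Z : Type*} [sX : Setoid X] [sY : Setoid Y] (A : X → Z)
    (B : Y → Z) (hA : ∀ x x' : X, x ≈ x' ↔ A x = A x') (hB : ∀ y y' : Y, y ≈ y' ↔ B y = B y')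
    (h₁ : ∀ x, ∃ y, A x = B y) (h₂ : ∀ y, ∃ x, A x = B y) :
    ∃ Φ : Quotient sX ≃ Quotient sY, ∀ x y, Φ ⟦x⟧ = ⟦y⟧ ↔ A x = B y := by
  choose f hf using h₁
  have hfr : ∀ x x' : X, x ≈ x' → (⟦f x⟧ : Quotient sY) = ⟦f x'⟧ := fun x x' h =>
    Quotient.sound ((hB _ _).2 (by rw [← hf, ← hf, (hA _ _).1 h]))
  let φ : Quotient sX → Quotient sY := Quotient.lift (fun x => ⟦f x⟧) hfr
  have hφ : ∀ x y, φ ⟦x⟧ = ⟦y⟧ ↔ A x = B y := fun x y =>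
    ⟨fun h => (hf x).trans ((hB _ _).1 (Quotient.exact h)),
      fun h => Quotient.sound ((hB _ _).2 ((hf x).symm.trans h))⟩
  refine ⟨Equiv.ofBijective φ ⟨?_, ?_⟩, hφ⟩
  · rintro ⟨x⟩ ⟨x'⟩ h
    have h' : φ ⟦x⟧ = ⟦f x'⟧ := h
    exact Quotient.sound ((hA _ _).2 (((hφ _ _).1 h').trans (hf x').symm))
  · rintro ⟨y⟩
    obtain ⟨x, hx⟩ := h₂ y
    exact ⟨⟦x⟧, (hφ x y).2 hx⟩

variable {EGt EG EM EP : Type*} [NormedAddCommGroup EGt] [NormedSpace ℝ EGt]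
  [NormedAddCommGroup EG] [NormedSpace ℝ EG] [NormedAddCommGroup EM] [NormedSpace ℝ EM]
  [NormedAddCommGroup EP] [NormedSpace ℝ EP]
  {Gt : Type*} [Group Gt] [TopologicalSpace Gt] [ChartedSpace EGt Gt] [LieGroup 𝓘(ℝ, EGt) ∞ Gt]
  {G : Type*} [Group G] [TopologicalSpace G] [ChartedSpace EG G] [LieGroup 𝓘(ℝ, EG) ∞ G]
  {M : Type*} [TopologicalSpace M] [ChartedSpace EM M]
  {P : Type u} [TopologicalSpace P] [ChartedSpace EP P] [MulAction Gᵐᵒᵖ P]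
  {π : P → M} {ρ : Gt →* G}

/-- The case of the identity of `Gt` in `range_pi1_of_lift` and in `exists_lift`: the subgroup is a
complete invariant. -/
theorem SpinorStructure.equivalent_iff_range_eq [ConnectedSpace G] [ConnectedSpace M]
    (hP : IsPrincipalBundle EG EM EP G π) (hρ : IsUniversalCover EGt EG ρ)
    (S T : SpinorStructure EGt EM EP π ρ) {s₀ : S.Q} {t₀ : T.Q} {p₀ : P}
    (hs : S.spinorMap s₀ = p₀) (ht : T.spinorMap t₀ = p₀) :
    S ≈ T ↔ (S.isBundleMorphism.pi1 hs).range = (T.isBundleMorphism.pi1 ht).range := by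
  have := hρ.simplyConnected
  constructor
  · rintro ⟨a, ha, e⟩
    exact T.isBundleMorphism.range_pi1_of_lift (ιt := MonoidHom.id Gt) (f := S.spinorMap) hP
      T.isPrincipalBundle S.isPrincipalBundle continuous_id S.isBundleMorphism ha e ht hs
  · intro h
    obtain ⟨a, ha, e⟩ := T.isBundleMorphism.exists_lift (ιt := MonoidHom.id Gt) (f := S.spinorMap) hP
      T.isPrincipalBundle S.isPrincipalBundle hρ continuous_id S.isBundleMorphism ht hs h.le
    exact ⟨a, ha, e⟩

variable {EHt EH ER : Type*} [NormedAddCommGroup EHt] [NormedSpace ℝ EHt]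
  [NormedAddCommGroup EH] [NormedSpace ℝ EH] [NormedAddCommGroup ER] [NormedSpace ℝ ER]
  {Ht : Type*} [Group Ht] [TopologicalSpace Ht] [ChartedSpace EHt Ht] [LieGroup 𝓘(ℝ, EHt) ∞ Ht]
  {H : Type*} [Group H] [TopologicalSpace H] [ChartedSpace EH H] [LieGroup 𝓘(ℝ, EH) ∞ H]
  {R : Type u} [TopologicalSpace R] [ChartedSpace ER R] [MulAction Hᵐᵒᵖ R]
  {πR : R → M} {ρH : Ht →* H} {ι : H →* G} {κ : R → P} {ιt : Ht →* Gt}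

omit [LieGroup 𝓘(ℝ, EGt) ∞ Gt] [LieGroup 𝓘(ℝ, EHt) ∞ Ht] in
theorem SpinorStructure.isBundleMorphism_comp (hκ : IsBundleMorphism ER EP πR π ι κ)
    (hρι : ∀ h, ρ (ιt h) = ι (ρH h)) (S : SpinorStructure EHt EM ER πR ρH) :
    IsBundleMorphism ER EP S.proj π (ρ.comp ιt) (κ ∘ S.spinorMap) :=
  ⟨hκ.contMDiff.comp S.isBundleMorphism.contMDiff,
    fun s => (hκ.proj _).trans (S.isBundleMorphism.proj s), fun s h => by
      rw [Function.comp_apply, S.isBundleMorphism.act, hκ.act, ← hρι]; rfl⟩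

/-- This converts the equality of subgroups that defines the correspondence into the existence of a
reduction map, so that partners can be found by constructing such maps. -/
theorem SpinorStructure.range_map_eq_iff [ConnectedSpace G] [ConnectedSpace M]
    (hP : IsPrincipalBundle EG EM EP G π) (hρ : IsUniversalCover EGt EG ρ)
    (hρH : IsUniversalCover EHt EH ρH)
    (hκ : IsBundleMorphism ER EP πR π ι κ) (hιt : Continuous ιt) (hρι : ∀ h, ρ (ιt h) = ι (ρH h))
    (S : SpinorStructure EHt EM ER πR ρH) (Q : SpinorStructure EGt EM EP π ρ)
    {r₀ : R} {s₀ : S.Q} {q₀ : Q.Q} (hs : S.spinorMap s₀ = r₀) (hq : Q.spinorMap q₀ = κ r₀) :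
    (S.isBundleMorphism.pi1 hs).range.map (hκ.pi1 (rfl : κ r₀ = κ r₀)) =
      (Q.isBundleMorphism.pi1 hq).range ↔
    ∃ κt : S.Q → Q.Q, IsBundleMorphism ER EP S.proj Q.proj ιt κt ∧
      ∀ s, Q.spinorMap (κt s) = κ (S.spinorMap s) := by
  have := hρ.simplyConnected
  have := hρH.simplyConnected
  have hf := S.isBundleMorphism_comp hκ hρι
  have hs' : (κ ∘ S.spinorMap) s₀ = κ r₀ := congrArg κ hs
  have h1 : (hκ.pi1 (rfl : κ r₀ = κ r₀)).comp (S.isBundleMorphism.pi1 hs) = hf.pi1 hs' :=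
    pi1Map_comp _ _ _ _ _ (fun _ => rfl) _
  rw [← MonoidHom.range_comp, h1]
  constructor
  · intro h
    exact Q.isBundleMorphism.exists_lift hP Q.isPrincipalBundle S.isPrincipalBundle hρ hιt hf hq
      hs' h.le
  · rintro ⟨κt, hκt, e⟩
    exact Q.isBundleMorphism.range_pi1_of_lift hP Q.isPrincipalBundle S.isPrincipalBundle hιt hf
      hκt e hq hs'

/-- The correspondence of spinor structures, given that each spinor structure of one of the
bundles is related to one of the other. -/
theorem SpinorStructure.exists_classes_equiv [ConnectedSpace G] [ConnectedSpace H]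
    [ConnectedSpace M] (hP : IsPrincipalBundle EG EM EP G π) (hρ : IsUniversalCover EGt EG ρ)
    (hR : IsPrincipalBundle EH EM ER H πR) (hρH : IsUniversalCover EHt EH ρH)
    (hκ : IsBundleMorphism ER EP πR π ι κ) (hιt : Continuous ιt) (hρι : ∀ h, ρ (ιt h) = ι (ρH h))
    (r₀ : R) (hinj : Function.Injective (hκ.pi1 (rfl : κ r₀ = κ r₀)))
    (h₁ : ∀ S : SpinorStructure EHt EM ER πR ρH, ∃ (Q : SpinorStructure EGt EM EP π ρ)
      (κt : S.Q → Q.Q), IsBundleMorphism ER EP S.proj Q.proj ιt κt ∧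
      ∀ s, Q.spinorMap (κt s) = κ (S.spinorMap s))
    (h₂ : ∀ Q : SpinorStructure EGt EM EP π ρ, ∃ (S : SpinorStructure EHt EM ER πR ρH)
      (κt : S.Q → Q.Q), IsBundleMorphism ER EP S.proj Q.proj ιt κt ∧
      ∀ s, Q.spinorMap (κt s) = κ (S.spinorMap s)) :
    ∃ Φ : SpinorStructure.Classes EHt EM ER πR ρH ≃ SpinorStructure.Classes EGt EM EP π ρ,
      ∀ (S : SpinorStructure EHt EM ER πR ρH) (Q : SpinorStructure EGt EM EP π ρ),
        (Φ ⟦S⟧ = ⟦Q⟧ ↔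
          ∀ (s₀ : S.Q) (hs : S.spinorMap s₀ = r₀) (q₀ : Q.Q) (hq : Q.spinorMap q₀ = κ r₀),
            (S.isBundleMorphism.pi1 hs).range.map (hκ.pi1 rfl) =
              (Q.isBundleMorphism.pi1 hq).range) ∧
        (Φ ⟦S⟧ = ⟦Q⟧ → ∃ κt : S.Q → Q.Q, IsBundleMorphism ER EP S.proj Q.proj ιt κt ∧
          ∀ s, Q.spinorMap (κt s) = κ (S.spinorMap s)) := by
  have hSs : ∀ S : SpinorStructure EHt EM ER πR ρH, ∃ s₀ : S.Q, S.spinorMap s₀ = r₀ := fun S =>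
    S.isBundleMorphism.surjective hR S.isPrincipalBundle hρH.surjective r₀
  have hQs : ∀ Q : SpinorStructure EGt EM EP π ρ, ∃ q₀ : Q.Q, Q.spinorMap q₀ = κ r₀ := fun Q =>
    Q.isBundleMorphism.surjective hP Q.isPrincipalBundle hρ.surjective (κ r₀)
  choose s hs using hSs
  choose q hq using hQs
  obtain ⟨Φ, hΦ⟩ := exists_quotient_equiv
    (fun S : SpinorStructure EHt EM ER πR ρH =>
      (S.isBundleMorphism.pi1 (hs S)).range.map (hκ.pi1 (rfl : κ r₀ = κ r₀)))
    (fun Q : SpinorStructure EGt EM EP π ρ => (Q.isBundleMorphism.pi1 (hq Q)).range)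
    -- Since `κ_*` is injective, the invariant of `S` loses nothing when read in `π₁(P)`.
    (fun S S' => by
      rw [S.equivalent_iff_range_eq hR hρH S' (hs S) (hs S'), (Subgroup.map_injective hinj).eq_iff])
    (fun Q Q' => Q.equivalent_iff_range_eq hP hρ Q' (hq Q) (hq Q'))
    (fun S => by
      obtain ⟨Q, h⟩ := h₁ S
      exact ⟨Q, (S.range_map_eq_iff hP hρ hρH hκ hιt hρι Q (hs S) (hq Q)).2 h⟩)
    (fun Q => by
      obtain ⟨S, h⟩ := h₂ Q
      exact ⟨S, (S.range_map_eq_iff hP hρ hρH hκ hιt hρι Q (hs S) (hq Q)).2 h⟩)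
  refine ⟨Φ, fun S Q => ⟨?_, fun h => (S.range_map_eq_iff hP hρ hρH hκ hιt hρι Q (hs S) (hq Q)).1
    ((hΦ S Q).1 h)⟩⟩
  rw [hΦ]
  constructor
  · intro h s₀ hs₀ q₀ hq₀
    rw [S.isBundleMorphism.range_pi1_eq hR S.isPrincipalBundle hs₀ (hs S), h]
    exact Q.isBundleMorphism.range_pi1_eq hP Q.isPrincipalBundle _ _
  · intro h
    exact h _ _ _ _

end Correspondence

/-! ### Smooth structures pulled back along local homeomorphisms. -/

section PullbackCharts

variable {E X Y : Type*} [NormedAddCommGroup E] [NormedSpace ℝ E] [TopologicalSpace X]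
  [TopologicalSpace Y] [ChartedSpace E Y] {v : X → Y}

/-- The charted space structure for which a given local homeomorphism is smooth. -/
@[reducible]
noncomputable def IsLocalHomeomorph.pullbackChartedSpace (hv : IsLocalHomeomorph v) :
    ChartedSpace E X where
  atlas := Set.range fun x => (hv x).choose.trans (chartAt E (v x))
  chartAt x := (hv x).choose.trans (chartAt E (v x))
  mem_chart_source x := by
    rw [OpenPartialHomeomorph.trans_source]
    refine ⟨(hv x).choose_spec.1, ?_⟩
    rw [Set.mem_preimage, ← (hv x).choose_spec.2]
    exact mem_chart_source E (v x)
  chart_mem_atlas x := ⟨x, rfl⟩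

/-- The map `v` cancels in changes of charts, which are therefore restrictions of those of `Y`. -/
theorem IsLocalHomeomorph.isManifold_pullback [IsManifold 𝓘(ℝ, E) ∞ Y]
    (hv : IsLocalHomeomorph v) :
    letI := hv.pullbackChartedSpace (E := E)
    IsManifold 𝓘(ℝ, E) ∞ X := by
  let _ := hv.pullbackChartedSpace (E := E)
  refine isManifold_of_contDiffOn 𝓘(ℝ, E) ∞ X ?_
  rintro _ _ ⟨x, rfl⟩ ⟨x', rfl⟩
  have h1 := ((contDiffGroupoid ∞ 𝓘(ℝ, E)).compatible (chart_mem_atlas E (v x))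
    (chart_mem_atlas E (v x')))
  have h2 := (mem_groupoid_of_pregroupoid.1 h1).1
  have e1 : ⇑(hv x).choose = v := (hv x).choose_spec.2.symm
  have e2 : ⇑(hv x').choose = v := (hv x').choose_spec.2.symm
  have key : ∀ y ∈ (hv x).choose.target, v ((hv x).choose.symm y) = y := fun y hy => by
    have := (hv x).choose.right_inv hy
    rwa [e1] at this
  refine ContDiffOn.congr_mono h2 ?_ ?_
  · intro y hy
    simp only [mfld_simps] at hy ⊢
    rw [e2, key _ hy.1.2]
  · intro y hy
    simp only [mfld_simps] at hy ⊢
    rw [e2, key _ hy.1.2] at hy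
    exact ⟨hy.1.1, hy.2.2⟩

/-- In the pulled back chart and the chart it comes from, the map is the identity. -/
theorem IsLocalHomeomorph.isLocalDiffeomorph_pullback [IsManifold 𝓘(ℝ, E) ∞ Y]
    (hv : IsLocalHomeomorph v) :
    letI := hv.pullbackChartedSpace (E := E)
    IsLocalDiffeomorph 𝓘(ℝ, E) 𝓘(ℝ, E) ∞ v := by
  let _ := hv.pullbackChartedSpace (E := E)
  have := hv.isManifold_pullback (E := E)
  intro x
  have e1 : ⇑(hv x).choose = v := (hv x).choose_spec.2.symm
  have hx : x ∈ (chartAt E x).source := mem_chart_source E x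
  let c := (chartAt E x).trans (chartAt E (v x)).symm
  have hc : ∀ y ∈ (chartAt E x).source, v y ∈ (chartAt E (v x)).source ∧
      (chartAt E (v x)).symm (chartAt E x y) = v y := fun y hy => by
    have h1 : chartAt E x = (hv x).choose.trans (chartAt E (v x)) := rfl
    rw [h1, OpenPartialHomeomorph.trans_source, e1] at hy
    refine ⟨hy.2, ?_⟩
    rw [h1, OpenPartialHomeomorph.coe_trans, e1]
    exact (chartAt E (v x)).left_inv hy.2
  have hs : c.source ⊆ (chartAt E x).source := fun y hy => by
    rw [OpenPartialHomeomorph.trans_source] at hy; exact hy.1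
  refine ⟨
    { c.toPartialEquiv with
      open_source := c.open_source
      open_target := c.open_target
      contMDiffOn_toFun := ?_
      contMDiffOn_invFun := ?_ }, ?_, fun y hy => ((hc y (hs hy)).2).symm⟩
  · exact (contMDiffOn_chart_symm (I := 𝓘(ℝ, E)) (n := ∞) (x := v x)).comp
      ((contMDiffOn_chart (I := 𝓘(ℝ, E)) (n := ∞) (x := x)).mono hs) fun y hy => hy.2
  · exact (contMDiffOn_chart_symm (I := 𝓘(ℝ, E)) (n := ∞) (x := x)).comp
      ((contMDiffOn_chart (I := 𝓘(ℝ, E)) (n := ∞) (x := v x)).mono fun y hy => hy.1)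
      fun y hy => hy.2
  · refine ⟨hx, ?_⟩
    change chartAt E x x ∈ (chartAt E (v x)).target
    have h1 : chartAt E x = (hv x).choose.trans (chartAt E (v x)) := rfl
    rw [h1, OpenPartialHomeomorph.coe_trans, e1]
    exact mem_chart_target E (v x)

theorem isLocalHomeomorph_of_injOn {X Y : Type*} [TopologicalSpace X] [TopologicalSpace Y]
    {v : X → Y} (hc : Continuous v) (ho : IsOpenMap v) (hi : ∀ x, ∃ U ∈ 𝓝 x, U.InjOn v) :
    IsLocalHomeomorph v := by
  refine isLocalHomeomorph_iff_isOpenEmbedding_restrict.2 fun x => ?_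
  obtain ⟨U, hU, hinj⟩ := hi x
  obtain ⟨V, hVU, hV, hxV⟩ := mem_nhds_iff.1 hU
  exact ⟨V, hV.mem_nhds hxV, Topology.IsOpenEmbedding.of_continuous_injective_isOpenMap (by fun_prop)
    (Set.injOn_iff_injective.1 (hinj.mono hVU)) (ho.domRestrict hV)⟩

end PullbackCharts

/-! ### From topological to smooth spinor structures. -/

section TopologicalSpinorStructures

variable {EGt EG EM EP : Type*} [NormedAddCommGroup EGt] [NormedSpace ℝ EGt]
  [NormedAddCommGroup EG] [NormedSpace ℝ EG] [NormedAddCommGroup EM] [NormedSpace ℝ EM]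
  [NormedAddCommGroup EP] [NormedSpace ℝ EP]
  {Gt : Type*} [Group Gt] [TopologicalSpace Gt] [ChartedSpace EGt Gt]
  {G : Type*} [Group G] [TopologicalSpace G] [ChartedSpace EG G] [LieGroup 𝓘(ℝ, EG) ∞ G]
  {M : Type*} [TopologicalSpace M] [ChartedSpace EM M]
  {P : Type*} [TopologicalSpace P] [ChartedSpace EP P] [MulAction Gᵐᵒᵖ P]
  {Q : Type*} [TopologicalSpace Q] [MulAction Gtᵐᵒᵖ Q]
  {π : P → M} {ρ : Gt →* G} {v : Q → P}

variable (EM EP) in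
/-- A spinor structure without a given smooth structure on its total space. -/
structure IsTopSpinor (π : P → M) (ρ : Gt →* G) (v : Q → P) : Prop where
  isLocalHomeomorph : IsLocalHomeomorph v
  continuous_act : Continuous fun x : Q × Gt => op x.2 • x.1
  act : ∀ (q : Q) (g : Gt), v (op g • q) = op (ρ g) • v q
  free : ∀ (q : Q) (g : Gt), op g • q = q → g = 1
  transitive : ∀ q q' : Q, π (v q) = π (v q') → ∃ g : Gt, op g • q = q'
  local_section : ∀ m₀ : M, ∃ (U : Set M) (τ : M → Q), IsOpen U ∧ m₀ ∈ U ∧ ContinuousOn τ U ∧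
    ContMDiffOn 𝓘(ℝ, EM) 𝓘(ℝ, EP) ∞ (fun m => v (τ m)) U ∧ ∀ m ∈ U, π (v (τ m)) = m

/-- Smoothness of the action and of the sections can be tested after composition with the local
diffeomorphism `v`. The fibre coordinate has values in `Gt`, and is obtained from that of `P` by a
local inverse of `ρ`. -/
theorem IsTopSpinor.isPrincipalBundle [ChartedSpace EP Q] (h : IsTopSpinor EM EP π ρ v)
    (hv : IsLocalDiffeomorph 𝓘(ℝ, EP) 𝓘(ℝ, EP) ∞ v) (hP : IsPrincipalBundle EG EM EP G π)
    (hρ : IsLocalDiffeomorph 𝓘(ℝ, EGt) 𝓘(ℝ, EG) ∞ ρ) :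
    IsPrincipalBundle EGt EM EP Gt (fun q => π (v q)) := by
  have hπv := hP.contMDiff_proj.comp hv.contMDiff
  have hcv : Continuous v := hv.contMDiff.continuous
  have hact : ContMDiff (𝓘(ℝ, EP).prod 𝓘(ℝ, EGt)) 𝓘(ℝ, EP) ∞ fun x : Q × Gt => op x.2 • x.1 := by
    refine hv.contMDiff_of_comp h.continuous_act ?_
    simp only [h.act]
    exact hP.contMDiff_act.comp ((hv.contMDiff.comp contMDiff_fst).prodMk
      (hρ.contMDiff.comp contMDiff_snd))
  have hπa : ∀ (q : Q) (g : Gt), π (v (op g • q)) = π (v q) := fun q g => by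
    rw [h.act, hP.proj_act]
  have hinj : ∀ (q : Q) (g g' : Gt), op g • q = op g' • q → g = g' := fun q g g' e => by
    rw [← mul_inv_eq_one]
    refine h.free q _ ?_
    rw [op_mul, mul_smul, e, op_inv, inv_smul_smul]
  refine isPrincipalBundle_of_isLocalTriv (fun m => ?_) hπv hact hπa h.transitive h.free
    fun m₀ => ?_
  · obtain ⟨U, τ, -, hm, -, -, hτ⟩ := h.local_section m
    exact ⟨τ m, hτ m hm⟩
  obtain ⟨U, τ, hU, hm, hτc, hτs, hτ⟩ := h.local_section m₀
  have hd : ∀ q : Q, ∃ g : Gt, π (v q) ∈ U → op g • τ (π (v q)) = q := fun q => by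
    by_cases hq : π (v q) ∈ U
    · obtain ⟨g, hg⟩ := h.transitive (τ (π (v q))) q (hτ _ hq)
      exact ⟨g, fun _ => hg⟩
    · exact ⟨1, fun h => absurd h hq⟩
  choose ψ hψ using hd
  refine ⟨U, τ, ψ, hm, hU, fun m hm => ?_, fun q₀ hq₀ => ContMDiffAt.contMDiffWithinAt ?_, hτ, hψ⟩
  · exact (hv.contMDiffAt_of_comp (hτc.continuousAt (hU.mem_nhds hm))
      (hτs.contMDiffAt (hU.mem_nhds hm))).contMDiffWithinAt
  obtain ⟨U', τ', ψ', hm', hU'⟩ := hP.exists_isLocalTriv (π (v q₀))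
  obtain ⟨Ψ, hΨ, hρΨ⟩ := hρ (ψ q₀)
  have hq₀' : π (v q₀) ∈ U := hq₀
  have hV : IsOpen (π ⁻¹' U') := hU'.isOpen.preimage hP.contMDiff_proj.continuous
  have hψ' : ∀ p, π p ∈ U' → ContMDiffAt 𝓘(ℝ, EP) 𝓘(ℝ, EG) ∞ ψ' p := fun p hp =>
    hU'.coord_smooth.contMDiffAt (hV.mem_nhds hp)
  have hvτ : ContMDiffAt 𝓘(ℝ, EP) 𝓘(ℝ, EP) ∞ (fun q => v (τ (π (v q)))) q₀ :=
    ContMDiffAt.comp q₀ (g := fun m => v (τ m)) (hτs.contMDiffAt (hU.mem_nhds hq₀')) (hπv q₀)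
  -- `D q` is the fibre coordinate of `v q` relative to the section `v ∘ τ`; its lift near `ψ q₀`
  -- should be `ψ q`.
  let D : Q → G := fun q => (ψ' (v (τ (π (v q)))))⁻¹ * ψ' (v q)
  have hD : ContMDiffAt 𝓘(ℝ, EP) 𝓘(ℝ, EG) ∞ D q₀ :=
    ((hψ' _ (by rw [hτ _ hq₀']; exact hm')).comp q₀ hvτ).inv.mul
      ((hψ' _ hm').comp q₀ hv.contMDiff.contMDiffAt)
  have hDv : ∀ q, π (v q) ∈ U → π (v q) ∈ U' → op (D q) • v (τ (π (v q))) = v q := by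
    intro q h1 h2
    have h3 := hU'.coord_act (v (τ (π (v q)))) (by rwa [hτ _ h1])
    rw [hτ _ h1] at h3
    have h4 : op (D q) • op (ψ' (v (τ (π (v q))))) • τ' (π (v q)) = v q := by
      rw [smul_smul, ← op_mul, mul_inv_cancel_left, hU'.coord_act (v q) h2]
    rwa [h3] at h4
  have hD0 : D q₀ = ρ (ψ q₀) := by
    refine hP.act_injective (v (τ (π (v q₀)))) ?_
    rw [hDv q₀ hq₀' hm', ← h.act, hψ q₀ hq₀']
  have ht : D q₀ ∈ Ψ.target := by rw [hD0, hρΨ hΨ]; exact Ψ.map_source hΨ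
  have hg : ContMDiffAt 𝓘(ℝ, EP) 𝓘(ℝ, EGt) ∞ (fun q => Ψ.invFun (D q)) q₀ :=
    (Ψ.contMDiffOn_invFun.contMDiffAt (Ψ.open_target.mem_nhds ht)).comp q₀ hD
  refine hg.congr_of_eventuallyEq ?_
  have hg0 : Ψ.invFun (D q₀) = ψ q₀ := by
    rw [hD0, hρΨ hΨ]; exact Ψ.left_inv hΨ
  have hτc' : ContinuousAt (fun q => τ (π (v q))) q₀ :=
    ContinuousAt.comp (g := τ) (f := fun q => π (v q)) (hτc.continuousAt (hU.mem_nhds hq₀'))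
      hπv.continuous.continuousAt
  have hc : ContinuousAt (fun q => op (Ψ.invFun (D q)) • τ (π (v q))) q₀ :=
    h.continuous_act.continuousAt.comp (hτc'.prodMk hg.continuousAt)
  obtain ⟨e, he, hve⟩ := h.isLocalHomeomorph q₀
  have he' := e.open_source.mem_nhds he
  have hc0 : op (Ψ.invFun (D q₀)) • τ (π (v q₀)) = q₀ := by rw [hg0, hψ q₀ hq₀']
  -- Near `q₀` the point with lifted coordinate and `q` have the same image under `v` and lie in a
  -- set where `v` is injective, so they coincide.
  filter_upwards [he', hc.preimage_mem_nhds (by rw [hc0]; exact he'),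
    hD.continuousAt.preimage_mem_nhds (Ψ.open_target.mem_nhds ht),
    hπv.continuous.continuousAt.preimage_mem_nhds (hU.mem_nhds hq₀'),
    hπv.continuous.continuousAt.preimage_mem_nhds (hU'.isOpen.mem_nhds hm')] with q h1 h2 h3 h4 h5
  have h6 : ρ (Ψ.invFun (D q)) = D q := (hρΨ (Ψ.map_target h3)).trans (Ψ.right_inv h3)
  have h7 : op (Ψ.invFun (D q)) • τ (π (v q)) = q := by
    refine e.injOn h2 h1 ?_
    rw [← hve, h.act, h6]
    exact hDv q h4 h5
  exact hinj (τ (π (v q))) _ _ ((hψ q h4).trans h7.symm)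

/-- A spinor structure without a given smooth structure carries a unique compatible one. -/
theorem IsTopSpinor.exists_spinorStructure {P : Type u} [TopologicalSpace P] [ChartedSpace EP P]
    [IsManifold 𝓘(ℝ, EP) ∞ P] [MulAction Gᵐᵒᵖ P] {π : P → M} [Small.{u} Q] {v : Q → P}
    [T2Space M] [T2Space Gt] [SecondCountableTopology M] [SecondCountableTopology Gt]
    [FiniteDimensional ℝ EP] (h : IsTopSpinor EM EP π ρ v)
    (hP : IsPrincipalBundle EG EM EP G π) (hρ : IsLocalDiffeomorph 𝓘(ℝ, EGt) 𝓘(ℝ, EG) ∞ ρ) :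
    ∃ (S : SpinorStructure EGt EM EP π ρ) (e : Q ≃ₜ S.Q), (∀ q, S.spinorMap (e q) = v q) ∧
      ∀ (q : Q) (g : Gt), e (op g • q) = op g • e q := by
  -- The total space has to lie in the universe of `P`.
  let e : Q ≃ₜ Shrink.{u} Q := Shrink.homeomorph Q
  have eact : ∀ (g : Gt) (q : Q), e (op g • q) = op g • e q := fun g q => equivShrink_smul _ _
  have eact' : ∀ (g : Gt) (q : Shrink.{u} Q), e.symm (op g • q) = op g • e.symm q := fun g q => by
    rw [e.symm_apply_eq, eact, e.apply_symm_apply]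
  have h' : IsTopSpinor EM EP π ρ (fun q => v (e.symm q)) :=
    { isLocalHomeomorph := h.isLocalHomeomorph.comp e.symm.isLocalHomeomorph
      continuous_act := by
        have : (fun x : Shrink.{u} Q × Gt => op x.2 • x.1) =
            fun x => e (op x.2 • e.symm x.1) := funext fun x => by
          rw [eact, e.apply_symm_apply]
        rw [this]
        exact e.continuous.comp (h.continuous_act.comp
          (f := fun x : Shrink.{u} Q × Gt => (e.symm x.1, x.2)) (by fun_prop))
      act := fun q g => by rw [eact', h.act]
      free := fun q g hq => h.free (e.symm q) g (by rw [← eact', hq])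
      transitive := fun q q' hq => by
        obtain ⟨g, hg⟩ := h.transitive _ _ hq
        exact ⟨g, by rw [← eact', e.symm.injective.eq_iff] at hg; exact hg⟩
      local_section := fun m₀ => by
        obtain ⟨U, τ, hU, hm, hτc, hτs, hτ⟩ := h.local_section m₀
        refine ⟨U, fun m => e (τ m), hU, hm, e.continuous.comp_continuousOn hτc, ?_, ?_⟩
        · simpa only [e.symm_apply_apply] using hτs
        · simpa only [e.symm_apply_apply] using hτ }
  let _ := h'.isLocalHomeomorph.pullbackChartedSpace (E := EP)
  have := h'.isLocalHomeomorph.isManifold_pullback (E := EP)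
  have hv := h'.isLocalHomeomorph.isLocalDiffeomorph_pullback (E := EP)
  have hQ := h'.isPrincipalBundle hv hP hρ
  have := hQ.t2Space
  have := hQ.paracompactSpace
  exact ⟨{ Q := Shrink.{u} Q
           proj := _
           isPrincipalBundle := hQ
           spinorMap := fun q => v (e.symm q)
           isBundleMorphism := ⟨hv.contMDiff, fun _ => rfl, h'.act⟩ }, e,
    fun q => congrArg v (e.symm_apply_apply q), fun q g => eact g q⟩

end TopologicalSpinorStructures

/-! ### Spinor structures induced by pullback and by extension. -/

section InducedSpinorStructures

theorem isOpenMap_of_local_sections {X Y : Type*} [TopologicalSpace X] [TopologicalSpace Y]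
    {f : X → Y} (h : ∀ x, ∃ s : Y → X, ContinuousAt s (f x) ∧ s (f x) = x ∧
      ∀ᶠ y in 𝓝 (f x), f (s y) = y) : IsOpenMap f := by
  refine isOpenMap_iff_nhds_le.2 fun x => ?_
  obtain ⟨s, hs, hx, he⟩ := h x
  calc 𝓝 (f x) = Filter.map (fun y => f (s y)) (𝓝 (f x)) := by
        rw [Filter.map_congr he, Filter.map_id']
    _ = Filter.map f (Filter.map s (𝓝 (f x))) := Filter.map_map.symm
    _ ≤ Filter.map f (𝓝 x) := Filter.map_mono (by rw [ContinuousAt, hx] at hs; exact hs)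

variable {EGt EG EHt EH EM ER EP : Type*} [NormedAddCommGroup EGt] [NormedSpace ℝ EGt]
  [NormedAddCommGroup EG] [NormedSpace ℝ EG] [NormedAddCommGroup EM] [NormedSpace ℝ EM]
  [NormedAddCommGroup EP] [NormedSpace ℝ EP] [NormedAddCommGroup EHt] [NormedSpace ℝ EHt]
  [NormedAddCommGroup EH] [NormedSpace ℝ EH] [NormedAddCommGroup ER] [NormedSpace ℝ ER]
  {Gt : Type*} [Group Gt] [TopologicalSpace Gt] [ChartedSpace EGt Gt] [LieGroup 𝓘(ℝ, EGt) ∞ Gt]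
  {G : Type*} [Group G] [TopologicalSpace G] [ChartedSpace EG G] [LieGroup 𝓘(ℝ, EG) ∞ G]
  {Ht : Type*} [Group Ht] [TopologicalSpace Ht] [ChartedSpace EHt Ht] [LieGroup 𝓘(ℝ, EHt) ∞ Ht]
  {H : Type*} [Group H] [TopologicalSpace H] [ChartedSpace EH H] [LieGroup 𝓘(ℝ, EH) ∞ H]
  {M : Type*} [TopologicalSpace M] [ChartedSpace EM M]
  {ρ : Gt →* G} {ρH : Ht →* H} {ι : H →* G} {ιt : Ht →* Gt}

/-- The total space of the pullback of a spinor structure. -/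
abbrev SpinorPullback {P R Q : Type*} (κ : R → P) (u : Q → P) : Type _ :=
  {x : R × Q // κ x.1 = u x.2}

/-- The action of `Ht` on the pullback of a spinor structure. -/
@[reducible]
def pullbackMulAction {P R Q : Type*} [MulAction Gᵐᵒᵖ P] [MulAction Hᵐᵒᵖ R] [MulAction Gtᵐᵒᵖ Q]
    {κ : R → P} {u : Q → P} (hκ : ∀ (r : R) (h : H), κ (op h • r) = op (ι h) • κ r)
    (hu : ∀ (q : Q) (g : Gt), u (op g • q) = op (ρ g) • u q) (hρι : ∀ h, ρ (ιt h) = ι (ρH h)) :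
    MulAction Htᵐᵒᵖ (SpinorPullback κ u) where
  smul h x := ⟨(op (ρH h.unop) • x.1.1, op (ιt h.unop) • x.1.2), by
    dsimp only; rw [hκ, hu, x.2, hρι]⟩
  one_smul x := Subtype.ext (Prod.ext (by change op (ρH 1) • _ = _; simp)
    (by change op (ιt 1) • _ = _; simp))
  mul_smul a b x := Subtype.ext (Prod.ext
    (by change op (ρH (b.unop * a.unop)) • _ = op _ • op _ • _; rw [map_mul, op_mul, mul_smul])
    (by change op (ιt (b.unop * a.unop)) • _ = op _ • op _ • _; rw [map_mul, op_mul, mul_smul]))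

/-- The spinor structure is the fibre product of `R` and `Q` over `P`, with the first projection as
spinor map and the second as reduction map. The action is free because `ιt` is injective. -/
theorem SpinorStructure.exists_pullback {P : Type*} [TopologicalSpace P] [ChartedSpace EP P]
    [MulAction Gᵐᵒᵖ P] {π : P → M}
    {R : Type u} [TopologicalSpace R] [ChartedSpace ER R] [IsManifold 𝓘(ℝ, ER) ∞ R]
    [MulAction Hᵐᵒᵖ R] {πR : R → M} {κ : R → P} {Q : Type u} [TopologicalSpace Q]
    [ChartedSpace EP Q] [MulAction Gtᵐᵒᵖ Q] {πQ : Q → M} {u : Q → P}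
    [T2Space M] [T2Space Ht] [SecondCountableTopology M] [SecondCountableTopology Ht]
    [FiniteDimensional ℝ ER]
    (hP : IsPrincipalBundle EG EM EP G π) (hR : IsPrincipalBundle EH EM ER H πR)
    (hQ : IsPrincipalBundle EGt EM EP Gt πQ) (hu : IsBundleMorphism EP EP πQ π ρ u)
    (hρ : IsLocalDiffeomorph 𝓘(ℝ, EGt) 𝓘(ℝ, EG) ∞ ρ) (hρs : Function.Surjective ρ)
    (hρH : IsLocalDiffeomorph 𝓘(ℝ, EHt) 𝓘(ℝ, EH) ∞ ρH) (hρHs : Function.Surjective ρH)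
    (hκ : IsBundleMorphism ER EP πR π ι κ) (hιt : Continuous ιt)
    (hinj : Function.Injective ιt) (hρι : ∀ h, ρ (ιt h) = ι (ρH h))
    (hker : ∀ k, ρ k = 1 → ∃ h, ρH h = 1 ∧ ιt h = k) :
    ∃ (S : SpinorStructure EHt EM ER πR ρH) (κt : S.Q → Q),
      IsBundleMorphism ER EP S.proj πQ ιt κt ∧ ∀ s, u (κt s) = κ (S.spinorMap s) := by
  let _ := pullbackMulAction hκ.act hu.act hρι
  have hul := hu.isLocalDiffeomorph hP hQ hρ
  have hu' := hul.isLocalHomeomorph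
  have hcκ := hκ.contMDiff.continuous
  have hv1 : ∀ (h : Ht) (x : SpinorPullback κ u), (op h • x).1.1 = op (ρH h) • x.1.1 := fun h x => rfl
  have hv2 : ∀ (h : Ht) (x : SpinorPullback κ u), (op h • x).1.2 = op (ιt h) • x.1.2 := fun h x => rfl
  have hX : IsTopSpinor EM ER πR ρH (fun x : SpinorPullback κ u => x.1.1) :=
    { isLocalHomeomorph := by
        refine isLocalHomeomorph_of_injOn (by fun_prop) ?_ ?_
        -- Since `u` is open, for `r` close to the first component of `x` the point `κ r` still has
        -- a preimage in `Q` close to the second.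
        · refine isOpenMap_iff_nhds_le.2 fun x W hW => ?_
          obtain ⟨T, hT, hTW⟩ := mem_nhds_subtype _ _ _ |>.1 hW
          obtain ⟨A, hA, B, hB, hAB⟩ := mem_nhds_prod_iff.1 hT
          have h1 : u '' B ∈ 𝓝 (κ x.1.1) := by
            rw [x.2]; exact hu'.isOpenMap.image_mem_nhds hB
          filter_upwards [hA, hcκ.continuousAt.preimage_mem_nhds h1] with r hr hr'
          obtain ⟨q, hq, e⟩ := hr'
          exact @hTW ⟨(r, q), e.symm⟩ (hAB ⟨hr, hq⟩)
        · intro x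
          obtain ⟨e, he, hue⟩ := hu' x.1.2
          refine ⟨{y : SpinorPullback κ u | y.1.2 ∈ e.source}, (e.open_source.preimage (by fun_prop)).mem_nhds he,
            fun y hy z hz hyz => Subtype.ext (Prod.ext hyz (e.injOn hy hz ?_))⟩
          rw [← hue, ← y.2, ← z.2]
          exact congrArg κ hyz
      continuous_act := by
        refine Continuous.subtype_mk (f := fun x : SpinorPullback κ u × Ht =>
          ((op (ρH x.2) • x.1.1.1 : R), (op (ιt x.2) • x.1.1.2 : Q))) (Continuous.prodMk ?_ ?_) _
        · exact hR.contMDiff_act.continuous.comp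
            (f := fun x : SpinorPullback κ u × Ht => (x.1.1.1, ρH x.2))
            ((by fun_prop : Continuous fun x : SpinorPullback κ u × Ht => x.1.1.1).prodMk
              (hρH.contMDiff.continuous.comp continuous_snd))
        · exact hQ.contMDiff_act.continuous.comp
            (f := fun x : SpinorPullback κ u × Ht => (x.1.1.2, ιt x.2)) (by fun_prop)
      act := fun x h => rfl
      free := fun x h hx => by
        have h1 : op (ιt h) • x.1.2 = x.1.2 := by rw [← hv2, hx]
        exact hinj ((hQ.free _ _ h1).trans (map_one ιt).symm)
      transitive := fun x y hxy => by
        obtain ⟨h, hh⟩ := hR.transitive _ _ hxy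
        obtain ⟨ht, rfl⟩ := hρHs h
        -- Once the components in `R` agree, those in `Q` have the same image in `P`; what remains
        -- is an element of `ker ρ`, which `hker` lifts to `ker ρH`.
        obtain ⟨k, hk, hkq⟩ := hu.exists_ker hP hQ (q := op (ιt ht) • x.1.2) (q' := y.1.2) (by
          rw [hu.act, hρι, ← x.2, ← hκ.act, ← y.2, ← hh])
        obtain ⟨k', hk', rfl⟩ := hker k hk
        refine ⟨ht * k', Subtype.ext (Prod.ext ?_ ?_)⟩
        · rw [hv1, map_mul, hk', mul_one, hh]
        · rw [hv2, map_mul, op_mul, mul_smul, hkq]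
      local_section := fun m₀ => by
        obtain ⟨U, σ, ψ, hm, hU⟩ := hR.exists_isLocalTriv m₀
        obtain ⟨q₀, hq₀⟩ := hu.surjective hP hQ hρs (κ (σ m₀))
        obtain ⟨e, he, hue⟩ := hu' q₀
        have hκσ : ContinuousOn (fun m => κ (σ m)) U :=
          hcκ.comp_continuousOn hU.section_smooth.continuousOn
        have hue' : ∀ p ∈ e.target, u (e.symm p) = p := fun p hp => by
          rw [hue]; exact e.right_inv hp
        let V := U ∩ (fun m => κ (σ m)) ⁻¹' e.target
        have hV : IsOpen V := hκσ.isOpen_inter_preimage hU.isOpen e.open_target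
        classical
        let x₀ : SpinorPullback κ u := ⟨(σ m₀, q₀), hq₀.symm⟩
        -- The second component is a local inverse of `u` applied to `κ ∘ σ`; the value `x₀` is a
        -- filler where this is undefined.
        let s : M → SpinorPullback κ u := fun m => if h : κ (σ m) ∈ e.target then
          ⟨(σ m, e.symm (κ (σ m))), (hue' _ h).symm⟩ else x₀
        have hs : ∀ m ∈ V, (s m).1 = (σ m, e.symm (κ (σ m))) := fun m hm => by
          have h1 : κ (σ m) ∈ e.target := hm.2
          simp only [s]; rw [dif_pos h1]
        refine ⟨V, s, hV, ⟨hm, ?_⟩, ?_, ?_, fun m hm => ?_⟩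
        · change κ (σ m₀) ∈ e.target
          rw [← hq₀, hue]; exact e.map_source he
        · refine Topology.IsInducing.subtypeVal.continuousOn_iff.2 ?_
          refine ContinuousOn.congr ?_ fun m hm => hs m hm
          refine (hU.section_smooth.continuousOn.mono Set.inter_subset_left).prodMk ?_
          exact e.continuousOn_symm.comp (hκσ.mono Set.inter_subset_left) fun m hm => hm.2
        · exact (hU.section_smooth.mono Set.inter_subset_left).congr fun m hm =>
            congrArg Prod.fst (hs m hm)
        · rw [hs m hm]; exact hU.proj_section m hm.1 }
  obtain ⟨S, e, he, hea⟩ := hX.exists_spinorStructure hR hρH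
  have hek : ∀ s, u (e.symm s).1.2 = κ (S.spinorMap s) := fun s => by
    rw [← (e.symm s).2, ← he, e.apply_symm_apply]
  refine ⟨S, fun s => (e.symm s).1.2, ⟨?_, fun s => ?_, fun s h => ?_⟩, hek⟩
  · refine hul.contMDiff_of_comp (by fun_prop) ?_
    simp only [hek]
    exact hκ.contMDiff.comp S.isBundleMorphism.contMDiff
  · rw [← hu.proj, hek, hκ.proj, S.isBundleMorphism.proj]
  · have : e.symm (op h • s) = op h • e.symm s := by
      rw [e.symm_apply_eq, hea, e.apply_symm_apply]
    rw [this, hv2]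

/-- The total space of the bundle associated with a bundle with group `Ht` and a homomorphism
`Ht → Gt` is the quotient by this relation. -/
@[reducible]
def extensionSetoid (S : Type*) [MulAction Htᵐᵒᵖ S] (ιt : Ht →* Gt) : Setoid (S × Gt) where
  r x y := ∃ h : Ht, op h • x.1 = y.1 ∧ ιt h * y.2 = x.2
  iseqv :=
    { refl := fun x => ⟨1, by simp, by simp⟩
      symm := fun ⟨h, h1, h2⟩ => ⟨h⁻¹, by rw [← h1, op_inv, inv_smul_smul],
        by rw [← h2, map_inv, inv_mul_cancel_left]⟩
      trans := fun ⟨h, h1, h2⟩ ⟨k, k1, k2⟩ => ⟨h * k, by rw [op_mul, mul_smul, h1, k1],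
        by rw [map_mul, mul_assoc, k2, h2]⟩ }

/-- The action of `Gt` on the associated bundle. -/
@[reducible]
def extensionMulAction (S : Type*) [MulAction Htᵐᵒᵖ S] (ιt : Ht →* Gt) :
    MulAction Gtᵐᵒᵖ (Quotient (extensionSetoid S ιt)) where
  smul g := Quotient.map (fun x => (x.1, x.2 * g.unop)) fun x y ⟨h, h1, h2⟩ =>
    ⟨h, h1, by rw [← h2, mul_assoc]⟩
  one_smul x := by
    induction x using Quotient.inductionOn with
    | h x => exact congrArg (Quotient.mk _) (Prod.ext (x := (x.1, x.2 * 1)) rfl (mul_one x.2))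
  mul_smul a b x := by
    induction x using Quotient.inductionOn with
    | h x =>
      exact congrArg (Quotient.mk _)
        (Prod.ext (x := (x.1, x.2 * (b.unop * a.unop))) rfl (mul_assoc x.2 _ _).symm)

/-- The saturation of an open set is the union of its translates under `Ht`. -/
theorem isOpenQuotientMap_extension [IsTopologicalGroup Gt] {S : Type*} [TopologicalSpace S] [MulAction Htᵐᵒᵖ S]
    (hS : ∀ h : Ht, Continuous fun s : S => op h • s) :
    IsOpenQuotientMap (Quotient.mk (extensionSetoid S ιt)) := by
  refine ⟨Quotient.mk_surjective, continuous_quotient_mk', fun U hU => ?_⟩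
  refine isQuotientMap_quotient_mk'.isOpen_preimage.1 ?_
  change IsOpen (Quotient.mk (extensionSetoid S ιt) ⁻¹' _)
  have : Quotient.mk (extensionSetoid S ιt) ⁻¹' (Quotient.mk (extensionSetoid S ιt) '' U) =
      ⋃ h : Ht, (fun x : S × Gt => (op h • x.1, (ιt h)⁻¹ * x.2)) ⁻¹' U := by
    ext x
    simp only [Set.mem_preimage, Set.mem_image, Set.mem_iUnion]
    constructor
    · rintro ⟨y, hy, e⟩
      obtain ⟨h, h1, h2⟩ := Quotient.exact e.symm
      refine ⟨h, ?_⟩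
      rw [h1, ← h2, inv_mul_cancel_left]
      exact hy
    · rintro ⟨h, hx⟩
      exact ⟨_, hx, (Quotient.sound (s := extensionSetoid S ιt) (a := x)
        ⟨h, rfl, mul_inv_cancel_left _ _⟩).symm⟩
  rw [this]
  exact isOpen_iUnion fun h => hU.preimage
    (((hS h).comp continuous_fst).prodMk (continuous_const.mul continuous_snd))

/-- The spinor structure is the associated bundle `S ×_Ht Gt`, with spinor map `[s, g] ↦ f(s) ρ(g)`;
the reduction map is `s ↦ [s, 1]`. -/
theorem SpinorStructure.exists_extension {P : Type u} [TopologicalSpace P] [ChartedSpace EP P]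
    [IsManifold 𝓘(ℝ, EP) ∞ P] [MulAction Gᵐᵒᵖ P] {π : P → M}
    {S : Type u} [TopologicalSpace S] [ChartedSpace ER S]
    [MulAction Htᵐᵒᵖ S] {πS : S → M} {f : S → P} [Small.{u} Gt]
    [T2Space M] [T2Space Gt] [SecondCountableTopology M] [SecondCountableTopology Gt]
    [FiniteDimensional ℝ EP]
    (hP : IsPrincipalBundle EG EM EP G π) (hS : IsPrincipalBundle EHt EM ER Ht πS)
    (hρ : IsLocalDiffeomorph 𝓘(ℝ, EGt) 𝓘(ℝ, EG) ∞ ρ) (hιt : Continuous ιt)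
    (hf : IsBundleMorphism ER EP πS π (ρ.comp ιt) f) :
    ∃ (Q : SpinorStructure EGt EM EP π ρ) (κt : S → Q.Q),
      IsBundleMorphism ER EP πS Q.proj ιt κt ∧ ∀ s, Q.spinorMap (κt s) = f s := by
  have := topologicalGroup_of_lieGroup 𝓘(ℝ, EGt) ∞ (G := Gt)
  let _ := extensionMulAction S ιt
  let X := Quotient (extensionSetoid S ιt)
  let mk : S × Gt → X := Quotient.mk (extensionSetoid S ιt)
  have hmk : IsOpenQuotientMap mk := isOpenQuotientMap_extension fun h =>
    hS.contMDiff_act.continuous.comp (g := fun x : S × Ht => op x.2 • x.1)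
      (f := fun s => (s, h)) (by fun_prop)
  have hsound : ∀ s g h, mk (op h • s, g) = mk (s, ιt h * g) := fun s g h =>
    (Quotient.sound ⟨h, rfl, rfl⟩ : mk (s, ιt h * g) = mk (op h • s, g)).symm
  have hact : ∀ s g g', op g' • mk (s, g) = mk (s, g * g') := fun s g g' => rfl
  have hfc := hf.contMDiff.continuous
  have hfa : ∀ s h, f (op h • s) = op (ρ (ιt h)) • f s := hf.act
  let v : X → P := Quotient.lift (fun x : S × Gt => op (ρ x.2) • f x.1) fun x y ⟨h, h1, h2⟩ => by
    rw [← h1, ← h2, hfa, smul_smul, ← op_mul, map_mul]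
  have hv : ∀ s g, v (mk (s, g)) = op (ρ g) • f s := fun s g => rfl
  have hπv : ∀ s g, π (v (mk (s, g))) = πS s := fun s g => by rw [hv, hP.proj_act, hf.proj]
  have hvc : Continuous v := hmk.isQuotientMap.continuous_iff.2
    (hP.contMDiff_act.continuous.comp (f := fun x : S × Gt => (f x.1, ρ x.2))
      ((hfc.comp continuous_fst).prodMk (hρ.contMDiff.continuous.comp continuous_snd)))
  obtain ⟨d, hd, hdc⟩ := hP.isTopPrincipal.exists_div
  have hX : IsTopSpinor EM EP π ρ v :=
    { isLocalHomeomorph := by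
        -- Moving the first component to the section `τ` changes the second into a fibre coordinate.
        have hx : ∀ x : X, ∃ (U : Set M) (τ : M → S) (ψ : S → Ht) (g : Gt), π (v x) ∈ U ∧
            IsLocalTriv EHt EM ER Ht πS U τ ψ ∧ x = mk (τ (π (v x)), g) := by
          intro x
          obtain ⟨⟨s, g⟩, rfl⟩ := hmk.surjective x
          obtain ⟨U, τ, ψ, hm, hU⟩ := hS.exists_isLocalTriv (πS s)
          refine ⟨U, τ, ψ, ιt (ψ s) * g, by rwa [hπv], hU, ?_⟩
          rw [hπv, ← hsound, hU.coord_act s hm]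
        refine isLocalHomeomorph_of_injOn hvc (isOpenMap_of_local_sections fun x => ?_)
          fun x => ?_
        · obtain ⟨U, τ, ψ, g, hm, hU, e⟩ := hx x
          obtain ⟨Ψ, hΨ, hρΨ⟩ := hρ g
          have hm' := (hU.isOpen.preimage hP.contMDiff_proj.continuous).mem_nhds hm
          have hτ : ContinuousOn (fun p => τ (π p)) (π ⁻¹' U) :=
            hU.section_smooth.continuousOn.comp hP.contMDiff_proj.continuous.continuousOn
              fun p hp => hp
          have hfib : ∀ p, π p ∈ U → π (f (τ (π p))) = π p := fun p hp => by
            rw [hf.proj, hU.proj_section _ hp]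
          have hD : ContinuousAt (fun p => d (f (τ (π p)), p)) (v x) :=
            (hdc.comp (f := fun p => (f (τ (π p)), p)) (t := {x | π x.1 = π x.2}) ((hfc.comp_continuousOn hτ).prodMk continuousOn_id)
              hfib).continuousAt hm'
          have hD0 : d (f (τ (π (v x))), v x) = ρ g := by
            refine hP.act_injective (f (τ (π (v x)))) ?_
            rw [hd _ _ (hfib _ hm), ← hv, ← e]
          have ht : d (f (τ (π (v x))), v x) ∈ Ψ.target := by
            rw [hD0, hρΨ hΨ]; exact Ψ.map_source hΨ
          -- The local section of `v`: the coordinate of `p` relative to `f ∘ τ`, lifted to `Gt` by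
          -- a local inverse of `ρ`.
          refine ⟨fun p => mk (τ (π p), Ψ.invFun (d (f (τ (π p)), p))), ?_, ?_, ?_⟩
          · refine hmk.continuous.continuousAt.comp ((hτ.continuousAt hm').prodMk ?_)
            exact ContinuousAt.comp (g := Ψ.invFun) (f := fun p => d (f (τ (π p)), p))
              (Ψ.contMDiffOn_invFun.continuousOn.continuousAt (Ψ.open_target.mem_nhds ht)) hD
          · have : Ψ.invFun (d (f (τ (π (v x))), v x)) = g := by
              rw [hD0, hρΨ hΨ]; exact Ψ.left_inv hΨ
            dsimp only
            rw [this, ← e]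
          · filter_upwards [hm', hD.preimage_mem_nhds (Ψ.open_target.mem_nhds ht)] with p hp hp'
            have h1 : ρ (Ψ.invFun (d (f (τ (π p)), p))) = d (f (τ (π p)), p) :=
              (hρΨ (Ψ.map_target hp')).trans (Ψ.right_inv hp')
            rw [hv, h1, hd _ _ (hfib _ hp)]
        · obtain ⟨U, τ, ψ, g, hm, hU, e⟩ := hx x
          obtain ⟨Ψ, hΨ, hρΨ⟩ := hρ g
          have hVo : IsOpen (πS ⁻¹' U) := hU.isOpen.preimage hS.contMDiff_proj.continuous
          have hχ : ContinuousOn (fun x : S × Gt => ιt (ψ x.1) * x.2) ((πS ⁻¹' U) ×ˢ Set.univ) :=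
            ((hιt.comp_continuousOn hU.coord_smooth.continuousOn).comp continuousOn_fst
              fun x hx => hx.1).mul continuousOn_snd
          have hW := hχ.isOpen_inter_preimage (hVo.prod isOpen_univ) Ψ.open_source
          have hτm : πS (τ (π (v x))) = π (v x) := hU.proj_section _ hm
          -- The neighbourhood consists of the classes whose fibre coordinate lies in `Ψ.source`,
          -- where `ρ` is injective.
          refine ⟨_, (hmk.isOpenMap _ hW).mem_nhds ⟨_, ⟨⟨?_, trivial⟩, ?_⟩, e.symm⟩, ?_⟩
          · change πS (τ (π (v x))) ∈ U
            rwa [hτm]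
          · change ιt (ψ (τ (π (v x)))) * g ∈ Ψ.source
            rwa [hU.coord_section hS hm, map_one, one_mul]
          · rintro _ ⟨⟨s, a⟩, ⟨⟨hs, -⟩, ha⟩, rfl⟩ _ ⟨⟨s', a'⟩, ⟨⟨hs', -⟩, ha'⟩, rfl⟩ hss
            have e1 : ∀ s a, πS s ∈ U → mk (s, a) = mk (τ (πS s), ιt (ψ s) * a) := fun s a hs => by
              rw [← hsound, hU.coord_act s hs]
            have e2 : πS s = πS s' := by rw [← hπv s a, ← hπv s' a', hss]
            rw [e1 s a hs, e1 s' a' hs', e2, hv, hv] at hss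
            have e3 : ρ (ιt (ψ s) * a) = ρ (ιt (ψ s') * a') := hP.act_injective _ hss
            have e4 : ιt (ψ s) * a = ιt (ψ s') * a' := by
              rw [hρΨ ha, hρΨ ha'] at e3
              exact Ψ.toPartialEquiv.injOn ha ha' e3
            rw [e1 s a hs, e1 s' a' hs', e2, e4]
      continuous_act := by
        refine (hmk.prodMap (IsOpenQuotientMap.id (X := Gt))).isQuotientMap.continuous_iff.2 ?_
        exact hmk.continuous.comp (f := fun x : (S × Gt) × Gt => (x.1.1, x.1.2 * x.2)) (by fun_prop)
      act := fun x g => by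
        obtain ⟨⟨s, a⟩, rfl⟩ := hmk.surjective x
        rw [hact, hv, hv, smul_smul, ← op_mul, map_mul]
      free := fun x g hx => by
        obtain ⟨⟨s, a⟩, rfl⟩ := hmk.surjective x
        obtain ⟨h, h1, h2⟩ := Quotient.exact hx
        have h3 : h = 1 := hS.free s h h1
        subst h3
        have h4 : a = a * g := by simpa using h2
        exact left_eq_mul.1 h4
      transitive := fun x y hxy => by
        obtain ⟨⟨s, a⟩, rfl⟩ := hmk.surjective x
        obtain ⟨⟨s', a'⟩, rfl⟩ := hmk.surjective y
        rw [hπv, hπv] at hxy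
        obtain ⟨h, rfl⟩ := hS.transitive s s' hxy
        exact ⟨a⁻¹ * (ιt h * a'), by rw [hact, hsound, mul_inv_cancel_left]⟩
      local_section := fun m₀ => by
        obtain ⟨U, τ, ψ, hm, hU⟩ := hS.exists_isLocalTriv m₀
        have e1 : ∀ m, v (mk (τ m, 1)) = f (τ m) := fun m => by
          rw [hv, map_one, op_one, one_smul]
        refine ⟨U, fun m => mk (τ m, 1), hU.isOpen, hm, ?_, ?_, fun m hm => ?_⟩
        · exact hmk.continuous.comp_continuousOn
            (hU.section_smooth.continuousOn.prodMk continuousOn_const)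
        · simp only [e1]
          exact hf.contMDiff.comp_contMDiffOn hU.section_smooth
        · rw [hπv, hU.proj_section m hm] }
  obtain ⟨Q, e, he, hea⟩ := hX.exists_spinorStructure hP hρ
  have hek : ∀ s, Q.spinorMap (e (mk (s, 1))) = f s := fun s => by
    rw [he, hv, map_one, op_one, one_smul]
  refine ⟨Q, fun s => e (mk (s, 1)), ⟨?_, fun s => ?_, fun s h => ?_⟩, hek⟩
  · refine (Q.isBundleMorphism.isLocalDiffeomorph hP Q.isPrincipalBundle hρ).contMDiff_of_comp
      (e.continuous.comp (hmk.continuous.comp (by fun_prop))) ?_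
    simp only [hek]
    exact hf.contMDiff
  · rw [← Q.isBundleMorphism.proj, hek, hf.proj]
  · rw [hsound, mul_one, ← hea, hact, one_mul]

/-- A point is determined by the set of basic open sets containing it, that is, by a subset of `ℕ`.
This brings `Gt`, given in any universe, into that of `P`. -/
theorem small_of_secondCountable (X : Type*) [TopologicalSpace X] [T1Space X]
    [SecondCountableTopology X] : Small.{u} X := by
  let b := TopologicalSpace.countableBasis X
  have hb := TopologicalSpace.isBasis_countableBasis X
  have : Countable b := TopologicalSpace.countable_countableBasis X
  obtain ⟨n, hn⟩ := exists_injective_nat b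
  refine small_of_injective (β := ULift.{u} (Set ℕ))
    (f := fun x => ⟨{k | ∃ U : b, n U = k ∧ x ∈ U.1}⟩) fun x y hxy => ?_
  by_contra hne
  obtain ⟨U, hU, hxU, hUy⟩ := hb.mem_nhds_iff.1 (isOpen_compl_singleton.mem_nhds hne)
  have h1 : {k | ∃ U : b, n U = k ∧ x ∈ U.1} = {k | ∃ U : b, n U = k ∧ y ∈ U.1} :=
    congrArg ULift.down hxy
  obtain ⟨V, hV, hyV⟩ := (Set.ext_iff.1 h1 (n ⟨U, hU⟩)).1 ⟨⟨U, hU⟩, rfl, hxU⟩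
  rw [hn hV] at hyV
  exact hUy hyV rfl

end InducedSpinorStructures

/-! ### Comparison of a bundle with its reduction. -/

section Reductions

/-- The comparison of the fundamental groups and of the spinor structures of a principal bundle
and of a reduction of it. -/
theorem IsBundleMorphism.spinorStructures_of_reduction {EM EG EH EGt EHt EP ER : Type*}
      [NormedAddCommGroup EM] [NormedSpace ℝ EM] [FiniteDimensional ℝ EM]
      [NormedAddCommGroup EG] [NormedSpace ℝ EG] [FiniteDimensional ℝ EG]
      [NormedAddCommGroup EH] [NormedSpace ℝ EH] [FiniteDimensional ℝ EH]
      [NormedAddCommGroup EGt] [NormedSpace ℝ EGt] [FiniteDimensional ℝ EGt]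
      [NormedAddCommGroup EHt] [NormedSpace ℝ EHt] [FiniteDimensional ℝ EHt]
      [NormedAddCommGroup EP] [NormedSpace ℝ EP] [FiniteDimensional ℝ EP]
      [NormedAddCommGroup ER] [NormedSpace ℝ ER] [FiniteDimensional ℝ ER]
      {M : Type u} [TopologicalSpace M] [T2Space M] [ParacompactSpace M] [ConnectedSpace M]
      [ChartedSpace EM M] [IsManifold 𝓘(ℝ, EM) ∞ M]
      {G : Type*} [Group G] [TopologicalSpace G] [T2Space G] [ParacompactSpace G]
      [ConnectedSpace G] [ChartedSpace EG G] [LieGroup 𝓘(ℝ, EG) ∞ G]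
      {H : Type*} [Group H] [TopologicalSpace H] [T2Space H] [ParacompactSpace H]
      [ConnectedSpace H] [ChartedSpace EH H] [LieGroup 𝓘(ℝ, EH) ∞ H]
      (ι : H →* G) (hι : ContMDiff 𝓘(ℝ, EH) 𝓘(ℝ, EG) ∞ ι) (hinj : Function.Injective ι)
      (hbij : Function.Bijective (pi1Map ι hι.continuous (map_one ι)))
      {Gt : Type*} [Group Gt] [TopologicalSpace Gt] [T2Space Gt] [ParacompactSpace Gt]
      [ChartedSpace EGt Gt] [LieGroup 𝓘(ℝ, EGt) ∞ Gt]
      (ρG : Gt →* G) (hρG : IsUniversalCover EGt EG ρG)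
      {Ht : Type*} [Group Ht] [TopologicalSpace Ht] [T2Space Ht] [ParacompactSpace Ht]
      [ChartedSpace EHt Ht] [LieGroup 𝓘(ℝ, EHt) ∞ Ht]
      (ρH : Ht →* H) (hρH : IsUniversalCover EHt EH ρH)
      {P : Type u} [TopologicalSpace P] [T2Space P] [ParacompactSpace P]
      [ChartedSpace EP P] [IsManifold 𝓘(ℝ, EP) ∞ P] [MulAction Gᵐᵒᵖ P]
      (πP : P → M) (hP : IsPrincipalBundle EG EM EP G πP)
      {R : Type u} [TopologicalSpace R] [T2Space R] [ParacompactSpace R]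
      [ChartedSpace ER R] [IsManifold 𝓘(ℝ, ER) ∞ R] [MulAction Hᵐᵒᵖ R]
      (πR : R → M) (hR : IsPrincipalBundle EH EM ER H πR)
      (κ : R → P) (hκ : IsBundleMorphism ER EP πR πP ι κ) (r₀ : R) :
      (∃ (hH : π_ 2 M (πR r₀) →* FundamentalGroup H 1)
          (hG : π_ 2 M (πR r₀) →* FundamentalGroup G 1),
        (∀ a b, ConnectingRel πR r₀ a b ↔ hH a = b) ∧
        (∀ a b, ConnectingRel πP (κ r₀) a b ↔ hG a = b) ∧
        (pi1Map ι hι.continuous (map_one ι)).comp hH = hG) ∧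
      (hκ.pi1 rfl).comp (hR.orbitPi1 r₀) =
        (hP.orbitPi1 (κ r₀)).comp (pi1Map ι hι.continuous (map_one ι)) ∧
      (hP.projPi1 (hκ.proj r₀)).comp (hκ.pi1 rfl) = hR.projPi1 rfl ∧
      Function.Bijective (hκ.pi1 (rfl : κ r₀ = κ r₀)) ∧
      (∀ K : Subgroup (FundamentalGroup R r₀),
        IsSplitting (hR.orbitPi1 r₀) (hR.projPi1 rfl) K ↔
          IsSplitting (hP.orbitPi1 (κ r₀)) (hP.projPi1 (hκ.proj r₀)) (K.map (hκ.pi1 rfl))) ∧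
      (Nonempty (SpinorStructure EHt EM ER πR ρH) ↔
        Nonempty (SpinorStructure EGt EM EP πP ρG)) ∧
      ∃ ιt : Ht →* Gt, ContMDiff 𝓘(ℝ, EHt) 𝓘(ℝ, EGt) ∞ ιt ∧ Function.Injective ιt ∧
        (∀ h, ρG (ιt h) = ι (ρH h)) ∧
        ∃ Φ : SpinorStructure.Classes EHt EM ER πR ρH ≃ SpinorStructure.Classes EGt EM EP πP ρG,
          ∀ (S : SpinorStructure EHt EM ER πR ρH) (Q : SpinorStructure EGt EM EP πP ρG),
            (Φ ⟦S⟧ = ⟦Q⟧ ↔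
              ∀ (s₀ : S.Q) (hs : S.spinorMap s₀ = r₀) (q₀ : Q.Q) (hq : Q.spinorMap q₀ = κ r₀),
                (S.isBundleMorphism.pi1 hs).range.map (hκ.pi1 rfl) =
                  (Q.isBundleMorphism.pi1 hq).range) ∧
            (Φ ⟦S⟧ = ⟦Q⟧ → ∃ κt : S.Q → Q.Q, IsBundleMorphism ER EP S.proj Q.proj ιt κt ∧
              ∀ s, Q.spinorMap (κt s) = κ (S.spinorMap s)) := by
  have := secondCountable_of_connected_manifold EM M
  have := hρG.simplyConnected
  have := hρH.simplyConnected
  have := secondCountable_of_connected_manifold EGt Gt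
  have := secondCountable_of_connected_manifold EHt Ht
  have : Small.{u} Gt := small_of_secondCountable Gt
  have := pathConnectedSpace_of_connected_manifold EH H
  have hPt := hP.isTopPrincipal
  have hRt := hR.isTopPrincipal
  have hκc := hκ.contMDiff.continuous
  have hκb : Function.Bijective (hκ.pi1 (rfl : κ r₀ = κ r₀)) :=
    ⟨hPt.pi1Map_injective hRt hι.continuous hκc hκ.proj hκ.act hbij.1 rfl,
      hPt.pi1Map_surjective hRt hι.continuous hκc hκ.proj hκ.act hbij.2 rfl⟩
  have hsq₁ : (hκ.pi1 rfl).comp (hR.orbitPi1 r₀) =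
      (hP.orbitPi1 (κ r₀)).comp (pi1Map ι hι.continuous (map_one ι)) := by
    have hc : Continuous fun h : H => κ (op h • r₀) := hκc.comp (hR.continuous_orbit r₀)
    have h0 : κ (op (1 : H) • r₀) = κ r₀ := by rw [op_one, one_smul]
    exact (pi1Map_comp _ _ _ _ hc (fun _ => rfl) h0).trans
      (pi1Map_comp _ _ _ _ hc (fun h => (hκ.act r₀ h).symm) h0).symm
  have hsq₂ : (hP.projPi1 (hκ.proj r₀)).comp (hκ.pi1 rfl) = hR.projPi1 rfl :=
    pi1Map_comp _ _ _ _ _ hκ.proj _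
  obtain ⟨ιt, hιt, hρι⟩ := exists_lift_universalCover hρG hρH hι
  have hιi := lift_universalCover_injective hρG hρH hι.continuous hinj hbij.1 hιt.continuous hρι
  have h₁ : ∀ S : SpinorStructure EHt EM ER πR ρH, ∃ (Q : SpinorStructure EGt EM EP πP ρG)
      (κt : S.Q → Q.Q), IsBundleMorphism ER EP S.proj Q.proj ιt κt ∧
      ∀ s, Q.spinorMap (κt s) = κ (S.spinorMap s) := fun S =>
    SpinorStructure.exists_extension hP S.isPrincipalBundle hρG.isLocalDiffeomorph hιt.continuous
      (S.isBundleMorphism_comp hκ hρι)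
  have h₂ : ∀ Q : SpinorStructure EGt EM EP πP ρG, ∃ (S : SpinorStructure EHt EM ER πR ρH)
      (κt : S.Q → Q.Q), IsBundleMorphism ER EP S.proj Q.proj ιt κt ∧
      ∀ s, Q.spinorMap (κt s) = κ (S.spinorMap s) := fun Q =>
    SpinorStructure.exists_pullback hP hR Q.isPrincipalBundle Q.isBundleMorphism
      hρG.isLocalDiffeomorph hρG.surjective hρH.isLocalDiffeomorph hρH.surjective hκ
      hιt.continuous hιi hρι fun k hk =>
        lift_universalCover_ker hρG hρH hι.continuous hbij.2 hιt.continuous hρι hk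
  refine ⟨?_, hsq₁, hsq₂, hκb, isSplitting_iff_map hbij.2 hκb hsq₁ hsq₂,
    ⟨fun ⟨S⟩ => ⟨(h₁ S).choose⟩, fun ⟨Q⟩ => ⟨(h₂ Q).choose⟩⟩, ιt, hιt, hιi, hρι,
    SpinorStructure.exists_classes_equiv hP hρG hR hρH hκ hιt.continuous hρι r₀ hκb.1 h₁ h₂⟩
  obtain ⟨hH, hH'⟩ := hRt.exists_connectingHom r₀
  have hG : ∃ hG : π_ 2 M (πR r₀) →* FundamentalGroup G 1,
      ∀ a b, ConnectingRel πP (κ r₀) a b ↔ hG a = b := by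
    -- The base points `πR r₀` and `πP (κ r₀)` are equal only by `hκ.proj`.
    rw [← hκ.proj r₀]
    exact hPt.exists_connectingHom (κ r₀)
  obtain ⟨hG, hG'⟩ := hG
  refine ⟨hH, hG, hH', hG', MonoidHom.ext fun a => ?_⟩
  exact ((hG' _ _).1 (((hH' a _).2 rfl).map hι.continuous hκc hκ.proj hκ.act)).symm

end Reductions

/-! ### The groups `GL⁺(4)` and `SO₀(1,3)` as topological spaces and manifolds. -/

section LinearGroupTopology

theorem isEmbedding_GLplus : Topology.IsEmbedding (fun A : GLplus => ((A : End4ˣ) : End4)) :=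
  Units.isOpenEmbedding_val.isEmbedding.comp Topology.IsEmbedding.subtypeVal

theorem isEmbedding_SO13₀ :
    Topology.IsEmbedding (fun A : SO13₀ => (((A : O13) : End4ˣ) : End4)) :=
  isEmbedding_O13.comp Topology.IsEmbedding.subtypeVal

instance : T2Space GLplus := isEmbedding_GLplus.t2Space

instance : ParacompactSpace GLplus := by
  have := isEmbedding_GLplus.metrizableSpace
  let _ := TopologicalSpace.metrizableSpaceMetric GLplus
  infer_instance

instance : T2Space SO13₀ := isEmbedding_SO13₀.t2Space

instance : ParacompactSpace SO13₀ := by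
  have := isEmbedding_SO13₀.metrizableSpace
  let _ := TopologicalSpace.metrizableSpaceMetric SO13₀
  infer_instance

instance : ConnectedSpace SO13₀ :=
  isConnected_iff_connectedSpace.1 (isConnected_connectedComponent (x := (1 : O13)))

theorem GLplus_contMDiff_iff {E N : Type*} [NormedAddCommGroup E] [NormedSpace ℝ E]
    {H : Type*} [TopologicalSpace H] {I : ModelWithCorners ℝ E H}
    [TopologicalSpace N] [ChartedSpace H N] {f : N → GLplus}
    (hf : ContMDiff I 𝓘(ℝ, End4) ∞ (fun x => ((f x : End4ˣ) : End4))) :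
    ContMDiff I 𝓘(ℝ, End4) ∞ f :=
  (ContMDiff.subtypeVal_comp_iff (⟨GLplus, isOpen_GLplus⟩ : TopologicalSpace.Opens End4ˣ) _).1
    (ContMDiff.of_comp_isOpenEmbedding Units.isOpenEmbedding_val hf)

theorem GLplus_contMDiff_coe :
    ContMDiff 𝓘(ℝ, End4) 𝓘(ℝ, End4) ∞ (fun g : GLplus => ((g : End4ˣ) : End4)) :=
  ContMDiff.comp (g := fun g : End4ˣ => (g : End4)) (f := fun g : GLplus => (g : End4ˣ))
    Units.contMDiff_val (openSubgroup_contMDiff_coe (E := End4) GLplus isOpen_GLplus)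

theorem SO13₀.contMDiff_incl : ContMDiff 𝓘(ℝ, LieO13) 𝓘(ℝ, End4) ∞ SO13₀.incl :=
  GLplus_contMDiff_iff (O13_contMDiff_coe.comp
    (openSubgroup_contMDiff_coe (E := LieO13) SO13₀ isOpen_SO13₀))

theorem SO13₀.incl_injective : Function.Injective SO13₀.incl := fun _ _ h =>
  isEmbedding_SO13₀.injective (congrArg (fun A : GLplus => ((A : End4ˣ) : End4)) h)

open Classical in
/-- The element of `GL⁺(4, ℝ)` given by an endomorphism of positive determinant. -/
noncomputable def GLplus.ofEnd (A : End4) : GLplus :=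
  if h : 0 < A.det then ⟨(A.toContinuousLinearEquivOfDetNeZero h.ne').toUnit, h⟩ else 1

theorem GLplus.coe_ofEnd {A : End4} (h : 0 < A.det) :
    ((GLplus.ofEnd A : End4ˣ) : End4) = A := by
  rw [GLplus.ofEnd, dif_pos h]; rfl

theorem GLplus.continuous_ofEnd {X : Type*} [TopologicalSpace X] {F : X → End4}
    (hF : Continuous F) (h : ∀ x, 0 < (F x).det) : Continuous fun x => GLplus.ofEnd (F x) := by
  refine isEmbedding_GLplus.continuous_iff.2 ?_
  change Continuous fun x => ((GLplus.ofEnd (F x) : End4ˣ) : End4)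
  simpa only [GLplus.coe_ofEnd (h _)] using hF

theorem GLplus.ext {A B : GLplus} (h : ((A : End4ˣ) : End4) = ((B : End4ˣ) : End4)) : A = B :=
  isEmbedding_GLplus.injective h

/-- The standard basis vectors of `ℝ⁴`. -/
noncomputable abbrev stdE (i : Fin 4) : E4 := EuclideanSpace.single i (1 : ℝ)

/-- The endomorphism with given columns. -/
noncomputable def ofCols (f : Fin 4 → E4) : End4 :=
  LinearMap.toContinuousLinearMap ((EuclideanSpace.basisFun (Fin 4) ℝ).toBasis.constr ℝ f)

@[simp]
theorem ofCols_stdE (f : Fin 4 → E4) (i : Fin 4) : ofCols f (stdE i) = f i := by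
  have h := (EuclideanSpace.basisFun (Fin 4) ℝ).toBasis.constr_basis ℝ f i
  rwa [OrthonormalBasis.coe_toBasis, EuclideanSpace.basisFun_apply] at h

theorem End4.ext_stdE {A B : End4} (h : ∀ i, A (stdE i) = B (stdE i)) : A = B := by
  refine ContinuousLinearMap.coe_injective
    ((EuclideanSpace.basisFun (Fin 4) ℝ).toBasis.ext fun i => ?_)
  rw [OrthonormalBasis.coe_toBasis, EuclideanSpace.basisFun_apply]
  exact h i

theorem End4.continuous_iff {X : Type*} [TopologicalSpace X] {F : X → End4} :
    Continuous F ↔ ∀ i, Continuous fun x => F x (stdE i) := by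
  rw [continuous_clm_apply]
  refine ⟨fun h i => h _, fun h y => ?_⟩
  have : ∀ x, F x y = ∑ i, y i • F x (stdE i) := fun x => by
    conv_lhs => rw [← (EuclideanSpace.basisFun (Fin 4) ℝ).sum_repr y]
    simp [map_sum]
  simp only [this]
  fun_prop

/-- The matrix of inner products is `Aᵀ B`. -/
theorem End4.det_mul_det (A B : End4) :
    A.det * B.det = (Matrix.of fun j i => inner ℝ (A (stdE j)) (B (stdE i))).det := by
  let b := (EuclideanSpace.basisFun (Fin 4) ℝ)
  have hA : ∀ C : End4, C.det = (LinearMap.toMatrix b.toBasis b.toBasis (C : E4 →ₗ[ℝ] E4)).det :=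
    fun C => (LinearMap.det_toMatrix _ _).symm
  rw [hA A, hA B, ← Matrix.det_transpose, ← Matrix.det_mul]
  congr 1
  ext j i
  simp [Matrix.mul_apply, LinearMap.toMatrix_apply, b, PiLp.inner_apply, mul_comm]

theorem End4.det_mul (A B : End4) : (A * B).det = A.det * B.det :=
  LinearMap.det_comp _ _

theorem End4.linearIndependent {A : End4} (h : A.det ≠ 0) :
    LinearIndependent ℝ fun i => A (stdE i) := by
  have h1 : LinearMap.ker (A : E4 →ₗ[ℝ] E4) = ⊥ :=
    LinearMap.ker_eq_bot.2 (A.toContinuousLinearEquivOfDetNeZero h).injective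
  have h2 := (EuclideanSpace.basisFun (Fin 4) ℝ).toBasis.linearIndependent.map' _ h1
  have e : (fun i => A (stdE i)) =
      (A : E4 →ₗ[ℝ] E4) ∘ (EuclideanSpace.basisFun (Fin 4) ℝ).toBasis := funext fun i => by
    rw [Function.comp_apply, OrthonormalBasis.coe_toBasis, EuclideanSpace.basisFun_apply]
    rfl
  rwa [e]

end LinearGroupTopology

/-! ### The Gram–Schmidt deformation of `GL⁺(4)`. -/

section GramSchmidt

open InnerProductSpace

theorem continuous_gramSchmidt {X ι E : Type*} [TopologicalSpace X] [NormedAddCommGroup E]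
    [InnerProductSpace ℝ E] [LinearOrder ι] [LocallyFiniteOrderBot ι] [WellFoundedLT ι]
    {f : X → ι → E} (hf : ∀ i, Continuous fun x => f x i)
    (hl : ∀ x, LinearIndependent ℝ (f x)) (n : ι) :
    Continuous fun x => gramSchmidt ℝ (f x) n := by
  induction n using WellFoundedLT.induction with
  | ind n ih =>
    simp_rw [gramSchmidt_def ℝ _ n, Submodule.starProjection_singleton]
    refine (hf n).sub (continuous_finsetSum _ fun i hi => ?_)
    have h1 := ih i (Finset.mem_Iio.1 hi)
    refine Continuous.smul (Continuous.div (h1.inner (hf n)) ?_ fun x => ?_) h1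
    · exact (RCLike.continuous_ofReal.comp (h1.norm.pow 2))
    · simpa using gramSchmidt_ne_zero i (hl x)

/-- `f i` differs from its Gram–Schmidt vector by a combination of earlier ones, which are
orthogonal to it. -/
theorem inner_gramSchmidtNormed_self_pos {ι E : Type*} [NormedAddCommGroup E]
    [InnerProductSpace ℝ E] [LinearOrder ι] [LocallyFiniteOrderBot ι] [WellFoundedLT ι]
    {f : ι → E} (hl : LinearIndependent ℝ f) (i : ι) :
    0 < inner ℝ (gramSchmidtNormed ℝ f i) (f i) := by
  have h0 := gramSchmidt_ne_zero i hl
  have h1 : inner ℝ (gramSchmidt ℝ f i) (f i) = inner ℝ (gramSchmidt ℝ f i) (gramSchmidt ℝ f i) := by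
    conv_lhs => rw [gramSchmidt_def'' ℝ f i]
    rw [inner_add_right, inner_sum, Finset.sum_eq_zero, add_zero]
    intro k hk
    rw [inner_smul_right, gramSchmidt_orthogonal ℝ f (Finset.mem_Iio.1 hk).ne', mul_zero]
  rw [gramSchmidtNormed, inner_smul_left, h1]
  exact mul_pos (inv_pos.2 (norm_pos_iff.2 h0)) (real_inner_self_pos.2 h0)

/-- The endomorphism whose columns result from those of `A` by the Gram–Schmidt process. -/
noncomputable def gsCols (A : End4) : End4 := ofCols (gramSchmidtNormed ℝ fun i => A (stdE i))

theorem gsCols_stdE (A : End4) (i : Fin 4) :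
    gsCols A (stdE i) = gramSchmidtNormed ℝ (fun i => A (stdE i)) i := ofCols_stdE _ _

theorem gsCols_orthonormal {A : End4} (h : A.det ≠ 0) :
    Orthonormal ℝ fun i => gsCols A (stdE i) := by
  simpa only [gsCols_stdE] using gramSchmidtNormed_orthonormal (End4.linearIndependent h)

theorem gsCols_of_orthonormal {A : End4} (h : Orthonormal ℝ fun i => A (stdE i)) :
    gsCols A = A := by
  refine End4.ext_stdE fun i => ?_
  rw [gsCols_stdE, gramSchmidtNormed, gramSchmidt_of_orthogonal ℝ fun i j hij => h.2 hij, h.1 i]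
  simp

theorem gsCols_stdE_zero {A : End4} (h : A (stdE 0) = stdE 0) : gsCols A (stdE 0) = stdE 0 := by
  have : (0 : Fin 4) = ⊥ := rfl
  rw [gsCols_stdE, gramSchmidtNormed, this, gramSchmidt_bot, ← this, h]
  simp

/-- Relative to the orthonormal basis formed by the columns of `gsCols A`, both `A` and `gsCols A`
are upper triangular with positive diagonal, hence so are all their convex combinations. -/
theorem det_gsCols_path {A : End4} (h : 0 < A.det) {s : ℝ} (hs : s ∈ Set.Icc (0 : ℝ) 1) :
    0 < ((1 - s) • A + s • gsCols A).det := by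
  have hl := End4.linearIndependent h.ne'
  have ho := gsCols_orthonormal h.ne'
  have key : ∀ s ∈ Set.Icc (0 : ℝ) 1, 0 < (gsCols A).det * ((1 - s) • A + s • gsCols A).det := by
    intro s hs
    have he : ∀ j i, inner ℝ (gsCols A (stdE j)) (((1 - s) • A + s • gsCols A) (stdE i)) =
        (1 - s) * inner ℝ (gsCols A (stdE j)) (A (stdE i)) + s * if j = i then 1 else 0 := by
      intro j i
      rw [add_apply, smul_apply, smul_apply, inner_add_right, inner_smul_right, inner_smul_right,
        orthonormal_iff_ite.1 ho]
    rw [End4.det_mul_det, Matrix.det_of_isUpperTriangular]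
    · refine Finset.prod_pos fun i _ => ?_
      rw [Matrix.of_apply, he, if_pos rfl, mul_one, gsCols_stdE]
      have h1 := inner_gramSchmidtNormed_self_pos hl i
      rcases hs.1.eq_or_lt with h0 | h0
      · rw [← h0]; simpa using h1
      · have := mul_nonneg (sub_nonneg.2 hs.2) h1.le
        linarith
    · intro j i hij
      have hij' : i < j := hij
      rw [Matrix.of_apply, he, if_neg hij'.ne', mul_zero, add_zero, gsCols_stdE, gramSchmidtNormed,
        inner_smul_left, gramSchmidt_inv_triangular ℝ _ hij', mul_zero, mul_zero]
  -- For `s = 0` this says that `gsCols A` has the same sign of the determinant as `A`, so the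
  -- auxiliary factor can be removed.
  have h0 := key 0 ⟨le_rfl, zero_le_one⟩
  rw [sub_zero, one_smul, zero_smul ℝ (gsCols A), add_zero] at h0
  exact (pos_iff_pos_of_mul_pos (key s hs)).1 ((pos_iff_pos_of_mul_pos h0).2 h)

theorem det_gsCols {A : End4} (h : 0 < A.det) : 0 < (gsCols A).det := by
  have := det_gsCols_path h (s := 1) ⟨zero_le_one, le_rfl⟩
  rwa [sub_self, zero_smul ℝ A, zero_add, one_smul] at this

theorem continuous_gsCols {X : Type*} [TopologicalSpace X] {F : X → End4} (hF : Continuous F)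
    (h : ∀ x, 0 < (F x).det) : Continuous fun x => gsCols (F x) := by
  refine End4.continuous_iff.2 fun i => ?_
  simp only [gsCols_stdE, gramSchmidtNormed]
  have h1 := continuous_gramSchmidt (f := fun x i => F x (stdE i)) (fun i => End4.continuous_iff.1 hF i)
    (fun x => End4.linearIndependent (h x).ne') i
  refine Continuous.smul (Continuous.inv₀ (h1.norm) fun x => ?_) h1
  simpa using gramSchmidt_ne_zero i (End4.linearIndependent (h x).ne')

/-- The straight line from `A` to `gsCols A` in `GL⁺(4, ℝ)`. -/
noncomputable def GLplus.gsPath (s : unitInterval) (A : GLplus) : GLplus :=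
  GLplus.ofEnd ((1 - (s : ℝ)) • ((A : End4ˣ) : End4) + (s : ℝ) • gsCols ((A : End4ˣ) : End4))

theorem GLplus.coe_gsPath (s : unitInterval) (A : GLplus) :
    ((GLplus.gsPath s A : End4ˣ) : End4) =
      (1 - (s : ℝ)) • ((A : End4ˣ) : End4) + (s : ℝ) • gsCols ((A : End4ˣ) : End4) :=
  GLplus.coe_ofEnd (det_gsCols_path A.2 s.2)

theorem GLplus.continuous_gsPath :
    Continuous fun x : unitInterval × GLplus => GLplus.gsPath x.1 x.2 := by
  refine GLplus.continuous_ofEnd ?_ fun x => det_gsCols_path x.2.2 x.1.2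
  have h1 : Continuous fun x : unitInterval × GLplus => ((x.2 : End4ˣ) : End4) :=
    isEmbedding_GLplus.continuous.comp continuous_snd
  have h2 := continuous_gsCols h1 fun x => x.2.2
  fun_prop

theorem GLplus.gsPath_zero (A : GLplus) : GLplus.gsPath 0 A = A :=
  GLplus.ext (by
    rw [GLplus.coe_gsPath, Set.Icc.coe_zero, sub_zero, one_smul, zero_smul ℝ (gsCols _), add_zero])

theorem GLplus.coe_gsPath_one (A : GLplus) :
    ((GLplus.gsPath 1 A : End4ˣ) : End4) = gsCols ((A : End4ˣ) : End4) := by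
  rw [GLplus.coe_gsPath, Set.Icc.coe_one, sub_self, zero_smul ℝ ((A : End4ˣ) : End4), zero_add,
    one_smul]

end GramSchmidt

/-! ### Connectedness of `GL⁺(4)`. -/

section Connected

open InnerProductSpace

theorem GLplus.mem_component {X : Type*} [TopologicalSpace X] [PreconnectedSpace X]
    {F : X → GLplus} (hF : Continuous F) {x : X}
    (h : F x ∈ Subgroup.connectedComponentOfOne GLplus) (y : X) :
    F y ∈ Subgroup.connectedComponentOfOne GLplus := by
  have h1 : F x ∈ connectedComponent (1 : GLplus) := h
  change F y ∈ connectedComponent (1 : GLplus)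
  rw [connectedComponent_eq h1]
  exact (isPreconnected_range hF).subset_connectedComponent ⟨x, rfl⟩ ⟨y, rfl⟩

/-- The reflection in the hyperplane orthogonal to `v`. -/
noncomputable def reflEnd (v : E4) : End4 := ((ℝ ∙ v)ᗮ.reflection : E4 →L[ℝ] E4)

theorem det_reflEnd {v : E4} (hv : v ≠ 0) : (reflEnd v).det = -1 := by
  have h := Submodule.det_reflection (ℝ ∙ v)ᗮ
  rw [Submodule.orthogonal_orthogonal, finrank_span_singleton hv, pow_one] at h
  exact h

theorem reflEnd_apply (v x : E4) : reflEnd v x = (ℝ ∙ v)ᗮ.reflection x := rfl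

theorem reflEnd_mul_self (v : E4) : reflEnd v * reflEnd v = 1 := by
  refine ContinuousLinearMap.ext fun x => ?_
  change reflEnd v (reflEnd v x) = x
  rw [reflEnd_apply, reflEnd_apply, Submodule.reflection_reflection]

/-- The vector `v` can be moved to `w` in the connected space `ℝ⁴ ∖ 0`, and for `v = w` the product
is `1`. -/
theorem reflEnd_mul_mem {v w : E4} (hv : v ≠ 0) (hw : w ≠ 0) :
    ∃ g ∈ Subgroup.connectedComponentOfOne GLplus,
      ((g : End4ˣ) : End4) = reflEnd v * reflEnd w := by
  have hd : ∀ v : {v : E4 // v ≠ 0}, 0 < (reflEnd v * reflEnd w).det := fun v => by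
    rw [End4.det_mul, det_reflEnd v.2, det_reflEnd hw]; norm_num
  have : PreconnectedSpace {v : E4 // v ≠ 0} := by
    have h := isPreconnected_iff_preconnectedSpace.1
      (isPathConnected_compl_singleton_of_one_lt_rank (E := E4)
        (by rw [← Module.finrank_eq_rank, finrank_euclideanSpace]; norm_num) 0).isConnected.isPreconnected
    exact h
  have hc : Continuous fun v : {v : E4 // v ≠ 0} => reflEnd v * reflEnd w := by
    refine Continuous.mul (continuous_clm_apply.2 fun x => ?_) continuous_const
    have : ∀ v : {v : E4 // v ≠ 0}, reflEnd v x =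
        -(2 • (inner ℝ v.1 x / ((‖v.1‖ : ℝ) ^ 2)) • v.1 - x) := fun v => by
      rw [reflEnd_apply, Submodule.reflection_orthogonal_apply, Submodule.reflection_singleton_apply]
      rfl
    simp only [this]
    have h1 : Continuous fun v : {v : E4 // v ≠ 0} => inner ℝ v.1 x / ‖v.1‖ ^ 2 :=
      Continuous.div (by fun_prop) (by fun_prop) fun v => by simpa using v.2
    fun_prop
  refine ⟨GLplus.ofEnd (reflEnd v * reflEnd w), ?_, GLplus.coe_ofEnd (hd ⟨v, hv⟩)⟩
  refine GLplus.mem_component (GLplus.continuous_ofEnd hc hd) (x := ⟨w, hw⟩) ?_ ⟨v, hv⟩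
  have : GLplus.ofEnd (reflEnd w * reflEnd w) = 1 :=
    GLplus.ext (by rw [GLplus.coe_ofEnd (hd ⟨w, hw⟩), reflEnd_mul_self]; rfl)
  rw [this]
  exact one_mem _

theorem stdE_ne_zero (i : Fin 4) : stdE i ≠ 0 := by simp [stdE]

/-- An isometry is a product of reflections, and products of two reflections lie in the component of
`1`; the fixed reflection in the second alternative takes care of an odd number of them. -/
theorem exists_mem_component_of_isometry (φ : E4 ≃ₗᵢ[ℝ] E4) :
    ∃ g ∈ Subgroup.connectedComponentOfOne GLplus, ((g : End4ˣ) : End4) = (φ : E4 →L[ℝ] E4) ∨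
      ((g : End4ˣ) : End4) = reflEnd (stdE 0) * (φ : E4 →L[ℝ] E4) := by
  obtain ⟨l, -, rfl⟩ := φ.reflections_generate_dim
  induction l with
  | nil => exact ⟨1, one_mem _, Or.inl rfl⟩
  | cons v l ih =>
    have hcons : ((((v :: l).map fun v => (ℝ ∙ v)ᗮ.reflection).prod : E4 ≃ₗᵢ[ℝ] E4) : End4) =
        reflEnd v * (((l.map fun v => (ℝ ∙ v)ᗮ.reflection).prod : E4 ≃ₗᵢ[ℝ] E4) : End4) := by
      rw [List.map_cons, List.prod_cons]; rfl
    rw [hcons]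
    obtain ⟨g, hg, e⟩ := ih
    -- The list may contain the zero vector, whose reflection is the identity.
    by_cases hv : v = 0
    · have : reflEnd v = 1 := by
        refine ContinuousLinearMap.ext fun x => Submodule.reflection_mem_subspace_eq_self ?_
        rw [hv, Submodule.span_zero_singleton, Submodule.bot_orthogonal_eq_top]
        trivial
      rw [this, one_mul]
      exact ⟨g, hg, e⟩
    · rcases e with e | e
      · obtain ⟨k, hk, ek⟩ := reflEnd_mul_mem (stdE_ne_zero 0) hv
        exact ⟨k * g, mul_mem hk hg, Or.inr (by
          rw [Subgroup.coe_mul, Units.val_mul, ek, e, mul_assoc])⟩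
      · obtain ⟨k, hk, ek⟩ := reflEnd_mul_mem hv (stdE_ne_zero 0)
        exact ⟨k * g, mul_mem hk hg, Or.inl (by
          rw [Subgroup.coe_mul, Units.val_mul, ek, e, mul_assoc, ← mul_assoc (reflEnd (stdE 0)),
            reflEnd_mul_self, one_mul])⟩

theorem exists_isometry_of_orthonormal {A : End4} (h : Orthonormal ℝ fun i => A (stdE i)) :
    ∃ φ : E4 ≃ₗᵢ[ℝ] E4, ((φ : E4 →L[ℝ] E4) : End4) = A := by
  let b := (EuclideanSpace.basisFun (Fin 4) ℝ)
  have hb : Orthonormal ℝ b.toBasis := by rw [OrthonormalBasis.coe_toBasis]; exact b.orthonormal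
  have hf : Orthonormal ℝ ((A : E4 →ₗ[ℝ] E4) ∘ b.toBasis) := by
    rw [OrthonormalBasis.coe_toBasis]
    simpa [b, Function.comp_def] using h
  exact ⟨((A : E4 →ₗ[ℝ] E4).isometryOfOrthonormal hb hf).toLinearIsometryEquiv rfl,
    ContinuousLinearMap.ext fun x => rfl⟩

/-- The Gram–Schmidt path leads from any matrix to an orthogonal one of positive determinant, and
positivity excludes an odd number of reflections. -/
instance : ConnectedSpace GLplus := by
  refine connectedSpace_iff_univ.2 ?_
  have h : connectedComponent (1 : GLplus) = Set.univ := by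
    refine Set.eq_univ_of_forall fun A => ?_
    have hA : 0 < ((A : End4ˣ) : End4).det := A.2
    have h1 : GLplus.gsPath 1 A ∈ Subgroup.connectedComponentOfOne GLplus := by
      obtain ⟨φ, hφ⟩ := exists_isometry_of_orthonormal (gsCols_orthonormal hA.ne')
      obtain ⟨g, hg, e⟩ := exists_mem_component_of_isometry φ
      rw [hφ] at e
      rcases e with e | e
      · rwa [← GLplus.ext (e.trans (GLplus.coe_gsPath_one A).symm)]
      · have h2 : 0 < ((g : End4ˣ) : End4).det := g.2
        rw [e, End4.det_mul, det_reflEnd (stdE_ne_zero 0)] at h2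
        linarith [det_gsCols hA]
    have hc : Continuous fun s : unitInterval => GLplus.gsPath s A :=
      GLplus.continuous_gsPath.comp (f := fun s : unitInterval => (s, A))
        (Continuous.prodMk_left A)
    have h2 := GLplus.mem_component hc h1 0
    rwa [GLplus.gsPath_zero] at h2
  exact h ▸ isConnected_connectedComponent

end Connected

/-! ### Contractibility of loops in the punctured space `ℝ⁴ ∖ 0`. -/

section PuncturedSpace

open unitInterval

theorem E4.norm_le_sum (x : E4) : ‖x‖ ≤ ∑ i, |x i| := by
  conv_lhs => rw [← (EuclideanSpace.basisFun (Fin 4) ℝ).sum_repr x]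
  refine (norm_sum_le _ _).trans (Finset.sum_le_sum fun i _ => ?_)
  rw [norm_smul, OrthonormalBasis.norm_eq_one, mul_one]
  rfl

/-- A path in `ℝ⁴` has a smooth approximation with the same end points. -/
theorem exists_contDiff_near {v : I → E4} (hv : Continuous v) {ε : ℝ} (hε : 0 < ε) :
    ∃ q : ℝ → E4, ContDiff ℝ 1 q ∧ q 0 = v 0 ∧ q 1 = v 1 ∧ ∀ t : I, ‖q t - v t‖ < ε := by
  have h1 : ∀ i, ∃ p : Polynomial ℝ, ∀ t : I, |p.eval (t : ℝ) - v t i| < ε / 12 := fun i => by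
    obtain ⟨p, hp⟩ := exists_polynomial_near_of_continuousOn 0 1
      (fun x => v (Set.projIcc 0 1 zero_le_one x) i) (by fun_prop) (ε / 12) (by positivity)
    exact ⟨p, fun t => by simpa using hp t t.2⟩
  choose p hp using h1
  -- Interpolation corrects the polynomials at both ends. In each of the four coordinates the three
  -- errors, each below `ε / 12`, add up to less than `ε / 4`.
  let q : ℝ → E4 := fun t => WithLp.toLp 2 fun i => (p i).eval t +
    ((1 - t) * (v 0 i - (p i).eval 0) + t * (v 1 i - (p i).eval 1))
  have hq : ∀ t i, q t i = (p i).eval t +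
    ((1 - t) * (v 0 i - (p i).eval 0) + t * (v 1 i - (p i).eval 1)) := fun t i => rfl
  refine ⟨q, ?_, ?_, ?_, fun t => ?_⟩
  · refine (contDiff_piLp 2).2 fun i => ?_
    simp only [hq]
    have h2 : ContDiff ℝ 1 fun t => (p i).eval t := by
      simpa using (p i).contDiff_aeval (𝕜 := ℝ) 1
    fun_prop
  · ext i; rw [hq]; ring
  · ext i; rw [hq]; ring
  · refine (E4.norm_le_sum _).trans_lt ?_
    have key : ∀ i, |(q t - v t) i| < ε / 4 := fun i => by
      have e0 := hp i 0
      have e1 := hp i 1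
      have et := hp i t
      rw [Set.Icc.coe_zero] at e0
      rw [Set.Icc.coe_one] at e1
      rw [PiLp.sub_apply, hq]
      have t0 := t.2.1
      have t1 := t.2.2
      rw [abs_lt] at *
      constructor <;> nlinarith
    calc ∑ i, |(q t - v t) i| < ∑ _i : Fin 4, ε / 4 :=
          Finset.sum_lt_sum_of_nonempty Finset.univ_nonempty fun i _ => key i
      _ = ε := by simp; ring

/-- Loops in `ℝ⁴ ∖ 0` are contractible. -/
theorem exists_nullhomotopy {v : I → E4} (hv : Continuous v) (h0 : ∀ t, v t ≠ 0)
    (h01 : v 0 = v 1) : ∃ F : I × I → E4, Continuous F ∧ (∀ x, F x ≠ 0) ∧ (∀ t, F (0, t) = v t) ∧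
      (∀ s, F (s, 0) = F (s, 1)) ∧ ∀ t, F (1, t) = F (1, 0) := by
  obtain ⟨t₀, -, ht₀⟩ := isCompact_univ.exists_isMinOn Set.univ_nonempty hv.norm.continuousOn
  have hε : 0 < ‖v t₀‖ := norm_pos_iff.2 (h0 t₀)
  obtain ⟨q, hq, q0, q1, hqv⟩ := exists_contDiff_near hv hε
  have hqv' : ∀ t : I, ‖q t - v t‖ < ‖v t‖ := fun t => (hqv t).trans_le (ht₀ (Set.mem_univ t))
  have hqc := hq.continuous
  -- The lines joining `0` to the points of the curve `q` fill the image of a plane under a `C¹`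
  -- map, so some `c` lies on none of them; the segments from `q t` to `c` then avoid `0`.
  have hd : Dense (Set.range fun x : ℝ × ℝ => x.1 • q x.2)ᶜ := by
    refine ContDiff.dense_compl_range_of_finrank_lt_finrank (by fun_prop) ?_
    rw [finrank_euclideanSpace, Module.finrank_prod]
    simp
  obtain ⟨c, hc⟩ := hd.nonempty
  have hc' : ∀ a b : ℝ, ∀ t : ℝ, b ≠ 0 → a • q t + b • c ≠ 0 := fun a b t hb h => hc
    ⟨(-(b⁻¹ * a), t), by
      have h2 : b⁻¹ • (a • q t + b • c) = 0 := by rw [h, smul_zero]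
      rw [smul_add, smul_smul, inv_smul_smul₀ hb] at h2
      simpa using (eq_neg_of_add_eq_zero_right h2).symm⟩
  have hq0 : ∀ (r : ℝ) (t : I), r ∈ Set.Icc (0 : ℝ) 1 → (1 - r) • v t + r • q t ≠ 0 := by
    intro r t hr h
    have h2 : v t = -(r • (q t - v t)) := by
      rw [← sub_eq_zero]
      rw [← h]
      module
    have h3 := congrArg norm h2
    rw [norm_neg, norm_smul, Real.norm_of_nonneg hr.1] at h3
    have := hqv' t
    nlinarith [norm_nonneg (q t - v t), hr.2]
  -- `a` and `d` are the weights of `v` and `c`: for `s ≤ 1 / 2` the loop `v` moves to `q`,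
  -- afterwards `q` moves to `c`.
  let a : I → ℝ := fun s => max 0 (1 - 2 * (s : ℝ))
  let d : I → ℝ := fun s => max 0 (2 * (s : ℝ) - 1)
  refine ⟨fun x => a x.1 • v x.2 + (1 - a x.1 - d x.1) • q x.2 + d x.1 • c, by fun_prop, ?_, ?_, ?_,
    ?_⟩
  · rintro ⟨s, t⟩
    rcases le_or_gt (s : ℝ) (1 / 2) with hs | hs
    · have e1 : d s = 0 := max_eq_left (by linarith)
      have e2 : a s = 1 - 2 * s := max_eq_right (by linarith)
      have h4 := hq0 (2 * s) t ⟨by linarith [s.2.1], by linarith⟩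
      simp only [e1, e2, zero_smul, add_zero, sub_zero, sub_sub_cancel]
      exact h4
    · have e1 : d s = 2 * s - 1 := max_eq_right (by linarith)
      have e2 : a s = 0 := max_eq_left (by linarith)
      simp only [e1, e2, zero_smul, zero_add, sub_zero]
      exact hc' _ _ _ (by linarith)
  · intro t
    simp [a, d]
  · intro s
    simp [q0, q1, h01]
  · intro t
    have e1 : a 1 = 0 := by simp [a]
    have e2 : d 1 = 1 := by simp only [d, Set.Icc.coe_one]; norm_num
    simp [e1, e2]

end PuncturedSpace

/-! ### Quaternions and loops of left multiplications. -/

section LeftMultiplication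

open unitInterval

theorem End4.det_eq (A : End4) : A.det = (Matrix.of fun j i => A (stdE i) j).det := by
  have h := End4.det_mul_det 1 A
  have h1 : (1 : End4).det = 1 := by simp [ContinuousLinearMap.det]
  rw [h1, one_mul] at h
  rw [h]
  congr 1
  ext j i
  simp [PiLp.inner_apply]

/-- Left multiplication by the quaternion `v`. -/
noncomputable def quatMul (v : E4) : End4 :=
  -- The columns are the quaternions `v`, `v i`, `v j` and `v k`.
  ofCols ![v, !₂[-v 1, v 0, v 3, -v 2], !₂[-v 2, -v 3, v 0, v 1], !₂[-v 3, v 2, -v 1, v 0]]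

theorem quatMul_stdE_zero (v : E4) : quatMul v (stdE 0) = v := ofCols_stdE _ _

theorem quatMul_one : quatMul (stdE 0) = 1 := by
  refine End4.ext_stdE fun i => ?_
  rw [quatMul, ofCols_stdE]
  ext j
  fin_cases i <;> fin_cases j <;> simp [stdE]

theorem det_quatMul (v : E4) : (quatMul v).det = (v 0 ^ 2 + v 1 ^ 2 + v 2 ^ 2 + v 3 ^ 2) ^ 2 := by
  rw [End4.det_eq]
  simp only [quatMul, ofCols_stdE]
  simp [Matrix.det_succ_row_zero, Fin.sum_univ_succ, Fin.succAbove]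
  ring

theorem det_quatMul_pos {v : E4} (hv : v ≠ 0) : 0 < (quatMul v).det := by
  have h : 0 < ‖v‖ ^ 2 := pow_pos (norm_pos_iff.2 hv) 2
  rw [EuclideanSpace.norm_sq_eq, Fin.sum_univ_four] at h
  simp only [Real.norm_eq_abs, sq_abs] at h
  rw [det_quatMul]
  positivity

theorem continuous_quatMul : Continuous quatMul := by
  refine End4.continuous_iff.2 fun i => ?_
  simp only [quatMul, ofCols_stdE]
  fin_cases i
  · exact continuous_id
  all_goals
    refine (PiLp.continuous_toLp 2 _).comp (continuous_pi fun j => ?_)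
    fin_cases j <;> simp <;> fun_prop

/-- Left multiplication by a nonzero quaternion, as an element of `GL⁺(4, ℝ)`. -/
noncomputable def GLplus.quat (v : E4) : GLplus := GLplus.ofEnd (quatMul v)

theorem GLplus.coe_quat {v : E4} (hv : v ≠ 0) : ((GLplus.quat v : End4ˣ) : End4) = quatMul v :=
  GLplus.coe_ofEnd (det_quatMul_pos hv)

theorem GLplus.quat_one : GLplus.quat (stdE 0) = 1 :=
  GLplus.ext (by rw [GLplus.coe_quat (stdE_ne_zero 0), quatMul_one]; rfl)

theorem GLplus.continuous_quat {X : Type*} [TopologicalSpace X] {v : X → E4} (hv : Continuous v)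
    (h : ∀ x, v x ≠ 0) : Continuous fun x => GLplus.quat (v x) :=
  GLplus.continuous_ofEnd (continuous_quatMul.comp hv) fun x => det_quatMul_pos (h x)

/-- The contraction in `ℝ⁴ ∖ 0` moves the base point; dividing in the group by the value at `t = 0`
makes it a based homotopy. -/
theorem GLplus.exists_quat_nullhomotopy {v : I → E4} (hv : Continuous v) (h : ∀ t, v t ≠ 0)
    (h0 : v 0 = stdE 0) (h1 : v 1 = stdE 0) :
    ∃ K : I × I → GLplus, Continuous K ∧ (∀ t, K (0, t) = GLplus.quat (v t)) ∧
      (∀ t, K (1, t) = 1) ∧ (∀ s, K (s, 0) = 1) ∧ ∀ s, K (s, 1) = 1 := by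
  have := topologicalGroup_of_lieGroup 𝓘(ℝ, End4) ∞ (G := GLplus)
  obtain ⟨F, hF, hn, F0, Fs, F1⟩ := exists_nullhomotopy hv h (h0.trans h1.symm)
  refine ⟨fun x => GLplus.quat (F x) * (GLplus.quat (F (x.1, 0)))⁻¹,
    (GLplus.continuous_quat hF hn).mul
      (GLplus.continuous_quat (hF.comp (by fun_prop : Continuous fun x : I × I => (x.1, (0 : I))))
        fun x => hn _).inv, fun t => ?_, fun t => ?_, fun s => ?_, fun s => ?_⟩
  · simp only [F0, h0, GLplus.quat_one, inv_one, mul_one]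
  · simp only [F1 t, mul_inv_cancel]
  · simp only [mul_inv_cancel]
  · simp only [← Fs s, mul_inv_cancel]

end LeftMultiplication

/-! ### Deformation to rotations and the comparison of fundamental groups. -/

section LorentzRetraction

open unitInterval

/-- The endomorphism preserves the Lorentz form. -/
def IsLorentz (A : End4) : Prop := ∀ x y, lorentzForm (A x) (A y) = lorentzForm x y

theorem IsLorentz.mul {A B : End4} (hA : IsLorentz A) (hB : IsLorentz B) : IsLorentz (A * B) :=
  fun x y => (hA _ _).trans (hB x y)

theorem lorentzForm_stdE_left (x : E4) : lorentzForm (stdE 0) x = x 0 := by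
  simp [lorentzForm, stdE]

theorem lorentzForm_eq_inner (x y : E4) : lorentzForm x y = 2 * (x 0 * y 0) - inner ℝ x y := by
  simp only [lorentzForm, PiLp.inner_apply, Fin.sum_univ_four, RCLike.inner_apply, conj_trivial]
  ring

theorem IsLorentz.det_ne_zero {A : End4} (hA : IsLorentz A) : A.det ≠ 0 := by
  have hinj : LinearMap.ker (A : E4 →ₗ[ℝ] E4) = ⊥ := by
    refine LinearMap.ker_eq_bot'.2 fun x hx => ?_
    have h : ∀ y, lorentzForm x y = 0 := fun y => by
      rw [← hA x y, show A x = 0 from hx]; simp [lorentzForm]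
    ext i
    have := h (stdE i)
    fin_cases i <;> simpa [lorentzForm, stdE] using this
  exact ((LinearEquiv.ofInjectiveEndo (A : E4 →ₗ[ℝ] E4) (LinearMap.ker_eq_bot.1 hinj)).isUnit_det').ne_zero

/-- A family over a connected space that takes the value `1` stays in the component of `1`, so
neither the determinant nor the time orientation has to be examined. -/
theorem exists_continuous_SO13₀ {X : Type*} [TopologicalSpace X] [PreconnectedSpace X]
    {F : X → End4} (hF : Continuous F) (h : ∀ x, IsLorentz (F x)) {x₀ : X} (h0 : F x₀ = 1) :
    ∃ f : X → SO13₀, Continuous f ∧ ∀ x, (((f x : O13) : End4ˣ) : End4) = F x := by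
  let g : X → O13 := fun x =>
    ⟨((F x).toContinuousLinearEquivOfDetNeZero (h x).det_ne_zero).toUnit, h x⟩
  have hg : Continuous g := isEmbedding_O13.continuous_iff.2 hF
  have g0 : g x₀ = 1 := isEmbedding_O13.injective h0
  have hm : ∀ x, g x ∈ SO13₀ := fun x => by
    change g x ∈ connectedComponent (1 : O13)
    exact (isPreconnected_range hg).subset_connectedComponent ⟨x₀, g0⟩ ⟨x, rfl⟩
  exact ⟨fun x => ⟨g x, hm x⟩, hg.subtype_mk _, fun x => rfl⟩

/-- The Lorentz form is `2 x₀ y₀ - ⟨x, y⟩`, and an isometry fixing the first basis vector preserves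
the coordinate `x₀`. -/
theorem isLorentz_of_orthonormal {A : End4} (h : Orthonormal ℝ fun i => A (stdE i))
    (h0 : A (stdE 0) = stdE 0) : IsLorentz A := by
  obtain ⟨φ, hφ⟩ := exists_isometry_of_orthonormal h
  have hi : ∀ x y, inner ℝ (A x) (A y) = inner ℝ x y := fun x y => by
    rw [← hφ]; exact φ.inner_map_map x y
  have hz : ∀ x, A x 0 = x 0 := fun x => by
    have := hi (stdE 0) x
    rw [h0] at this
    simpa [stdE, EuclideanSpace.inner_single_left] using this
  intro x y
  rw [lorentzForm_eq_inner, lorentzForm_eq_inner, hi, hz, hz]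

theorem IsLorentz.orthonormal {A : End4} (h : IsLorentz A) (h0 : A (stdE 0) = stdE 0) :
    Orthonormal ℝ fun i => A (stdE i) := by
  have hz : ∀ x, A x 0 = x 0 := fun x => by
    have := h (stdE 0) x
    rwa [h0, lorentzForm_stdE_left, lorentzForm_stdE_left] at this
  have hi : ∀ x y, inner ℝ (A x) (A y) = inner ℝ x y := fun x y => by
    have := h x y
    rw [lorentzForm_eq_inner, lorentzForm_eq_inner, hz, hz] at this
    linarith
  rw [orthonormal_iff_ite]
  intro i j
  rw [hi]
  simp [stdE, EuclideanSpace.inner_single_left]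

/-- The reflection in the line spanned by `w`, relative to the Lorentz form. -/
noncomputable def lorentzRefl (w : E4) : End4 :=
  LinearMap.toContinuousLinearMap
    { toFun := fun x => (2 * lorentzForm x w / lorentzForm w w) • w - x
      map_add' := fun x y => by
        have : lorentzForm (x + y) w = lorentzForm x w + lorentzForm y w := by
          simp [lorentzForm]; ring
        rw [this, mul_add, add_div, add_smul]; abel
      map_smul' := fun c x => by
        have : lorentzForm (c • x) w = c * lorentzForm x w := by
          simp [lorentzForm]; ring
        rw [this, RingHom.id_apply, smul_sub, smul_smul]; congr 2; ring }

theorem lorentzRefl_apply (w x : E4) :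
    lorentzRefl w x = (2 * lorentzForm x w / lorentzForm w w) • w - x := rfl

theorem isLorentz_lorentzRefl {w : E4} (hw : lorentzForm w w ≠ 0) : IsLorentz (lorentzRefl w) := by
  intro x y
  have key : ∀ c d : ℝ, lorentzForm (c • w - x) (d • w - y) = c * d * lorentzForm w w -
      c * lorentzForm y w - d * lorentzForm x w + lorentzForm x y := fun c d => by
    simp [lorentzForm]; ring
  rw [lorentzRefl_apply, lorentzRefl_apply, key]
  field_simp
  ring

theorem lorentzRefl_mul_self {w : E4} (hw : lorentzForm w w ≠ 0) :
    lorentzRefl w * lorentzRefl w = 1 := by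
  refine ContinuousLinearMap.ext fun x => ?_
  have key : ∀ c : ℝ, lorentzForm (c • w - x) w = c * lorentzForm w w - lorentzForm x w :=
    fun c => by simp [lorentzForm]; ring
  change lorentzRefl w (lorentzRefl w x) = x
  rw [lorentzRefl_apply, lorentzRefl_apply, key, ← sub_add, ← sub_smul]
  have : 2 * (2 * lorentzForm x w / lorentzForm w w * lorentzForm w w - lorentzForm x w) /
      lorentzForm w w - 2 * lorentzForm x w / lorentzForm w w = 0 := by
    field_simp; ring
  rw [this, zero_smul, zero_add]

theorem lorentzRefl_smul {w : E4} {c : ℝ} (hc : c ≠ 0) : lorentzRefl (c • w) = lorentzRefl w := by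
  refine ContinuousLinearMap.ext fun x => ?_
  have h1 : lorentzForm x (c • w) = c * lorentzForm x w := by simp [lorentzForm]; ring
  have h2 : lorentzForm (c • w) (c • w) = c * c * lorentzForm w w := by simp [lorentzForm]; ring
  rw [lorentzRefl_apply, lorentzRefl_apply, h1, h2, smul_smul]
  congr 2
  rcases eq_or_ne (lorentzForm w w) 0 with h | h
  · simp [h]
  · field_simp

theorem continuous_lorentzRefl {X : Type*} [TopologicalSpace X] {w : X → E4} (hw : Continuous w)
    (h : ∀ x, lorentzForm (w x) (w x) ≠ 0) : Continuous fun x => lorentzRefl (w x) := by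
  refine End4.continuous_iff.2 fun i => ?_
  simp only [lorentzRefl_apply]
  have h1 : Continuous fun x => lorentzForm (w x) (w x) := by unfold lorentzForm; fun_prop
  have h2 : Continuous fun x => lorentzForm (stdE i) (w x) := by unfold lorentzForm; fun_prop
  exact ((((continuous_const.mul h2).div h1 h).smul hw).sub continuous_const)

theorem SO13₀.isLorentz (A : SO13₀) : IsLorentz (((A : O13) : End4ˣ) : End4) := A.1.2

/-- This entry is `1` at the identity and never vanishes, as the image of the first basis vector has
Lorentz square `1`; the group is connected. -/
theorem SO13₀.stdE_zero_pos (A : SO13₀) : 0 < (((A : O13) : End4ˣ) : End4) (stdE 0) 0 := by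
  have hc : Continuous fun A : SO13₀ => (((A : O13) : End4ˣ) : End4) (stdE 0) 0 :=
    (by fun_prop : Continuous fun B : End4 => B (stdE 0) 0).comp isEmbedding_SO13₀.continuous
  by_contra hle
  obtain ⟨B, hB⟩ := mem_range_of_exists_le_of_exists_ge hc ⟨A, not_lt.1 hle⟩
    ⟨1, by change (0 : ℝ) ≤ (1 : End4) (stdE 0) 0; simp [stdE]⟩
  have h := SO13₀.isLorentz B (stdE 0) (stdE 0)
  rw [lorentzForm_stdE_left] at h
  simp only [lorentzForm, hB] at h
  have : (stdE 0 : E4) 0 = 1 := by simp [stdE]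
  rw [this] at h
  nlinarith

/-- The homotopy contracts `SO₀(1, 3)` onto the stabilizer of the first basis vector. -/
theorem SO13₀.exists_deformation : ∃ D : I × SO13₀ → SO13₀, Continuous D ∧ (∀ A, D (0, A) = A) ∧
    (∀ s, D (s, 1) = 1) ∧ ∀ A, (((D (1, A) : O13) : End4ˣ) : End4) (stdE 0) = stdE 0 := by
  let a : SO13₀ → E4 := fun A => (((A : O13) : End4ˣ) : End4) (stdE 0)
  have ha : Continuous a := (by fun_prop : Continuous fun B : End4 => B (stdE 0)).comp
    isEmbedding_SO13₀.continuous
  -- The deformation is `ρ(e₀) ρ(e₀ + s A e₀) A`, with `ρ` the Lorentz reflection in a line. For `s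
  -- = 0` the reflections cancel; for `s = 1` the second one takes `A e₀` to `e₀`, which the first
  -- one fixes.
  let w : I × SO13₀ → E4 := fun x => stdE 0 + (x.1 : ℝ) • a x.2
  have e0 : lorentzForm (stdE 0) (stdE 0) = 1 := by rw [lorentzForm_stdE_left]; simp [stdE]
  have haa : ∀ A, lorentzForm (a A) (a A) = 1 := fun A => (SO13₀.isLorentz A _ _).trans e0
  have hww : ∀ x, lorentzForm (w x) (w x) = 1 + 2 * x.1 * a x.2 0 + (x.1 : ℝ) ^ 2 := fun x => by
    have : lorentzForm (w x) (w x) = lorentzForm (stdE 0) (stdE 0) +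
        2 * x.1 * lorentzForm (stdE 0) (a x.2) + (x.1 : ℝ) ^ 2 * lorentzForm (a x.2) (a x.2) := by
      simp only [w, lorentzForm, PiLp.add_apply, PiLp.smul_apply, smul_eq_mul]; ring
    rw [this, e0, haa, lorentzForm_stdE_left]; ring
  -- The square is at least `1` because `A e₀` has a positive time component.
  have hw0 : ∀ x, lorentzForm (w x) (w x) ≠ 0 := fun x => by
    rw [hww]
    have := mul_nonneg x.1.2.1 (SO13₀.stdE_zero_pos x.2).le
    have h2 : (x.1 : ℝ) * a x.2 0 = x.1 * (((x.2 : O13) : End4ˣ) : End4) (stdE 0) 0 := rfl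
    nlinarith [sq_nonneg (x.1 : ℝ)]
  have e0' : lorentzForm (stdE 0) (stdE 0) ≠ 0 := by rw [e0]; exact one_ne_zero
  have hF : Continuous fun x : I × SO13₀ =>
      lorentzRefl (stdE 0) * lorentzRefl (w x) * (((x.2 : O13) : End4ˣ) : End4) :=
    (continuous_const.mul (continuous_lorentzRefl (by fun_prop) hw0)).mul
      (isEmbedding_SO13₀.continuous.comp continuous_snd)
  have hs1 : ∀ s : I, lorentzRefl (stdE 0) * lorentzRefl (w (s, 1)) *
      ((((1 : SO13₀) : O13) : End4ˣ) : End4) = 1 := fun s => by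
    have h1 : w (s, 1) = (1 + (s : ℝ)) • stdE 0 := by
      rw [add_smul, one_smul]; rfl
    have h2 : 1 + (s : ℝ) ≠ 0 := by linarith [s.2.1]
    rw [h1, lorentzRefl_smul h2, lorentzRefl_mul_self e0']
    rfl
  obtain ⟨D, hD, hDF⟩ := exists_continuous_SO13₀ hF
    (fun x => ((isLorentz_lorentzRefl e0').mul (isLorentz_lorentzRefl (hw0 x))).mul
      (SO13₀.isLorentz x.2)) (hs1 0)
  refine ⟨D, hD, fun A => isEmbedding_SO13₀.injective ((hDF _).trans ?_),
    fun s => isEmbedding_SO13₀.injective ((hDF _).trans (hs1 s)), fun A => ?_⟩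
  · have h1 : w (0, A) = stdE 0 := by simp [w]
    simp only [h1, lorentzRefl_mul_self e0', one_mul]
  · rw [hDF]
    change lorentzRefl (stdE 0) (lorentzRefl (w (1, A)) (a A)) = stdE 0
    have h1 : lorentzForm (a A) (w (1, A)) = 1 + a A 0 := by
      have : lorentzForm (a A) (w (1, A)) = lorentzForm (stdE 0) (a A) + lorentzForm (a A) (a A) := by
        simp only [w, lorentzForm, PiLp.add_apply, PiLp.smul_apply, smul_eq_mul, Set.Icc.coe_one]
        ring
      rw [this, haa, lorentzForm_stdE_left, add_comm]
    have h2 : lorentzForm (w (1, A)) (w (1, A)) = 2 * (1 + a A 0) := by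
      rw [hww]; simp only [Set.Icc.coe_one]; ring
    have h3 : lorentzRefl (w (1, A)) (a A) = stdE 0 := by
      have hne := hw0 (1, A)
      rw [lorentzRefl_apply, h1, ← h2, div_self hne, one_smul]
      simp [w]
    rw [h3, lorentzRefl_apply, e0]
    norm_num
    module

theorem GLplus.stdE_zero_ne (A : GLplus) : ((A : End4ˣ) : End4) (stdE 0) ≠ 0 := fun h => by
  have h1 := congrArg (((A : End4ˣ)⁻¹ : End4ˣ) : End4) h
  rw [map_zero] at h1
  have h2 : (((A : End4ˣ)⁻¹ : End4ˣ) : End4) (((A : End4ˣ) : End4) (stdE 0)) = stdE 0 :=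
    congrArg (fun B : End4 => B (stdE 0)) (A : End4ˣ).inv_mul
  exact stdE_ne_zero 0 (h2.symm.trans h1)

/-- The matrix `A`, multiplied by a quaternion so as to fix the first basis vector. -/
noncomputable def GLplus.normalize (A : GLplus) : GLplus :=
  (GLplus.quat (((A : End4ˣ) : End4) (stdE 0)))⁻¹ * A

theorem GLplus.continuous_normalize : Continuous GLplus.normalize := by
  have := topologicalGroup_of_lieGroup 𝓘(ℝ, End4) ∞ (G := GLplus)
  refine ((GLplus.continuous_quat ?_ GLplus.stdE_zero_ne).inv).mul continuous_id
  exact (by fun_prop : Continuous fun B : End4 => B (stdE 0)).comp isEmbedding_GLplus.continuous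

theorem GLplus.quat_mul_normalize (A : GLplus) :
    GLplus.quat (((A : End4ˣ) : End4) (stdE 0)) * GLplus.normalize A = A := mul_inv_cancel_left _ _

theorem GLplus.normalize_stdE_zero (A : GLplus) :
    ((GLplus.normalize A : End4ˣ) : End4) (stdE 0) = stdE 0 := by
  have h : ((GLplus.quat (((A : End4ˣ) : End4) (stdE 0)) : End4ˣ) : End4)
      (((GLplus.normalize A : End4ˣ) : End4) (stdE 0)) = ((A : End4ˣ) : End4) (stdE 0) :=
    congrArg (fun B : GLplus => ((B : End4ˣ) : End4) (stdE 0)) (GLplus.quat_mul_normalize A)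
  have h2 : ((GLplus.quat (((A : End4ˣ) : End4) (stdE 0)) : End4ˣ) : End4) (stdE 0) =
      ((A : End4ˣ) : End4) (stdE 0) := by
    rw [GLplus.coe_quat (GLplus.stdE_zero_ne A), quatMul_stdE_zero]
  have hinj : Function.Injective
      ((GLplus.quat (((A : End4ˣ) : End4) (stdE 0)) : End4ˣ) : End4) := fun x y e => by
    have h1 := congrArg (((GLplus.quat (((A : End4ˣ) : End4) (stdE 0)) : End4ˣ)⁻¹ : End4ˣ) : End4) e
    have h2 : ∀ z, (((GLplus.quat (((A : End4ˣ) : End4) (stdE 0)) : End4ˣ)⁻¹ : End4ˣ) : End4)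
      (((GLplus.quat (((A : End4ˣ) : End4) (stdE 0)) : End4ˣ) : End4) z) = z := fun z =>
        congrArg (fun B : End4 => B z) (Units.inv_mul _)
    rwa [h2, h2] at h1
  exact hinj (h.trans h2.symm)

theorem GLplus.normalize_of_stdE_zero {A : GLplus} (h : ((A : End4ˣ) : End4) (stdE 0) = stdE 0) :
    GLplus.normalize A = A := by
  rw [GLplus.normalize, h, GLplus.quat_one, inv_one, one_mul]

/-- After division by a quaternion the matrix fixes the first basis vector, and so does the
orthogonal matrix made from it by Gram–Schmidt, which is therefore Lorentz. Neither step changes a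
rotation that fixes this vector. -/
theorem exists_projection_SO13₀ : ∃ Q : GLplus → SO13₀, Continuous Q ∧
    (∀ A, SO13₀.incl (Q A) = GLplus.gsPath 1 (GLplus.normalize A)) ∧
    ∀ A : SO13₀, (((A : O13) : End4ˣ) : End4) (stdE 0) = stdE 0 → Q (SO13₀.incl A) = A := by
  have hfix : ∀ A : SO13₀, (((A : O13) : End4ˣ) : End4) (stdE 0) = stdE 0 →
      gsCols (((GLplus.normalize (SO13₀.incl A) : GLplus) : End4ˣ) : End4) =
        (((A : O13) : End4ˣ) : End4) := fun A hA => by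
    rw [GLplus.normalize_of_stdE_zero (A := SO13₀.incl A) hA]
    exact gsCols_of_orthonormal ((SO13₀.isLorentz A).orthonormal hA)
  have hpos : ∀ A : GLplus, 0 < ((GLplus.normalize A : End4ˣ) : End4).det :=
    fun A => (GLplus.normalize A).2
  obtain ⟨Q, hQ, hQF⟩ := exists_continuous_SO13₀
    (continuous_gsCols (isEmbedding_GLplus.continuous.comp GLplus.continuous_normalize)
      hpos) (fun A => isLorentz_of_orthonormal (gsCols_orthonormal (hpos A).ne')
      (gsCols_stdE_zero (GLplus.normalize_stdE_zero A))) (x₀ := SO13₀.incl 1) (hfix 1 rfl)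
  exact ⟨Q, hQ, fun A => GLplus.ext ((hQF A).trans (GLplus.coe_gsPath_one _).symm),
    fun A hA => isEmbedding_SO13₀.injective ((hQF _).trans (hfix A hA))⟩

/-- For injectivity, the deformation of `SO₀(1,3)` leads to matrices on which `Q ∘ incl` is the
identity, so every loop `α` is homotopic to `Q ∘ incl ∘ α`, which contracts with `incl ∘ α`. For
surjectivity, a loop in `GL⁺(4)` is a product of a loop of quaternions, which contracts, and a loop
that Gram–Schmidt deforms to `incl ∘ Q ∘ α`. -/
theorem SO13₀.bijective_pi1Map_incl :
    Function.Bijective (pi1Map SO13₀.incl SO13₀.contMDiff_incl.continuous (map_one _)) := by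
  have := topologicalGroup_of_lieGroup 𝓘(ℝ, End4) ∞ (G := GLplus)
  have hi := SO13₀.contMDiff_incl.continuous
  obtain ⟨Q, hQ, hQi, hQf⟩ := exists_projection_SO13₀
  have hQ1 : Q 1 = 1 := hQf 1 rfl
  constructor
  · obtain ⟨D, hD, D0, Ds, D1⟩ := SO13₀.exists_deformation
    rw [injective_iff_map_eq_one]
    intro a ha
    obtain ⟨α, rfl⟩ := loopClass_surjective a
    rw [pi1Map_loopClass, loopClass_eq_one_iff, Path.homotopic_iff_exists] at ha
    obtain ⟨F, hF, F0, F1, Fl, Fr⟩ := ha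
    rw [loopClass_eq_one_iff]
    let γ : Path (1 : SO13₀) 1 := ⟨⟨fun t => D (1, α t), by fun_prop⟩, by simp [Ds], by simp [Ds]⟩
    let δ : Path (1 : SO13₀) 1 := ⟨⟨fun t => Q (SO13₀.incl (α t)), by fun_prop⟩,
      by simp [hQ1], by simp [hQ1]⟩
    have h1 : α.Homotopic γ := Path.homotopic_iff_exists.2 ⟨fun x => D (x.1, α x.2), by fun_prop,
      fun t => D0 _, fun t => rfl, fun s => by simp [Ds], fun s => by simp [Ds]⟩
    have h2 : δ.Homotopic γ := Path.homotopic_iff_exists.2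
      ⟨fun x => Q (SO13₀.incl (D (x.1, α x.2))), by fun_prop, fun t => congrArg (fun B => Q (SO13₀.incl B)) (D0 _),
        fun t => hQf _ (D1 _), fun s => by simp [Ds, hQ1], fun s => by simp [Ds, hQ1]⟩
    have h3 : δ.Homotopic (Path.refl 1) := Path.homotopic_iff_exists.2
      ⟨fun x => Q (F x), by fun_prop, fun t => congrArg Q (F0 t), fun t => (congrArg Q (F1 t)).trans hQ1,
        fun s => (congrArg Q (Fl s)).trans hQ1, fun s => (congrArg Q (Fr s)).trans hQ1⟩
    exact (h1.trans h2.symm).trans h3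
  · intro a
    obtain ⟨α, rfl⟩ := loopClass_surjective a
    let v : I → E4 := fun t => ((α t : End4ˣ) : End4) (stdE 0)
    have hv : Continuous v := (by fun_prop : Continuous fun B : End4 => B (stdE 0)).comp
      (isEmbedding_GLplus.continuous.comp α.continuous)
    obtain ⟨K, hK, K0, K1, Kl, Kr⟩ := GLplus.exists_quat_nullhomotopy hv
      (fun t => GLplus.stdE_zero_ne _) (by simp [v]) (by simp [v])
    let β : Path (1 : SO13₀) 1 := ⟨⟨fun t => Q (α t), by fun_prop⟩, by simp [hQ1], by simp [hQ1]⟩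
    refine ⟨loopClass β, ?_⟩
    rw [pi1Map_loopClass, loopClass_eq_iff]
    have hn : GLplus.normalize 1 = 1 := GLplus.normalize_of_stdE_zero rfl
    have hg : ∀ s, GLplus.gsPath s 1 = 1 := fun s => by
      refine GLplus.ext ?_
      have h1 : gsCols 1 = 1 := gsCols_of_orthonormal
        (IsLorentz.orthonormal (A := 1) (fun x y => rfl) rfl)
      rw [GLplus.coe_gsPath]
      change (1 - (s : ℝ)) • (1 : End4) + (s : ℝ) • gsCols 1 = 1
      rw [h1, ← add_smul (1 - (s : ℝ)) (s : ℝ) (1 : End4), sub_add_cancel, one_smul]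
    have hc : Continuous fun x : I × I => GLplus.gsPath x.1 (GLplus.normalize (α x.2)) :=
      GLplus.continuous_gsPath.comp (f := fun x : I × I => (x.1, GLplus.normalize (α x.2)))
        (continuous_fst.prodMk (GLplus.continuous_normalize.comp
          (α.continuous.comp continuous_snd)))
    refine Path.Homotopic.symm (Path.homotopic_iff_exists.2
      ⟨fun x => K x * GLplus.gsPath x.1 (GLplus.normalize (α x.2)), hK.mul hc, fun t => ?_,
        fun t => ?_, fun s => ?_, fun s => ?_⟩)
    · simp only [K0, GLplus.gsPath_zero]
      exact GLplus.quat_mul_normalize _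
    · simp only [K1, one_mul]
      exact (hQi _).symm
    · simp only [Kl, α.source, hn, hg, one_mul]
    · simp only [Kr, α.target, hn, hg, one_mul]

end LorentzRetraction

/-! ### The oriented frame bundle as a principal bundle. -/

theorem End4.isUnit_of_det_ne_zero {A : End4} (h : A.det ≠ 0) : IsUnit A :=
  ⟨(A.toContinuousLinearEquivOfDetNeZero h).toUnit, rfl⟩

theorem GLplus.contMDiffAt_ofEnd {A : End4} (h : 0 < A.det) :
    ContMDiffAt 𝓘(ℝ, End4) 𝓘(ℝ, End4) ∞ GLplus.ofEnd A := by
  let U : TopologicalSpace.Opens End4 :=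
    ⟨{A | 0 < A.det}, isOpen_lt continuous_const ContinuousLinearMap.continuous_det⟩
  refine (contMDiffAt_subtype_iff (U := U) (x := ⟨A, h⟩)).1
    (GLplus_contMDiff_iff (f := fun B : U => GLplus.ofEnd B) ?_ _)
  simp only [fun B : U => GLplus.coe_ofEnd B.2]
  exact contMDiff_subtype_val

section FrameBundle

variable {M : Type u} [TopologicalSpace M] [ChartedSpace E4 M] [IsManifold 𝓘(ℝ, E4) ∞ M]

namespace TangentQuadruples

/-- The trivialization of the bundle of quadruples of tangent vectors induced by a chart. -/
noncomputable abbrev triv (m : M) : Bundle.Trivialization End4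
    (Bundle.TotalSpace.proj : TangentQuadruples M → M) :=
  trivializationAt End4
    (fun x : M => Bundle.Trivial M E4 x →L[ℝ] TangentSpace 𝓘(ℝ, E4) x) m

/-- The trivialization acts on the tangent space only, the target of the linear maps, and thus
commutes with composition on the right. -/
theorem triv_rightMul (m : M) (b : TangentQuadruples M) (g : End4) :
    (triv m (OrientationForm.rightMul b g)).2 = (triv m b).2 * g := by
  have h : ∀ x : M, (trivializationAt E4 (Bundle.Trivial M E4) m).symmL ℝ x =
      ContinuousLinearMap.id ℝ E4 := fun x => by
    simp
  rw [triv, hom_trivializationAt, Bundle.Trivialization.continuousLinearMap_apply,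
    Bundle.Trivialization.continuousLinearMap_apply, h, h]
  rfl

/-- The quadruple at `m` with coordinates `A` in the trivialization at `m₀`. -/
noncomputable def ofTriv (m₀ : M) (x : M × End4) : TangentQuadruples M :=
  (triv m₀).toOpenPartialHomeomorph.symm x

variable {m₀ m : M}

theorem proj_ofTriv (hm : m ∈ (triv m₀).baseSet) (A : End4) : (ofTriv m₀ (m, A)).proj = m :=
  (triv m₀).proj_symm_apply' hm

theorem triv_ofTriv (hm : m ∈ (triv m₀).baseSet) (A : End4) :
    triv m₀ (ofTriv m₀ (m, A)) = (m, A) :=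
  (triv m₀).apply_symm_apply' hm

theorem ofTriv_triv {b : TangentQuadruples M} (hb : b.proj ∈ (triv m₀).baseSet) :
    ofTriv m₀ (b.proj, (triv m₀ b).2) = b :=
  (triv m₀).symm_apply_mk_proj ((triv m₀).mem_source.2 hb)

theorem rightMul_ofTriv (hm : m ∈ (triv m₀).baseSet) (A g : End4) :
    OrientationForm.rightMul (ofTriv m₀ (m, A)) g = ofTriv m₀ (m, A * g) := by
  have e : (OrientationForm.rightMul (ofTriv m₀ (m, A)) g).proj = m := proj_ofTriv hm A
  rw [← ofTriv_triv (m₀ := m₀) (b := OrientationForm.rightMul (ofTriv m₀ (m, A)) g)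
    (by rw [e]; exact hm), triv_rightMul, triv_ofTriv hm, e]

theorem contMDiffOn_ofTriv (m₀ : M) :
    ContMDiffOn (𝓘(ℝ, E4).prod 𝓘(ℝ, End4)) (𝓘(ℝ, E4).prod 𝓘(ℝ, End4)) ∞ (ofTriv m₀)
      (triv m₀).target :=
  (triv m₀).contMDiffOn_symm

theorem contMDiffOn_triv (m₀ : M) :
    ContMDiffOn (𝓘(ℝ, E4).prod 𝓘(ℝ, End4)) 𝓘(ℝ, End4) ∞
      (fun b : TangentQuadruples M => (triv m₀ b).2) (triv m₀).source :=
  contMDiff_snd.comp_contMDiffOn (triv m₀).contMDiffOn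

/-- In bundle coordinates this is the multiplication of endomorphisms. -/
theorem contMDiff_rightMul : ContMDiff ((𝓘(ℝ, E4).prod 𝓘(ℝ, End4)).prod 𝓘(ℝ, End4))
    (𝓘(ℝ, E4).prod 𝓘(ℝ, End4)) ∞
    (fun x : TangentQuadruples M × End4 => OrientationForm.rightMul x.1 x.2) := by
  intro x
  refine Bundle.contMDiffAt_totalSpace.2 ⟨((Bundle.contMDiff_proj _).comp contMDiff_fst) x, ?_⟩
  have h1 : ContMDiffAt ((𝓘(ℝ, E4).prod 𝓘(ℝ, End4)).prod 𝓘(ℝ, End4)) 𝓘(ℝ, End4) ∞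
      (fun y : TangentQuadruples M × End4 => (triv x.1.proj y.1).2) x :=
    ContMDiffAt.comp (g := fun b : TangentQuadruples M => (triv x.1.proj b).2) x
      ((contMDiffOn_triv x.1.proj).contMDiffAt ((triv x.1.proj).open_source.mem_nhds
        ((triv x.1.proj).mem_source.2 (FiberBundle.mem_baseSet_trivializationAt' _))))
      contMDiffAt_fst
  have h2 : ContMDiffAt ((𝓘(ℝ, E4).prod 𝓘(ℝ, End4)).prod 𝓘(ℝ, End4)) 𝓘(ℝ, End4) ∞
      (fun y : TangentQuadruples M × End4 => (triv x.1.proj y.1).2 * y.2) x :=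
    ContMDiffAt.comp (g := fun z : End4 × End4 => z.1 * z.2) x
      (contDiff_mul (𝕜 := ℝ) (𝔸 := End4)).contMDiff.contMDiffAt (h1.prodMk_space contMDiffAt_snd)
  refine h2.congr_of_eventuallyEq (Filter.Eventually.of_forall fun y => ?_)
  exact triv_rightMul _ _ _

end TangentQuadruples

namespace OrientationForm

open TangentQuadruples

variable (o : OrientationForm M)

theorem contMDiff_val : ContMDiff 𝓘(ℝ, E4 × End4) (𝓘(ℝ, E4).prod 𝓘(ℝ, End4)) ∞
    (Subtype.val : o.FPlus → TangentQuadruples M) := by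
  have h : ContMDiff (𝓘(ℝ, E4).prod 𝓘(ℝ, End4)) (𝓘(ℝ, E4).prod 𝓘(ℝ, End4)) ∞
    (Subtype.val : o.positiveFrames → TangentQuadruples M) := contMDiff_subtype_val
  rw [modelWithCornersSelf_prod]
  exact h

variable {o} in
theorem contMDiffWithinAt_iff {E N H : Type*} [NormedAddCommGroup E] [NormedSpace ℝ E]
    [TopologicalSpace H] {I : ModelWithCorners ℝ E H} [TopologicalSpace N] [ChartedSpace H N]
    {f : N → o.FPlus} {s : Set N} {x : N} :
    ContMDiffWithinAt I 𝓘(ℝ, E4 × End4) ∞ f s x ↔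
      ContMDiffWithinAt I (𝓘(ℝ, E4).prod 𝓘(ℝ, End4)) ∞ (fun y => (f y).1) s x := by
  have h := ContMDiffWithinAt.subtypeVal_comp_iff (I := I) (I' := 𝓘(ℝ, E4).prod 𝓘(ℝ, End4))
    o.positiveFrames f s x
  rw [modelWithCornersSelf_prod]
  exact h.symm

theorem contMDiff_proj : ContMDiff 𝓘(ℝ, E4 × End4) 𝓘(ℝ, E4) ∞ o.proj :=
  (Bundle.contMDiff_proj _).comp o.contMDiff_val

theorem contMDiff_act : ContMDiff (𝓘(ℝ, E4 × End4).prod 𝓘(ℝ, End4)) 𝓘(ℝ, E4 × End4) ∞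
    (fun x : o.FPlus × GLplus => op x.2 • x.1) := by
  intro x
  refine contMDiffWithinAt_iff.2 (ContMDiff.contMDiffAt ?_)
  exact contMDiff_rightMul.comp (f := fun x : o.FPlus × GLplus => (x.1.1, ((x.2 : End4ˣ) : End4)))
    ((o.contMDiff_val.comp contMDiff_fst).prodMk (GLplus_contMDiff_coe.comp contMDiff_snd))

theorem form_ofTriv {m₀ m : M} (hm : m ∈ (triv m₀).baseSet) (A g : End4) :
    o.form (ofTriv m₀ (m, A * g)).proj (ofTriv m₀ (m, A * g)).vec =
      g.det * o.form (ofTriv m₀ (m, A)).proj (ofTriv m₀ (m, A)).vec := by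
  rw [← rightMul_ofTriv hm]
  exact o.form_rightMul (ofTriv m₀ (m, A)) g

theorem proj_surjective : Function.Surjective o.proj := by
  intro m
  obtain ⟨v, hv⟩ : ∃ v, o.form m v ≠ 0 := by
    by_contra h
    push Not at h
    exact o.ne_zero m (AlternatingMap.ext h)
  let b : TangentQuadruples M := ⟨m, (ofCols v : E4 →L[ℝ] E4)⟩
  have hb : o.form b.proj b.vec ≠ 0 := by
    have : b.vec = v := funext fun i => ofCols_stdE v i
    rw [this]; exact hv
  -- If the form is negative on the quadruple, changing the sign of the first vector makes it
  -- positive.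
  rcases hb.lt_or_gt with h | h
  · refine ⟨⟨rightMul b (reflEnd (stdE 0)), ?_⟩, rfl⟩
    change 0 < o.form b.proj _
    rw [form_rightMul, det_reflEnd (stdE_ne_zero 0)]
    linarith
  · exact ⟨⟨b, h⟩, rfl⟩

/-- An oriented frame is invertible in coordinates. -/
theorem det_triv_ne_zero (b : o.FPlus) {m₀ : M} (hb : b.1.proj ∈ (triv m₀).baseSet) :
    (triv m₀ b.1).2.det ≠ 0 := by
  intro h
  have h1 : 0 < o.form b.1.proj b.1.vec := b.2
  have h2 := o.form_ofTriv hb 1 (triv m₀ b.1).2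
  rw [one_mul, ofTriv_triv hb, h, zero_mul] at h2
  exact h1.ne' h2

/-- The matrix that takes the frame `b` to the frame `b'` over the same point. -/
noncomputable def div (m₀ : M) (b b' : TangentQuadruples M) : End4 :=
  Ring.inverse (triv m₀ b).2 * (triv m₀ b').2

variable {o}

theorem rightMul_div {b b' : o.FPlus} {m₀ : M} (hb : b.1.proj ∈ (triv m₀).baseSet)
    (h : b.1.proj = b'.1.proj) : rightMul b.1 (div m₀ b.1 b'.1) = b'.1 := by
  have hu := End4.isUnit_of_det_ne_zero (o.det_triv_ne_zero b hb)
  have h1 := rightMul_ofTriv hb (triv m₀ b.1).2 (div m₀ b.1 b'.1)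
  rwa [ofTriv_triv hb, div, Ring.mul_inverse_cancel_left _ _ hu, h, ofTriv_triv (h ▸ hb)] at h1

/-- The form is positive on both frames and scales by the determinant. -/
theorem det_div_pos {b b' : o.FPlus} {m₀ : M} (hb : b.1.proj ∈ (triv m₀).baseSet)
    (h : b.1.proj = b'.1.proj) : 0 < (div m₀ b.1 b'.1).det := by
  have h1 := o.form_rightMul b.1 (div m₀ b.1 b'.1)
  have h2 : 0 < o.form b'.1.proj b'.1.vec := b'.2
  have h3 : 0 < o.form b.1.proj b.1.vec := b.2
  rw [← rightMul_div hb h] at h2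
  exact pos_of_mul_pos_left (h1 ▸ h2) h3.le

theorem act_div {b b' : o.FPlus} {m₀ : M} (hb : b.1.proj ∈ (triv m₀).baseSet)
    (h : b.1.proj = b'.1.proj) : op (GLplus.ofEnd (div m₀ b.1 b'.1)) • b = b' := by
  refine Subtype.ext ?_
  change rightMul b.1 ((GLplus.ofEnd (div m₀ b.1 b'.1) : End4ˣ) : End4) = b'.1
  rw [GLplus.coe_ofEnd (det_div_pos hb h), rightMul_div hb h]

variable (o)

theorem free (b : o.FPlus) (g : GLplus) (h : op g • b = b) : g = 1 := by
  have hb : b.1.proj ∈ (triv b.1.proj).baseSet := FiberBundle.mem_baseSet_trivializationAt' _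
  have hu := End4.isUnit_of_det_ne_zero (o.det_triv_ne_zero b hb)
  have h1 : rightMul b.1 ((g : End4ˣ) : End4) = b.1 := congrArg Subtype.val h
  have h2 := triv_rightMul b.1.proj b.1 ((g : End4ˣ) : End4)
  rw [h1] at h2
  exact GLplus.ext (hu.mul_left_cancel (h2.symm.trans (mul_one _).symm))

-- The section through a given frame is the one with constant coordinates `A`, on the open set where
-- it remains positively oriented; `b₀` is a filler elsewhere. The fibre coordinate is `A⁻¹` times
-- the coordinates of the frame.
open Classical in
theorem exists_isLocalTriv (m₀ : M) : ∃ (U : Set M) (τ : M → o.FPlus) (ψ : o.FPlus → GLplus),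
    m₀ ∈ U ∧ IsLocalTriv End4 E4 (E4 × End4) GLplus o.proj U τ ψ := by
  obtain ⟨b₀, hb₀⟩ := o.proj_surjective m₀
  have hm₀ : m₀ ∈ (triv m₀).baseSet := FiberBundle.mem_baseSet_trivializationAt' _
  let A := (triv m₀ b₀.1).2
  have hs : ContMDiffOn 𝓘(ℝ, E4) (𝓘(ℝ, E4).prod 𝓘(ℝ, End4)) ∞ (fun m => ofTriv m₀ (m, A))
      (triv m₀).baseSet :=
    (contMDiffOn_ofTriv m₀).comp (contMDiffOn_id.prodMk contMDiffOn_const)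
      fun m hm => (triv m₀).mem_target.2 hm
  let f : TangentQuadruples M → ℝ := fun b => o.form b.proj b.vec
  let U : Set M := (triv m₀).baseSet ∩ (fun m => f (ofTriv m₀ (m, A))) ⁻¹' Set.Ioi 0
  have hU : IsOpen U :=
    (o.contMDiff.continuous.comp_continuousOn hs.continuousOn).isOpen_inter_preimage
      (triv m₀).open_baseSet isOpen_Ioi
  let τ : M → o.FPlus := fun m => if h : 0 < f (ofTriv m₀ (m, A)) then ⟨ofTriv m₀ (m, A), h⟩ else b₀
  have hτ : ∀ m ∈ U, (τ m).1 = ofTriv m₀ (m, A) := fun m hm =>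
    congrArg Subtype.val (dif_pos (show 0 < f (ofTriv m₀ (m, A)) from hm.2))
  have hτp : ∀ m ∈ U, (τ m).1.proj = m := fun m hm => by
    rw [hτ m hm]; exact proj_ofTriv hm.1 A
  have hdiv : ∀ p : o.FPlus, o.proj p ∈ U →
      div m₀ (τ (o.proj p)).1 p.1 = Ring.inverse A * (triv m₀ p.1).2 := fun p hp => by
    rw [div, hτ _ hp, triv_ofTriv hp.1]
  refine ⟨U, τ, fun p => GLplus.ofEnd (Ring.inverse A * (triv m₀ p.1).2), ⟨hm₀, ?_⟩, hU, ?_, ?_,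
    hτp, fun p hp => ?_⟩
  · have h1 : ofTriv m₀ (m₀, A) = b₀.1 := by
      subst hb₀
      exact ofTriv_triv hm₀
    change 0 < f (ofTriv m₀ (m₀, A))
    rw [h1]; exact b₀.2
  · intro m hm
    refine contMDiffWithinAt_iff.2 (((hs m hm.1).mono Set.inter_subset_left).congr hτ (hτ m hm))
  · intro p hp
    have hb : (τ (o.proj p)).1.proj ∈ (triv m₀).baseSet := by rw [hτp _ hp]; exact hp.1
    have hdet := det_div_pos hb (hτp _ hp)
    rw [hdiv p hp] at hdet
    have h1 : ContMDiffAt 𝓘(ℝ, E4 × End4) 𝓘(ℝ, End4) ∞ (fun p : o.FPlus => (triv m₀ p.1).2) p :=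
      ContMDiffAt.comp (g := fun b : TangentQuadruples M => (triv m₀ b).2) p
        ((contMDiffOn_triv m₀).contMDiffAt ((triv m₀).open_source.mem_nhds
          ((triv m₀).mem_source.2 hp.1))) o.contMDiff_val.contMDiffAt
    have h2 : ContMDiffAt 𝓘(ℝ, E4 × End4) 𝓘(ℝ, End4) ∞
        (fun p : o.FPlus => Ring.inverse A * (triv m₀ p.1).2) p :=
      ContMDiffAt.comp (g := fun B : End4 => Ring.inverse A * B) p
        (contDiff_const.mul contDiff_id).contMDiff.contMDiffAt h1
    exact (ContMDiffAt.comp (g := GLplus.ofEnd) p (GLplus.contMDiffAt_ofEnd hdet)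
      h2).contMDiffWithinAt
  · have hb : (τ (o.proj p)).1.proj ∈ (triv m₀).baseSet := by rw [hτp _ hp]; exact hp.1
    have h1 := act_div hb (hτp _ hp)
    rwa [hdiv p hp] at h1

theorem isPrincipalBundle : IsPrincipalBundle End4 E4 (E4 × End4) GLplus o.proj :=
  isPrincipalBundle_of_isLocalTriv o.proj_surjective o.contMDiff_proj o.contMDiff_act
    (fun _ _ => rfl)
    (fun b _ h => ⟨_, act_div (FiberBundle.mem_baseSet_trivializationAt' b.1.proj) h⟩)
    o.free o.exists_isLocalTriv

instance : SecondCountableTopology GLplus := isEmbedding_GLplus.secondCountableTopology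

instance [T2Space M] : T2Space o.FPlus := o.isPrincipalBundle.t2Space

theorem paracompactSpace [T2Space M] [ParacompactSpace M] [ConnectedSpace M] :
    ParacompactSpace o.FPlus := by
  have := secondCountable_of_connected_manifold E4 M
  exact o.isPrincipalBundle.paracompactSpace

end OrientationForm

end FrameBundle

theorem mainTheorem4 :
    -- the general case
    (∀ {EM EG EH EGt EHt EP ER : Type*}
      [NormedAddCommGroup EM] [NormedSpace ℝ EM] [FiniteDimensional ℝ EM]
      [NormedAddCommGroup EG] [NormedSpace ℝ EG] [FiniteDimensional ℝ EG]
      [NormedAddCommGroup EH] [NormedSpace ℝ EH] [FiniteDimensional ℝ EH]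
      [NormedAddCommGroup EGt] [NormedSpace ℝ EGt] [FiniteDimensional ℝ EGt]
      [NormedAddCommGroup EHt] [NormedSpace ℝ EHt] [FiniteDimensional ℝ EHt]
      [NormedAddCommGroup EP] [NormedSpace ℝ EP] [FiniteDimensional ℝ EP]
      [NormedAddCommGroup ER] [NormedSpace ℝ ER] [FiniteDimensional ℝ ER]
      -- the base manifold
      {M : Type u} [TopologicalSpace M] [T2Space M] [ParacompactSpace M] [ConnectedSpace M]
      [ChartedSpace EM M] [IsManifold 𝓘(ℝ, EM) ∞ M]
      -- the Lie group `G`, its Lie subgroup `H`, and their universal covering groups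
      {G : Type*} [Group G] [TopologicalSpace G] [T2Space G] [ParacompactSpace G]
      [ConnectedSpace G] [ChartedSpace EG G] [LieGroup 𝓘(ℝ, EG) ∞ G]
      {H : Type*} [Group H] [TopologicalSpace H] [T2Space H] [ParacompactSpace H]
      [ConnectedSpace H] [ChartedSpace EH H] [LieGroup 𝓘(ℝ, EH) ∞ H]
      (ι : H →* G) (hι : ContMDiff 𝓘(ℝ, EH) 𝓘(ℝ, EG) ∞ ι) (_ : Function.Injective ι)
      (_ : Function.Bijective (pi1Map ι hι.continuous (map_one ι)))
      {Gt : Type*} [Group Gt] [TopologicalSpace Gt] [T2Space Gt] [ParacompactSpace Gt]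
      [ChartedSpace EGt Gt] [LieGroup 𝓘(ℝ, EGt) ∞ Gt]
      (ρG : Gt →* G) (_ : IsUniversalCover EGt EG ρG)
      {Ht : Type*} [Group Ht] [TopologicalSpace Ht] [T2Space Ht] [ParacompactSpace Ht]
      [ChartedSpace EHt Ht] [LieGroup 𝓘(ℝ, EHt) ∞ Ht]
      (ρH : Ht →* H) (_ : IsUniversalCover EHt EH ρH)
      -- the principal bundles `P` and `R`, and the reduction map `κ`
      {P : Type u} [TopologicalSpace P] [T2Space P] [ParacompactSpace P]
      [ChartedSpace EP P] [IsManifold 𝓘(ℝ, EP) ∞ P] [MulAction Gᵐᵒᵖ P]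
      (πP : P → M) (hP : IsPrincipalBundle EG EM EP G πP)
      {R : Type u} [TopologicalSpace R] [T2Space R] [ParacompactSpace R]
      [ChartedSpace ER R] [IsManifold 𝓘(ℝ, ER) ∞ R] [MulAction Hᵐᵒᵖ R]
      (πR : R → M) (hR : IsPrincipalBundle EH EM ER H πR)
      (κ : R → P) (hκ : IsBundleMorphism ER EP πR πP ι κ) (r₀ : R),
      -- the squares of the diagram commute
      (∃ (hH : π_ 2 M (πR r₀) →* FundamentalGroup H 1)
          (hG : π_ 2 M (πR r₀) →* FundamentalGroup G 1),
        (∀ a b, ConnectingRel πR r₀ a b ↔ hH a = b) ∧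
        (∀ a b, ConnectingRel πP (κ r₀) a b ↔ hG a = b) ∧
        (pi1Map ι hι.continuous (map_one ι)).comp hH = hG) ∧
      (hκ.pi1 rfl).comp (hR.orbitPi1 r₀) =
        (hP.orbitPi1 (κ r₀)).comp (pi1Map ι hι.continuous (map_one ι)) ∧
      (hP.projPi1 (hκ.proj r₀)).comp (hκ.pi1 rfl) = hR.projPi1 rfl ∧
      -- `κ_*` is an isomorphism
      Function.Bijective (hκ.pi1 (rfl : κ r₀ = κ r₀)) ∧
      -- `κ_*` and its inverse preserve splittings
      (∀ K : Subgroup (FundamentalGroup R r₀),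
        IsSplitting (hR.orbitPi1 r₀) (hR.projPi1 rfl) K ↔
          IsSplitting (hP.orbitPi1 (κ r₀)) (hP.projPi1 (hκ.proj r₀)) (K.map (hκ.pi1 rfl))) ∧
      -- existence of spinor structures
      (Nonempty (SpinorStructure EHt EM ER πR ρH) ↔
        Nonempty (SpinorStructure EGt EM EP πP ρG)) ∧
      -- correspondence of spinor structures, corresponding ones being reductions
      ∃ ιt : Ht →* Gt, ContMDiff 𝓘(ℝ, EHt) 𝓘(ℝ, EGt) ∞ ιt ∧ Function.Injective ιt ∧
        (∀ h, ρG (ιt h) = ι (ρH h)) ∧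
        ∃ Φ : SpinorStructure.Classes EHt EM ER πR ρH ≃ SpinorStructure.Classes EGt EM EP πP ρG,
          ∀ (S : SpinorStructure EHt EM ER πR ρH) (Q : SpinorStructure EGt EM EP πP ρG),
            (Φ ⟦S⟧ = ⟦Q⟧ ↔
              ∀ (s₀ : S.Q) (hs : S.spinorMap s₀ = r₀) (q₀ : Q.Q) (hq : Q.spinorMap q₀ = κ r₀),
                (S.isBundleMorphism.pi1 hs).range.map (hκ.pi1 rfl) =
                  (Q.isBundleMorphism.pi1 hq).range) ∧
            (Φ ⟦S⟧ = ⟦Q⟧ → ∃ κt : S.Q → Q.Q, IsBundleMorphism ER EP S.proj Q.proj ιt κt ∧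
              ∀ s, Q.spinorMap (κt s) = κ (S.spinorMap s))) ∧
    -- Lorentz structures
    (∀ {EGt ELt ER : Type*}
      [NormedAddCommGroup EGt] [NormedSpace ℝ EGt] [FiniteDimensional ℝ EGt]
      [NormedAddCommGroup ELt] [NormedSpace ℝ ELt] [FiniteDimensional ℝ ELt]
      [NormedAddCommGroup ER] [NormedSpace ℝ ER] [FiniteDimensional ℝ ER]
      -- the oriented 4-manifold
      {M : Type u} [TopologicalSpace M] [T2Space M] [ParacompactSpace M] [ConnectedSpace M]
      [ChartedSpace E4 M] [IsManifold 𝓘(ℝ, E4) ∞ M] (o : OrientationForm M)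
      -- the universal covering groups
      {Gt : Type*} [Group Gt] [TopologicalSpace Gt] [T2Space Gt] [ParacompactSpace Gt]
      [ChartedSpace EGt Gt] [LieGroup 𝓘(ℝ, EGt) ∞ Gt]
      (ρG : Gt →* GLplus) (_ : IsUniversalCover EGt End4 ρG)
      {Lt : Type*} [Group Lt] [TopologicalSpace Lt] [T2Space Lt] [ParacompactSpace Lt]
      [ChartedSpace ELt Lt] [LieGroup 𝓘(ℝ, ELt) ∞ Lt]
      (ρL : Lt →* SO13₀) (_ : IsUniversalCover ELt LieO13 ρL)
      -- the Lorentz structure, a reduction of the oriented frame bundle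
      {R : Type u} [TopologicalSpace R] [T2Space R] [ParacompactSpace R]
      [ChartedSpace ER R] [IsManifold 𝓘(ℝ, ER) ∞ R] [MulAction SO13₀ᵐᵒᵖ R]
      (πR : R → M) (_ : IsPrincipalBundle LieO13 E4 ER SO13₀ πR)
      (κ : R → o.FPlus) (_ : IsBundleMorphism ER (E4 × End4) πR o.proj SO13₀.incl κ),
      (Nonempty (SpinorStructure ELt E4 ER πR ρL) ↔
        Nonempty (SpinorStructure EGt E4 (E4 × End4) o.proj ρG)) ∧
      ∃ ιt : Lt →* Gt, ContMDiff 𝓘(ℝ, ELt) 𝓘(ℝ, EGt) ∞ ιt ∧ Function.Injective ιt ∧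
        (∀ h, ρG (ιt h) = SO13₀.incl (ρL h)) ∧
        ∀ S : SpinorStructure ELt E4 ER πR ρL,
          ∃ (Q : SpinorStructure EGt E4 (E4 × End4) o.proj ρG) (κt : S.Q → Q.Q),
            IsBundleMorphism ER (E4 × End4) S.proj Q.proj ιt κt ∧
            ∀ s, Q.spinorMap (κt s) = κ (S.spinorMap s)) := by
  refine ⟨?_, ?_⟩
  · intros
    exact IsBundleMorphism.spinorStructures_of_reduction _ ‹_› ‹_› ‹_› _ ‹_› _ ‹_› _ ‹_› _ ‹_› _ ‹_› _
  · intro EGt ELt ER _ _ _ _ _ _ _ _ _ M _ _ _ _ _ _ o Gt _ _ _ _ _ _ ρG hρG Lt _ _ _ _ _ _ ρL hρL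
      R _ _ _ _ _ _ πR hR κ hκ
    have := o.paracompactSpace
    obtain ⟨m⟩ : Nonempty M := inferInstance
    -- The conclusion does not mention a base point; any one serves to apply the general case.
    obtain ⟨r₀, -⟩ := hR.surjective m
    obtain ⟨-, -, -, -, -, hne, ιt, hιt, hinj, hρ, Φ, hΦ⟩ :=
      hκ.spinorStructures_of_reduction SO13₀.incl SO13₀.contMDiff_incl SO13₀.incl_injective
        SO13₀.bijective_pi1Map_incl ρG hρG ρL hρL o.proj o.isPrincipalBundle πR hR κ r₀
    refine ⟨hne, ιt, hιt, hinj, hρ, fun S => ?_⟩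
    -- Any representative of the class corresponding to `S` will do.
    obtain ⟨Q, hQ⟩ := Quotient.exists_rep (Φ ⟦S⟧)
    obtain ⟨κt, h⟩ := (hΦ S Q).2 hQ.symm
    exact ⟨Q, κt, h⟩
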